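/- Let $k$ be any field, let $B=k[[X,Y,Z,W]]/[(X^2,Y^2)\cap(Z,W)]$, and let $x,y,z,w$ denote the images of $X,Y,Z,W$ in $B$. Put $J=(x,y)^2+(z,w)\subseteq B$ and $A=k+J\subseteq B$, a $k$-subalgebra of $B$. Then $A$ is a two-dimensional Noetherian local ring with maximal ideal $\mathfrak m=J$, and $B$ is a module-finite extension of $A$. Let $$Q=(x^2-z,\;y^2-w)A,\qquad Q'=(xy-z,\;x^2+y^2-w)A .$$ For a Noetherian local ring $(R,\mathfrak n)$ of dimension $d>0$, a parameter ideal is an ideal $\mathfrak q$ generated by $d$ elements with $\sqrt{\mathfrak q}=\mathfrak n$. Its Hilbert coefficients $e^i_{\mathfrak q}(R)\in\mathbb Z$ are defined by $$\ell_R(R/\mathfrak q^{n+1})=\sum_{i=0}^d(-1)^i e^i_{\mathfrak q}(R)\binom{n+d-i}{d-i}\qquad (n\gg0).$$ For an $\mathfrak n$-primary ideal $I$ let $\Lambda(I)=\{e^1_{\mathfrak q}(R) : \mathfrak q \text{ a parameter ideal of } R,\ \overline{\mathfrak q}=\overline I\}$, where the bar denotes the integral closure of ideals. An ideal $\mathfrak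 q\subseteq I$ is a reduction of $I$ if $I^{n+1}=\mathfrak q I^n$ for some $n\ge 0$, and a minimal reduction if it is minimal with respect to inclusion among the reductions of $I$. Let $\mathcal R(\mathfrak q)=R[\mathfrak q t]\subseteq R[t]$ be the Rees algebra, and for a reduction $\mathfrak q$ of $I$ let $S_{\mathfrak q}(I)=I\mathcal R(I)/I\mathcal R(\mathfrak q)\cong\bigoplus_{n\ge1}I^{n+1}/\mathfrak q^nI$ be the Sally module, a module over $\mathcal R(\mathfrak q)$. Then $Q$ and $Q'$ are parameter ideals of $A$ and minimal reductions of $\mathfrak m$, and $$e^1_{Q'}(A)=e^1_Q(A)+1=-5 .$$ Moreover, with $T=\mathcal R(Q)$, $T'=\mathcal R(Q')$, $S=S_Q(\mathfrak m)$, $S'=S_{Q'}(\mathfrak m)$, the ideals $\mathfrak p=\mathfrak mT$ and $\mathfrak p'=\mathfrak mT'$ are prime and $$\ell_{T_{\mathfrak p}}(S_{\mathfrak p})=1,\qquad \ell_{T'_{\mathfrak p'}}(S'_{\mathfrak p'})=0 .$$ Hence $\sharp\Lambda(\mathfrak m)>1$. In particular, it is not true that $\sharp\Lambda(I)=1$ for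 every Noetherian local ring of positive dimension and every ideal $I$ primary to its maximal ideal; it already fails for $I=\mathfrak m$ in $A$. -/

import Mathlib

universe u

open Filter Polynomial

noncomputable section

namespace HilbertCoeff

section General

variable {A : Type u} [CommRing A]

/-- `c` is the `i`-th Hilbert coefficient `e_I^i(A)` of `A` with respect to `I`: with `d = dim A` there are
integers `e 0, …, e d` with `e i = c` such that, for all large `n`, the `A`-module `A / I ^ (n + 1)`
has finite length equal to `∑_{j ≤ d} (-1)^j * e j * binom (n + d - j) (d - j)`. -/
def IsHilbertCoefficient (I : Ideal A) (i : ℕ) (c : ℤ) : Prop :=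
  ∃ (d : ℕ) (e : ℕ → ℤ), ringKrullDim A = (d : WithBot ℕ∞) ∧ i ≤ d ∧ e i = c ∧
    ∀ᶠ n : ℕ in atTop, ∃ l : ℕ, Module.length A (A ⧸ I ^ (n + 1)) = (l : ℕ∞) ∧
      (l : ℤ) = ∑ j ∈ Finset.range (d + 1),
        (-1 : ℤ) ^ j * e j * (Nat.choose (n + d - j) (d - j) : ℤ)

/-- The integral closure of the ideal `I`, as a set: all `x` that satisfy an equation
`x ^ n + a 1 * x ^ (n - 1) + ⋯ + a n = 0` with `n ≥ 1` and `a i ∈ I ^ i`. -/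
def idealIntegralClosure (I : Ideal A) : Set A :=
  {x | ∃ n : ℕ, 0 < n ∧ ∃ a : ℕ → A, (∀ i, a i ∈ I ^ i) ∧
    x ^ n + ∑ i ∈ Finset.Icc 1 n, a i * x ^ (n - i) = 0}

/-- `Q` is a reduction of `I`. -/
def IsReduction (Q I : Ideal A) : Prop :=
  Q ≤ I ∧ ∃ n : ℕ, I ^ (n + 1) = Q * I ^ n

/-- `Q` is a minimal reduction of `I`: it is minimal, with respect to inclusion, among the
reductions of `I`. -/
def IsMinimalReduction (Q I : Ideal A) : Prop :=
  Minimal (fun K : Ideal A => IsReduction K I) Q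

/-- `Q` is a parameter ideal of the local ring `A`: it is generated by `dim A` elements
and its radical is the maximal ideal. -/
def IsParameterIdeal [IsLocalRing A] (Q : Ideal A) : Prop :=
  ∃ d : ℕ, ringKrullDim A = (d : WithBot ℕ∞) ∧
    (∃ a : Fin d → A, Q = Ideal.span (Set.range a)) ∧
    Q.radical = IsLocalRing.maximalIdeal A

/-- `Λ(I)`, the set of the first Hilbert coefficients `e_Q^1(A)`, where `Q` runs through the parameter ideals
of `A` with the same integral closure as `I`. -/
def Lambda [IsLocalRing A] (I : Ideal A) : Set ℤ :=
  {c | ∃ Q : Ideal A, IsParameterIdeal Q ∧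
    idealIntegralClosure Q = idealIntegralClosure I ∧ IsHilbertCoefficient Q 1 c}

/-- `I * R(I)`, where `R(I) = A[It] ⊆ A[t]` is the Rees algebra, as an `R(Q)`-submodule of `A[t]`
(for `Q ≤ I`, the products `a * f` with `a ∈ I`, `f ∈ R(I)` span it over `R(Q) ⊆ R(I)`). -/
def reesTop (Q I : Ideal A) : Submodule (reesAlgebra Q) A[X] :=
  Submodule.span (reesAlgebra Q) {g | ∃ a ∈ I, ∃ f ∈ reesAlgebra I, g = C a * f}

/-- `I * R(Q)` as an `R(Q)`-submodule of `A[t]`. -/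
def reesBot (Q I : Ideal A) : Submodule (reesAlgebra Q) A[X] :=
  Submodule.span (reesAlgebra Q) {g | ∃ a ∈ I, g = C a}

/-- The quotient module `N₁ / N₂` of two submodules with `N₂ ≤ N₁`. -/
abbrev SubQuotient {T M : Type u} [Ring T] [AddCommGroup M] [Module T M]
    (N₁ N₂ : Submodule T M) : Type u :=
  N₁ ⧸ N₂.submoduleOf N₁

/-- The Sally module `S_Q(I) = I R(I) / I R(Q)`, a module over the Rees algebra `R(Q)`; its
component of degree `n` is `I ^ (n + 1) / Q ^ n I`. -/
abbrev SallyModule (Q I : Ideal A) : Type u :=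
  SubQuotient (T := reesAlgebra Q) (reesTop Q I) (reesBot Q I)

/-- The extension `𝔪 R(Q)` of the ideal `𝔪` of `A` to the Rees algebra `R(Q)`. -/
abbrev extendedIdeal (m Q : Ideal A) : Ideal (reesAlgebra Q) :=
  m.map (algebraMap A (reesAlgebra Q))

/-- With `T = R(Q)`, the ideal `𝔭 = 𝔪T` is prime and the localization at `𝔭` of the Sally module
`S_Q(𝔪)` has length `l` over `T_𝔭`. -/
def HasLocalSallyLength (Q m : Ideal A) (l : ℕ∞) : Prop :=
  ∃ _ : (extendedIdeal m Q).IsPrime,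
    Module.length (Localization.AtPrime (extendedIdeal m Q))
      (LocalizedModule (extendedIdeal m Q).primeCompl (SallyModule Q m)) = l

end General

/-- The assertion that `Λ(I)` has exactly one element for every Noetherian local ring `A` of
positive dimension and every ideal `I` of `A` that is primary to the maximal ideal. -/
def LambdaAlwaysSingleton : Prop :=
  ∀ (A : Type u) [CommRing A] [IsNoetherianRing A] [IsLocalRing A], 0 < ringKrullDim A →
    ∀ I : Ideal A, I.radical = IsLocalRing.maximalIdeal A → (Lambda I).encard = 1

/-- The subalgebra `k + J` of a `k`-algebra `B`, for an ideal `J` of `B`. -/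
def fieldPlus (k : Type u) [Field k] {B : Type u} [CommRing B] [Algebra k B] (J : Ideal B) :
    Subalgebra k B where
  carrier := {b | ∃ c : k, ∃ j ∈ J, b = algebraMap k B c + j}
  algebraMap_mem' c := ⟨c, 0, J.zero_mem, by simp⟩
  add_mem' := by
    rintro _ _ ⟨c, j, hj, rfl⟩ ⟨c', j', hj', rfl⟩
    exact ⟨c + c', j + j', J.add_mem hj hj', by rw [map_add]; ring⟩
  mul_mem' := by
    rintro _ _ ⟨c, j, hj, rfl⟩ ⟨c', j', hj', rfl⟩
    refine ⟨c * c', algebraMap k B c * j' + (algebraMap k B c' + j') * j,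
      J.add_mem (J.mul_mem_left _ hj') (J.mul_mem_left _ hj), ?_⟩
    rw [map_mul]; ring

section Example

variable (k : Type u) [Field k]

/-- The ideal `(X², Y²) ∩ (Z, W)` of `k[[X, Y, Z, W]]`; the variables are numbered `0, 1, 2, 3`. -/
def idealK : Ideal (MvPowerSeries (Fin 4) k) :=
  Ideal.span {MvPowerSeries.X 0 ^ 2, MvPowerSeries.X 1 ^ 2} ⊓
    Ideal.span {MvPowerSeries.X 2, MvPowerSeries.X 3}

/-- `B = k[[X, Y, Z, W]] / ((X², Y²) ∩ (Z, W))`. -/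
abbrev B : Type u := MvPowerSeries (Fin 4) k ⧸ idealK k

/-- The images `x, y, z, w` in `B` of the variables. -/
def v (i : Fin 4) : B k := Ideal.Quotient.mk (idealK k) (MvPowerSeries.X i)

/-- `J = (x, y)² + (z, w)`. -/
def J : Ideal (B k) := Ideal.span {v k 0, v k 1} ^ 2 ⊔ Ideal.span {v k 2, v k 3}

/-- `A = k + J ⊆ B`. -/
abbrev A : Subalgebra k (B k) := fieldPlus k (J k)

/-- An element of `J`, seen in `A`. -/
def ofJ (b : B k) (hb : b ∈ J k) : A k := ⟨b, 0, b, hb, by simp⟩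

theorem mul_mem_J {a b : B k} (ha : a = v k 0 ∨ a = v k 1) (hb : b = v k 0 ∨ b = v k 1) :
    a * b ∈ J k := by
  refine Ideal.mem_sup_left ?_
  rw [pow_two]
  exact Ideal.mul_mem_mul (Ideal.subset_span ha) (Ideal.subset_span hb)

theorem z_mem_J : v k 2 ∈ J k := Ideal.mem_sup_right (Ideal.subset_span (Or.inl rfl))

theorem w_mem_J : v k 3 ∈ J k := Ideal.mem_sup_right (Ideal.subset_span (Or.inr rfl))

theorem x_sq_mem_J : v k 0 ^ 2 ∈ J k := by
  rw [pow_two]; exact mul_mem_J k (Or.inl rfl) (Or.inl rfl)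

theorem y_sq_mem_J : v k 1 ^ 2 ∈ J k := by
  rw [pow_two]; exact mul_mem_J k (Or.inr rfl) (Or.inr rfl)

/-- `Q = (x² - z, y² - w) A`. -/
def Q : Ideal (A k) :=
  Ideal.span
    {ofJ k (v k 0 ^ 2 - v k 2) ((J k).sub_mem (x_sq_mem_J k) (z_mem_J k)),
     ofJ k (v k 1 ^ 2 - v k 3) ((J k).sub_mem (y_sq_mem_J k) (w_mem_J k))}

/-- `Q' = (xy - z, x² + y² - w) A`. -/
def Q' : Ideal (A k) :=
  Ideal.span
    {ofJ k (v k 0 * v k 1 - v k 2)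
       ((J k).sub_mem (mul_mem_J k (Or.inl rfl) (Or.inr rfl)) (z_mem_J k)),
     ofJ k (v k 0 ^ 2 + v k 1 ^ 2 - v k 3)
       ((J k).sub_mem ((J k).add_mem (x_sq_mem_J k) (y_sq_mem_J k)) (w_mem_J k))}

end Example

end HilbertCoeff

end

/-!
The ring `B` has as a topological basis over `k` the monomials in `x, y, z, w` that lie outside the
monomial ideal `(X², Y²) ∩ (Z, W)`. If `x, y` have weight one and `z, w` weight two, then `J ^ n` is
the ideal of all elements of weight at least `2 n` (`mem_J_pow_iff`). As `J` is an ideal of `A` and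
of `B`, products with `m` in `A` can be computed in `B` (`IsFieldPlus.mem_mul_iff`); counting
monomials gives `ℓ(m ^ n / m ^ (n + 1)) = 8 n + 6` for `n ≥ 2`
(`length_quotient_maximalIdeal_pow_succ`).

Write `p = x²`, `q = y²` and `r = xy`, so that `p` and `q` kill `z` and `w`. Both the ideals
`Q = (p - z, q - w)` and `Q' = (r - z, p + q - w)` satisfy `m ^ 3 = Q m ^ 2`. Modulo `x` and `y`
the generators become `-z` and `-w`; hence they are analytically independent
(`analyticallyIndependent_of_mem_span`). Therefore `R(Q) / m R(Q)` is a polynomial ring, `m R(Q)` is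
prime and `ℓ(Q ^ n / Q ^ n m) = n + 1`. Minimality of the reductions is tested with homomorphisms
from `A` to `k[[X]]` that are induced by homomorphisms on `B` vanishing at `x` and `y`
(`isMinimalReduction_span_pair`).

The Hilbert function of `Q` is now determined by the lengths of the components
`m ^ (n + 1) / Q ^ n m` of the Sally module: if they are eventually `s₁ n + s₀`, then the first
coefficient is `-5 - s₁` (`isHilbertCoefficient_one_of_length`).

For `Q`, the component of degree `n ≥ 1` has as a basis the products of `r` with the monomials of
degree `n` in `p` and `q`. Linear independence is the delicate point
(`eq_zero_of_mul_formEval_mem`): the coefficient of `x ^ (2 i + 1) y ^ (2 (n - i) + 1)` does not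
vanish on `Q ^ n`, but its difference to `(-1) ^ n` times the coefficient of `x y z ^ i w ^ (n - i)`
does. So `s₁ = 1`, and at `m R(Q)` the Sally module becomes the residue field, generated by `r p t`
(`hasLocalSallyLength_one_of_linear`).

For `Q'`, the component of degree `n ≥ 1` is spanned by `(r - z) ^ (n - 1) r²`, and `(p + q - w) r²`
lies in `Q' ^ 2 m`. So the lengths are at most one and eventually constant, `s₁ = 0`, and the
element `(p + q - w) t` outside `m R(Q')` kills the Sally module
(`hasLocalSallyLength_zero_of_square`).

A reduction of `m` has the integral closure `m` (`IsReduction.idealIntegralClosure_eq`), so that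
both `-6` and `-5` belong to `Λ(m)`.
-/

noncomputable section

namespace HilbertCoeff

/-! ### Monomial ideals of power series rings -/

section MonomialIdeals

/-- A power series all of whose exponents lie above some element of the finite set `S` is a
combination of the monomials with exponents in `S`; the coefficients can be chosen by
distributing the terms of `f`, so that no new terms appear. -/
theorem exists_eq_sum_monomial_mul {σ R : Type*} [CommRing R] (S : Finset (σ →₀ ℕ))
    (f : MvPowerSeries σ R) (h : ∀ e, MvPowerSeries.coeff e f ≠ 0 → ∃ s ∈ S, s ≤ e) :
    ∃ g : (σ →₀ ℕ) → MvPowerSeries σ R,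
      f = ∑ s ∈ S, MvPowerSeries.monomial s 1 * g s ∧
      ∀ s e, MvPowerSeries.coeff (e + s) f = 0 → MvPowerSeries.coeff e (g s) = 0 := by
  classical
  choose! c hcS hc using h
  let g : (σ →₀ ℕ) → MvPowerSeries σ R :=
    fun s e => if c (e + s) = s then MvPowerSeries.coeff (e + s) f else 0
  have hg : ∀ s e, MvPowerSeries.coeff e (g s) =
    if c (e + s) = s then MvPowerSeries.coeff (e + s) f else 0 := fun _ _ => rfl
  refine ⟨g, ?_, fun s e he => by rw [hg, he, ite_self]⟩
  ext e
  have key : ∀ s ∈ S, MvPowerSeries.coeff e (MvPowerSeries.monomial s 1 * g s) =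
      if c e = s then MvPowerSeries.coeff e f else 0 := by
    intro s _
    rw [MvPowerSeries.coeff_monomial_mul, one_mul, hg]
    by_cases hs : s ≤ e
    · rw [if_pos hs, tsub_add_cancel_of_le hs]
    · rw [if_neg hs]
      by_cases h0 : MvPowerSeries.coeff e f = 0
      · simp [h0]
      · rw [if_neg]
        rintro rfl
        exact hs (hc e h0)
  rw [map_sum, Finset.sum_congr rfl key]
  by_cases h0 : MvPowerSeries.coeff e f = 0
  · simp [h0]
  · rw [Finset.sum_ite_eq, if_pos (hcS e h0)]

/-- The ideal of the power series without terms in `U`, where `U` is closed under divisors. -/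
def supportIdeal {σ : Type*} (R : Type*) [CommRing R] (U : LowerSet (σ →₀ ℕ)) :
    Ideal (MvPowerSeries σ R) where
  carrier := {f | ∀ e ∈ U, MvPowerSeries.coeff e f = 0}
  add_mem' hf hg e he := by rw [map_add, hf e he, hg e he, add_zero]
  zero_mem' e _ := map_zero _
  smul_mem' g f hf e he := by
    classical
    rw [smul_eq_mul, MvPowerSeries.coeff_mul]
    refine Finset.sum_eq_zero fun p hp => ?_
    rw [Finset.HasAntidiagonal.mem_antidiagonal] at hp
    rw [hf p.2 (U.lower (hp ▸ le_add_self) he), mul_zero]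

theorem mem_span_monomial_iff {σ R : Type*} [CommRing R] (S : Finset (σ →₀ ℕ))
    (f : MvPowerSeries σ R) :
    f ∈ Ideal.span ((fun s => MvPowerSeries.monomial s (1 : R)) '' (S : Set (σ →₀ ℕ))) ↔
      ∀ e, (∀ s ∈ S, ¬ s ≤ e) → MvPowerSeries.coeff e f = 0 := by
  classical
  constructor
  · intro hf
    let U : LowerSet (σ →₀ ℕ) :=
      ⟨{e | ∀ s ∈ S, ¬ s ≤ e}, fun _ _ hle he s hs hse => he s hs (hse.trans hle)⟩
    have hU : Ideal.span ((fun s => MvPowerSeries.monomial s (1 : R)) '' (S : Set (σ →₀ ℕ))) ≤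
        supportIdeal R U := by
      rw [Ideal.span_le]
      rintro _ ⟨s, hs, rfl⟩ e he
      rw [MvPowerSeries.coeff_monomial, if_neg]
      rintro rfl
      exact he _ hs le_rfl
    exact hU hf
  · intro hf
    obtain ⟨g, hfg, -⟩ := exists_eq_sum_monomial_mul S f (by
      intro e he
      by_contra! h
      exact he (hf e h))
    rw [hfg]
    exact Ideal.sum_mem _ fun s hs =>
      Ideal.mul_mem_right _ _ (Ideal.subset_span (Set.mem_image_of_mem _ hs))

end MonomialIdeals

/-! ### The filtration of `B` by weight -/

section Coefficients

variable (k : Type u) [Field k]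

/-- The exponent of the monomial `X ^ a * Y ^ b * Z ^ c * W ^ d`. -/
def expo (a b c d : ℕ) : Fin 4 →₀ ℕ := Finsupp.equivFunOnFinite.symm ![a, b, c, d]

@[simp] theorem expo_zero (a b c d : ℕ) : expo a b c d 0 = a := rfl
@[simp] theorem expo_one (a b c d : ℕ) : expo a b c d 1 = b := rfl
@[simp] theorem expo_two (a b c d : ℕ) : expo a b c d 2 = c := rfl
@[simp] theorem expo_three (a b c d : ℕ) : expo a b c d 3 = d := rfl

theorem expo_ext {e e' : Fin 4 →₀ ℕ} (h0 : e 0 = e' 0) (h1 : e 1 = e' 1) (h2 : e 2 = e' 2)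
    (h3 : e 3 = e' 3) : e = e' := by
  ext i; fin_cases i <;> assumption

theorem expo_le {a b c d : ℕ} {e : Fin 4 →₀ ℕ} (h0 : a ≤ e 0) (h1 : b ≤ e 1) (h2 : c ≤ e 2)
    (h3 : d ≤ e 3) : expo a b c d ≤ e := by
  intro i; fin_cases i <;> assumption

theorem expo_eq_iff {a b c d a' b' c' d' : ℕ} :
    expo a b c d = expo a' b' c' d' ↔ a = a' ∧ b = b' ∧ c = c' ∧ d = d' := by
  constructor
  · intro h
    exact ⟨DFunLike.congr_fun h 0, DFunLike.congr_fun h 1, DFunLike.congr_fun h 2,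
      DFunLike.congr_fun h 3⟩
  · rintro ⟨rfl, rfl, rfl, rfl⟩; rfl

theorem monomial_expo (a b c d : ℕ) : MvPowerSeries.monomial (expo a b c d) (1 : k) =
    MvPowerSeries.X 0 ^ a * MvPowerSeries.X 1 ^ b * MvPowerSeries.X 2 ^ c *
      MvPowerSeries.X 3 ^ d := by
  simp only [MvPowerSeries.X_pow_eq, MvPowerSeries.monomial_mul_monomial, mul_one]
  congr 2
  apply expo_ext <;> simp

/-- The weight of an exponent, where `X, Y` have weight `1` and `Z, W` have weight `2`. -/
def wt (e : Fin 4 →₀ ℕ) : ℕ := e 0 + e 1 + 2 * e 2 + 2 * e 3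

/-- The exponents of the monomials outside `(X², Y²) ∩ (Z, W)`; their images form a topological
basis of `B`. -/
def IsStandard (e : Fin 4 →₀ ℕ) : Prop := (e 0 ≤ 1 ∧ e 1 ≤ 1) ∨ (e 2 = 0 ∧ e 3 = 0)

theorem wt_add (e e' : Fin 4 →₀ ℕ) : wt (e + e') = wt e + wt e' := by
  simp only [wt, Finsupp.add_apply]; ring

/-- The power series without terms of weight less than `N`. -/
def weightIdeal (N : ℕ) : Ideal (MvPowerSeries (Fin 4) k) :=
  supportIdeal k ⟨{e | wt e < N}, fun e e' hle he => by
    have : wt e' ≤ wt e := by rw [← add_tsub_cancel_of_le hle, wt_add]; exact le_self_add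
    exact this.trans_lt he⟩

theorem mem_weightIdeal {N : ℕ} {f : MvPowerSeries (Fin 4) k} :
    f ∈ weightIdeal k N ↔ ∀ e, wt e < N → MvPowerSeries.coeff e f = 0 := Iff.rfl

theorem mul_mem_weightIdeal {M N : ℕ} {f g : MvPowerSeries (Fin 4) k} (hf : f ∈ weightIdeal k M)
    (hg : g ∈ weightIdeal k N) : f * g ∈ weightIdeal k (M + N) := by
  classical
  rw [mem_weightIdeal] at hf hg ⊢
  intro e he
  rw [MvPowerSeries.coeff_mul]
  refine Finset.sum_eq_zero fun p hp => ?_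
  rw [Finset.HasAntidiagonal.mem_antidiagonal] at hp
  rw [← hp] at he
  by_cases h : wt p.1 < M
  · rw [hf _ h, zero_mul]
  · rw [hg p.2 ?_, mul_zero]
    rw [wt_add] at he
    omega

theorem monomial_mem_weightIdeal {e : Fin 4 →₀ ℕ} {N : ℕ} (h : N ≤ wt e) (a : k) :
    MvPowerSeries.monomial e a ∈ weightIdeal k N := by
  classical
  rw [mem_weightIdeal]
  intro e' he'
  rw [MvPowerSeries.coeff_monomial, if_neg]
  rintro rfl
  omega

/-- The ideal `(X, Y)² + (Z, W)` of the power series ring. -/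
def idealJ : Ideal (MvPowerSeries (Fin 4) k) :=
  Ideal.span {MvPowerSeries.X 0, MvPowerSeries.X 1} ^ 2 ⊔
    Ideal.span {MvPowerSeries.X 2, MvPowerSeries.X 3}

theorem map_idealJ : (idealJ k).map (Ideal.Quotient.mk (idealK k)) = J k := by
  simp [idealJ, J, v, Ideal.map_sup, Ideal.map_pow, Ideal.map_span, Set.image_pair]

theorem X_eq_monomial_expo :
    MvPowerSeries.X (0 : Fin 4) = MvPowerSeries.monomial (expo 1 0 0 0) (1 : k) ∧
    MvPowerSeries.X (1 : Fin 4) = MvPowerSeries.monomial (expo 0 1 0 0) (1 : k) ∧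
    MvPowerSeries.X (2 : Fin 4) = MvPowerSeries.monomial (expo 0 0 1 0) (1 : k) ∧
    MvPowerSeries.X (3 : Fin 4) = MvPowerSeries.monomial (expo 0 0 0 1) (1 : k) := by
  simp [monomial_expo]

theorem idealJ_le_weightIdeal : idealJ k ≤ weightIdeal k 2 := by
  obtain ⟨h0, h1, h2, h3⟩ := X_eq_monomial_expo k
  have hXY : Ideal.span {MvPowerSeries.X 0, MvPowerSeries.X 1} ≤ weightIdeal k 1 := by
    rw [Ideal.span_le, Set.pair_subset_iff, h0, h1]
    exact ⟨monomial_mem_weightIdeal k (by simp [wt]) _,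
      monomial_mem_weightIdeal k (by simp [wt]) _⟩
  refine sup_le ?_ ?_
  · rw [pow_two, Ideal.mul_le]
    exact fun f hf g hg => mul_mem_weightIdeal k (hXY hf) (hXY hg)
  · rw [Ideal.span_le, Set.pair_subset_iff, h2, h3]
    exact ⟨monomial_mem_weightIdeal k (by simp [wt]) _,
      monomial_mem_weightIdeal k (by simp [wt]) _⟩

theorem monomial_mem_idealJ {e : Fin 4 →₀ ℕ}
    (h : e ∈ ({expo 2 0 0 0, expo 1 1 0 0, expo 0 2 0 0, expo 0 0 1 0, expo 0 0 0 1} :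
      Set (Fin 4 →₀ ℕ))) : MvPowerSeries.monomial e (1 : k) ∈ idealJ k := by
  have hX : (MvPowerSeries.X 0 : MvPowerSeries (Fin 4) k) ∈
      Ideal.span {MvPowerSeries.X 0, MvPowerSeries.X 1} := Ideal.subset_span (Or.inl rfl)
  have hY : (MvPowerSeries.X 1 : MvPowerSeries (Fin 4) k) ∈
      Ideal.span {MvPowerSeries.X 0, MvPowerSeries.X 1} := Ideal.subset_span (Or.inr rfl)
  rcases h with rfl | rfl | rfl | rfl | rfl <;> simp only [monomial_expo, pow_zero, mul_one,
    one_mul, pow_one]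
  · exact Ideal.mem_sup_left (Ideal.pow_mem_pow hX 2)
  · exact Ideal.mem_sup_left (by rw [pow_two]; exact Ideal.mul_mem_mul hX hY)
  · exact Ideal.mem_sup_left (Ideal.pow_mem_pow hY 2)
  · exact Ideal.mem_sup_right (Ideal.subset_span (Or.inl rfl))
  · exact Ideal.mem_sup_right (Ideal.subset_span (Or.inr rfl))

/-- The powers of `(X, Y)² + (Z, W)` are the ideals of series of weight at least `2 n`: a monomial
of weight at least `2` is divisible by one of the five generators, which have weight exactly `2`. -/
theorem idealJ_pow (n : ℕ) : idealJ k ^ n = weightIdeal k (2 * n) := by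
  classical
  apply le_antisymm
  · induction n with
    | zero => intro f _; rw [mem_weightIdeal]; intro e he; omega
    | succ n ih =>
      rw [pow_succ, Ideal.mul_le]
      exact fun f hf g hg => mul_mem_weightIdeal k (ih hf) (idealJ_le_weightIdeal k hg)
  · induction n with
    | zero => simp
    | succ n ih =>
      intro f hf
      rw [mem_weightIdeal] at hf
      obtain ⟨g, hfg, hg⟩ := exists_eq_sum_monomial_mul
        {expo 2 0 0 0, expo 1 1 0 0, expo 0 2 0 0, expo 0 0 1 0, expo 0 0 0 1} f (by
          intro e he
          have hwt : 2 ≤ wt e := by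
            by_contra hlt
            exact he (hf e (by omega))
          simp only [Finset.mem_insert, Finset.mem_singleton, exists_eq_or_imp, exists_eq_left]
          unfold wt at hwt
          by_cases h2 : 1 ≤ e 2
          · exact Or.inr (Or.inr (Or.inr (Or.inl (expo_le (by simp) (by simp) h2 (by simp)))))
          by_cases h3 : 1 ≤ e 3
          · exact Or.inr (Or.inr (Or.inr (Or.inr (expo_le (by simp) (by simp) (by simp) h3))))
          by_cases h0 : 2 ≤ e 0
          · exact Or.inl (expo_le h0 (by simp) (by simp) (by simp))
          by_cases h1 : 2 ≤ e 1
          · exact Or.inr (Or.inr (Or.inl (expo_le (by simp) h1 (by simp) (by simp))))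
          · exact Or.inr (Or.inl (expo_le (by omega) (by omega) (by simp) (by simp))))
      rw [hfg, pow_succ']
      refine Ideal.sum_mem _ fun s hs => Ideal.mul_mem_mul ?_ (ih ?_)
      · exact monomial_mem_idealJ k (by simpa using hs)
      · rw [mem_weightIdeal]
        intro e he
        refine hg s e (hf _ ?_)
        have : wt s = 2 := by
          simp only [Finset.mem_insert, Finset.mem_singleton] at hs
          rcases hs with rfl | rfl | rfl | rfl | rfl <;> simp [wt]
        rw [wt_add]
        omega

/-- The kernel of `k[[X, Y, Z, W]] → B` is the monomial ideal of the series without standard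
terms. -/
theorem mem_idealK_iff (f : MvPowerSeries (Fin 4) k) :
    f ∈ idealK k ↔ ∀ e, IsStandard e → MvPowerSeries.coeff e f = 0 := by
  have h1 : (Ideal.span {MvPowerSeries.X 0 ^ 2, MvPowerSeries.X 1 ^ 2} :
      Ideal (MvPowerSeries (Fin 4) k)) = Ideal.span ((fun s => MvPowerSeries.monomial s (1 : k)) ''
        (({expo 2 0 0 0, expo 0 2 0 0} : Finset _) : Set (Fin 4 →₀ ℕ))) := by
    simp [Set.image_pair, monomial_expo]
  have h2 : (Ideal.span {MvPowerSeries.X 2, MvPowerSeries.X 3} :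
      Ideal (MvPowerSeries (Fin 4) k)) = Ideal.span ((fun s => MvPowerSeries.monomial s (1 : k)) ''
        (({expo 0 0 1 0, expo 0 0 0 1} : Finset _) : Set (Fin 4 →₀ ℕ))) := by
    simp [Set.image_pair, monomial_expo]
  rw [idealK, Ideal.mem_inf, h1, h2, mem_span_monomial_iff, mem_span_monomial_iff, ← forall_and]
  refine forall_congr' fun e => ?_
  rw [← or_imp]
  refine imp_congr (or_congr ?_ ?_) Iff.rfl
  all_goals
    simp only [Finset.mem_insert, Finset.mem_singleton, forall_eq_or_imp, forall_eq]
    refine and_congr ⟨fun h => ?_, fun h hle => ?_⟩ ⟨fun h => ?_, fun h hle => ?_⟩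
  · by_contra h'; exact h (expo_le (by omega) (by simp) (by simp) (by simp))
  · have : 2 ≤ e 0 := hle 0
    omega
  · by_contra h'; exact h (expo_le (by simp) (by omega) (by simp) (by simp))
  · have : 2 ≤ e 1 := hle 1
    omega
  · by_contra h'; exact h (expo_le (by simp) (by simp) (by omega) (by simp))
  · have : 1 ≤ e 2 := hle 2
    omega
  · by_contra h'; exact h (expo_le (by simp) (by simp) (by simp) (by omega))
  · have : 1 ≤ e 3 := hle 3
    omega

theorem mk_surjective : Function.Surjective (Ideal.Quotient.mk (idealK k)) :=
  Ideal.Quotient.mk_surjective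

open Classical in
/-- The coefficient of an element of `B` at an exponent, and `0` unless the exponent is
standard. -/
def cf (e : Fin 4 →₀ ℕ) : B k →ₗ[k] k where
  toFun b := if IsStandard e then MvPowerSeries.coeff e (Quotient.out b) else 0
  map_add' b b' := by
    split_ifs with he
    · rw [← map_add, ← sub_eq_zero, ← map_sub]
      refine (mem_idealK_iff k _).1 ?_ e he
      rw [← Ideal.Quotient.eq]
      simp [Ideal.Quotient.mk_out]
    · simp
  map_smul' c b := by
    split_ifs with he
    · rw [RingHom.id_apply, ← map_smul, ← sub_eq_zero, ← map_sub]
      refine (mem_idealK_iff k _).1 ?_ e he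
      rw [← Ideal.Quotient.eq]
      change _ = Ideal.Quotient.mkₐ k (idealK k) _
      rw [map_smul]
      simp [Ideal.Quotient.mk_out]
    · simp

open Classical in
theorem cf_mk (e : Fin 4 →₀ ℕ) (f : MvPowerSeries (Fin 4) k) :
    cf k e (Ideal.Quotient.mk (idealK k) f) =
      if IsStandard e then MvPowerSeries.coeff e f else 0 := by
  change (if IsStandard e then _ else _) = _
  split_ifs with he
  · rw [← sub_eq_zero, ← map_sub]
    refine (mem_idealK_iff k _).1 ?_ e he
    rw [← Ideal.Quotient.eq]
    exact Ideal.Quotient.mk_out _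
  · rfl

/-- The monomial `x ^ a * y ^ b * z ^ c * w ^ d` of `B`. -/
def mon (a b c d : ℕ) : B k := v k 0 ^ a * v k 1 ^ b * v k 2 ^ c * v k 3 ^ d

theorem mon_eq_mk (a b c d : ℕ) :
    mon k a b c d = Ideal.Quotient.mk (idealK k) (MvPowerSeries.monomial (expo a b c d) 1) := by
  simp [monomial_expo, mon, v]

open Classical in
theorem cf_mon (e : Fin 4 →₀ ℕ) (a b c d : ℕ) :
    cf k e (mon k a b c d) = if IsStandard e ∧ e = expo a b c d then 1 else 0 := by
  rw [mon_eq_mk, cf_mk, MvPowerSeries.coeff_monomial]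
  split_ifs <;> tauto

/-- The powers of `J` are the pieces of the filtration of `B` by weight. -/
theorem mem_J_pow_iff (n : ℕ) (b : B k) : b ∈ J k ^ n ↔ ∀ e, wt e < 2 * n → cf k e b = 0 := by
  classical
  rw [← map_idealJ, ← Ideal.map_pow, idealJ_pow,
    Ideal.mem_map_iff_of_surjective _ (mk_surjective k)]
  constructor
  · rintro ⟨f, hf, rfl⟩ e he
    rw [cf_mk, hf e he, ite_self]
  · intro hb
    obtain ⟨f, rfl⟩ := mk_surjective k b
    -- the terms of `f` at standard exponents already represent the class of `f`
    let g : MvPowerSeries (Fin 4) k :=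
      fun e => if IsStandard e then MvPowerSeries.coeff e f else 0
    have hg : ∀ e, MvPowerSeries.coeff e g =
      if IsStandard e then MvPowerSeries.coeff e f else 0 := fun _ => rfl
    refine ⟨g, fun e he => ?_, ?_⟩
    · rw [hg, ← cf_mk, hb e he]
    · rw [Ideal.Quotient.eq, mem_idealK_iff]
      intro e he
      rw [map_sub, hg, if_pos he, sub_self]

/-- An element of `J ^ n` is determined modulo `J ^ (n + 1)` by its coefficients at the
exponents of weight `2 * n` and `2 * n + 1`. -/
theorem mem_J_pow_succ (n : ℕ) {b : B k} (hb : b ∈ J k ^ n)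
    (h : ∀ e, IsStandard e → (wt e = 2 * n ∨ wt e = 2 * n + 1) → cf k e b = 0) :
    b ∈ J k ^ (n + 1) := by
  rw [mem_J_pow_iff] at hb ⊢
  intro e he
  by_cases hs : IsStandard e
  · by_cases hlt : wt e < 2 * n
    · exact hb e hlt
    · exact h e hs (by omega)
  · obtain ⟨f, rfl⟩ := mk_surjective k b
    rw [cf_mk, if_neg hs]

end Coefficients

/-! ### Lengths of quotients killed by the maximal ideal -/

section Length

variable {k A : Type*} [Field k] [CommRing A] [Algebra k A]

/-- If `N / N'` is killed by a maximal ideal with residue field `k`, its length is the number of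
elements in a `k`-basis. -/
theorem length_quotient_eq_add_card (m : Ideal A) [m.IsMaximal]
    (hm : ∀ x : A, ∃ c : k, x - algebraMap k A c ∈ m) {N' N : Ideal A} (hle : N' ≤ N)
    (hmN : m * N ≤ N') {ι : Type*} [Fintype ι] (u : ι → A) (hu : ∀ i, u i ∈ N)
    (hspan : ∀ x ∈ N, ∃ c : ι → k, x - ∑ i, c i • u i ∈ N')
    (hind : ∀ c : ι → k, ∑ i, c i • u i ∈ N' → c = 0) :
    Module.length A (A ⧸ N') = Module.length A (A ⧸ N) + (Fintype.card ι : ℕ∞) := by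
  classical
  let Ψ : (ι → A) →ₗ[A] A ⧸ N' := N'.mkQ ∘ₗ Fintype.linearCombination A u
  have hΨ : ∀ f, Ψ f = N'.mkQ (∑ i, f i * u i) := fun f => by
    simp [Ψ, Fintype.linearCombination_apply]
  have hker : LinearMap.ker Ψ = Submodule.pi Set.univ fun _ => m := by
    ext f
    rw [LinearMap.mem_ker, hΨ, Submodule.mkQ_apply, Submodule.Quotient.mk_eq_zero]
    choose c hc using fun i => hm (f i)
    have hsub : ∑ i, f i * u i - ∑ i, c i • u i ∈ N' := by
      rw [← Finset.sum_sub_distrib]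
      refine Ideal.sum_mem _ fun i _ => hmN ?_
      rw [Algebra.smul_def, ← sub_mul]
      exact Ideal.mul_mem_mul (hc i) (hu i)
    have h0 : ∀ i, f i ∈ m ↔ c i = 0 := by
      intro i
      constructor
      · intro hf
        by_contra hci
        have h1 : algebraMap k A (c i) ∈ m := by simpa using m.sub_mem hf (hc i)
        exact Ideal.IsPrime.ne_top' (Ideal.eq_top_of_isUnit_mem m h1
          ((isUnit_iff_ne_zero.2 hci).map (algebraMap k A)))
      · intro hci
        simpa [hci] using hc i
    simp only [Submodule.mem_pi, Set.mem_univ, true_imp_iff, h0]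
    constructor
    · intro hf i
      have := hind c (by simpa using N'.sub_mem hf hsub)
      rw [this]; rfl
    · intro hci
      simpa [hci] using hsub
  have hrange : Function.Exact (LinearMap.range Ψ).subtype (Submodule.factor hle) := by
    intro y
    obtain ⟨x, rfl⟩ := N'.mkQ_surjective y
    rw [Submodule.mkQ_apply]
    change Submodule.Quotient.mk x = 0 ↔ _
    rw [Submodule.Quotient.mk_eq_zero]
    rw [Submodule.coe_subtype, Subtype.range_coe, SetLike.mem_coe, LinearMap.mem_range]
    constructor
    · intro hx
      obtain ⟨c, hc⟩ := hspan x hx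
      refine ⟨fun i => algebraMap k A (c i), ?_⟩
      rw [hΨ, eq_comm, ← sub_eq_zero, ← Submodule.mkQ_apply, ← map_sub, Submodule.mkQ_apply,
        Submodule.Quotient.mk_eq_zero]
      simpa [Algebra.smul_def] using hc
    · rintro ⟨f, hf⟩
      rw [hΨ, Submodule.mkQ_apply, Submodule.Quotient.eq] at hf
      have h1 := hle hf
      have h2 : ∑ i, f i * u i ∈ N := Ideal.sum_mem _ fun i _ => N.mul_mem_left _ (hu i)
      simpa using N.sub_mem h2 h1
  rw [Module.length_eq_add_of_exact _ _ (Submodule.subtype_injective _)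
    (Submodule.factor_surjective hle) hrange, add_comm]
  congr 1
  rw [← (LinearMap.quotKerEquivRange Ψ).length_eq, hker,
    (Submodule.quotientPi fun _ : ι => m).length_eq, Module.length_pi_of_fintype]
  have : IsSimpleModule A (A ⧸ m) := by
    rw [isSimpleModule_iff_isCoatom]; exact Ideal.IsMaximal.out
  simp [Module.length_eq_one]

end Length

/-! ### The ring `k + J` -/

section FieldPlus

variable {k : Type u} [Field k] {B : Type u} [CommRing B] [Algebra k B] {J : Ideal B}

variable (k J) in
/-- The ideal `J` of `B`, seen as an ideal of `k + J`. -/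
def idealFieldPlus : Ideal (fieldPlus k J) := J.comap (fieldPlus k J).val

theorem mem_idealFieldPlus {x : fieldPlus k J} : x ∈ idealFieldPlus k J ↔ (x : B) ∈ J := Iff.rfl

theorem mem_fieldPlus_of_mem {b : B} (hb : b ∈ J) : b ∈ fieldPlus k J := ⟨0, b, hb, by simp⟩

theorem exists_sub_algebraMap_mem (x : fieldPlus k J) :
    ∃ c : k, x - algebraMap k (fieldPlus k J) c ∈ idealFieldPlus k J := by
  obtain ⟨c, j, hj, h⟩ := x.2
  refine ⟨c, ?_⟩
  rw [mem_idealFieldPlus]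
  have : ((x - algebraMap k (fieldPlus k J) c : fieldPlus k J) : B) = j := by
    change (x : B) - algebraMap k B c = j
    rw [h]; ring
  rwa [this]

theorem not_isUnit_of_mem_idealFieldPlus (hJ : J ≠ ⊤) {x : fieldPlus k J}
    (hx : x ∈ idealFieldPlus k J) : ¬ IsUnit x := fun h =>
  hJ (Ideal.eq_top_of_isUnit_mem J hx (h.map (fieldPlus k J).val))

theorem isUnit_of_notMem_idealFieldPlus [IsLocalRing B] (hJ : J ≠ ⊤) {x : fieldPlus k J}
    (hx : x ∉ idealFieldPlus k J) : IsUnit x := by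
  obtain ⟨c, hc⟩ := exists_sub_algebraMap_mem x
  have hc0 : c ≠ 0 := by
    rintro rfl
    exact hx (by simpa using hc)
  have hj : (x : B) - algebraMap k B c ∈ J := hc
  have hcu : IsUnit (algebraMap k B c) := (isUnit_iff_ne_zero.2 hc0).map _
  have hxu : IsUnit (x : B) := by
    by_contra h
    have h1 : (x : B) ∈ IsLocalRing.maximalIdeal B := h
    have h2 := Ideal.sub_mem _ h1 (IsLocalRing.le_maximalIdeal hJ hj)
    rw [sub_sub_cancel] at h2
    exact h2 hcu
  obtain ⟨y, hy⟩ := hxu.exists_right_inv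
  -- the inverse of `c + j` is `c⁻¹ - c⁻¹ * j * (c + j)⁻¹`, again in `k + J`
  have hyA : y ∈ fieldPlus k J := by
    refine ⟨c⁻¹, -(algebraMap k B c⁻¹ * y) * ((x : B) - algebraMap k B c),
      Ideal.mul_mem_left _ _ hj, ?_⟩
    have hcc : algebraMap k B c⁻¹ * algebraMap k B c = 1 := by
      rw [← map_mul, inv_mul_cancel₀ hc0, map_one]
    linear_combination (algebraMap k B c⁻¹) * hy - y * hcc
  exact IsUnit.of_mul_eq_one ⟨y, hyA⟩ (Subtype.ext hy)

/-- An element of `k + J` outside `J` is a unit of `B`, and its inverse lies in `k + J` again. -/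
theorem isLocalRing_fieldPlus [IsLocalRing B] (hJ : J ≠ ⊤) : IsLocalRing (fieldPlus k J) := by
  have : Nontrivial (fieldPlus k J) := inferInstance
  refine IsLocalRing.of_isUnit_or_isUnit_one_sub_self fun x => ?_
  by_cases hx : x ∈ idealFieldPlus k J
  · right
    refine isUnit_of_notMem_idealFieldPlus hJ fun h =>
      not_isUnit_of_mem_idealFieldPlus hJ (add_mem hx h) ?_
    simp
  · exact Or.inl (isUnit_of_notMem_idealFieldPlus hJ hx)

theorem maximalIdeal_fieldPlus [IsLocalRing B] [IsLocalRing (fieldPlus k J)] (hJ : J ≠ ⊤) :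
    IsLocalRing.maximalIdeal (fieldPlus k J) = idealFieldPlus k J := by
  ext x
  rw [IsLocalRing.mem_maximalIdeal, mem_nonunits_iff]
  exact ⟨fun h => by_contra fun hx => h (isUnit_of_notMem_idealFieldPlus hJ hx),
    not_isUnit_of_mem_idealFieldPlus hJ⟩

theorem exists_finset_add_mem [Module.Finite k (B ⧸ J)] :
    ∃ t : Finset B, ∀ b : B, ∃ w ∈ Submodule.span k (t : Set B), b - w ∈ J := by
  classical
  obtain ⟨t, ht⟩ := (Module.Finite.fg_top : (⊤ : Submodule k (B ⧸ J)).FG)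
  refine ⟨t.image Quotient.out, fun b => ?_⟩
  have hb : (Ideal.Quotient.mk J b) ∈ Submodule.span k (t : Set (B ⧸ J)) := by
    rw [ht]; trivial
  have key : ∀ q ∈ Submodule.span k (t : Set (B ⧸ J)),
      ∃ w ∈ Submodule.span k ((t.image Quotient.out : Finset B) : Set B),
        Ideal.Quotient.mkₐ k J w = q := by
    intro q hq
    induction hq using Submodule.span_induction with
    | mem q hq =>
      exact ⟨q.out, Submodule.subset_span (Finset.mem_coe.2 (Finset.mem_image_of_mem _ hq)),
        Ideal.Quotient.mk_out q⟩
    | zero => exact ⟨0, zero_mem _, map_zero _⟩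
    | add q q' _ _ h h' =>
      obtain ⟨w, hw, rfl⟩ := h
      obtain ⟨w', hw', rfl⟩ := h'
      exact ⟨w + w', add_mem hw hw', map_add _ _ _⟩
    | smul c q _ h =>
      obtain ⟨w, hw, rfl⟩ := h
      exact ⟨c • w, Submodule.smul_mem _ _ hw, map_smul _ _ _⟩
  obtain ⟨w, hw, h⟩ := key _ hb
  exact ⟨w, hw, Ideal.Quotient.eq.1 h.symm⟩

/-- Since `B / J` is finite over `k` and `J` lies in `k + J`, lifts of `k`-generators of `B / J`
together with `1` generate `B`. -/
theorem finite_fieldPlus [Module.Finite k (B ⧸ J)] : Module.Finite (fieldPlus k J) B := by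
  classical
  obtain ⟨t, ht⟩ := exists_finset_add_mem (k := k) (J := J)
  refine ⟨⟨insert 1 t, ?_⟩⟩
  rw [eq_top_iff]
  intro b _
  obtain ⟨w, hw, hbw⟩ := ht b
  have h1 : w ∈ Submodule.span (fieldPlus k J) ((insert 1 t : Finset B) : Set B) := by
    have := Submodule.span_le_restrictScalars k (fieldPlus k J) (t : Set B) hw
    exact Submodule.span_mono (by simp) this
  have h2 : b - w ∈ Submodule.span (fieldPlus k J) ((insert 1 t : Finset B) : Set B) := by
    have := Submodule.smul_mem (Submodule.span (fieldPlus k J) ((insert 1 t : Finset B) : Set B))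
      (⟨b - w, mem_fieldPlus_of_mem hbw⟩ : fieldPlus k J)
      (Submodule.subset_span (show (1 : B) ∈ _ by simp))
    change (b - w) * 1 ∈ _ at this
    rwa [mul_one] at this
  simpa using add_mem h1 h2

/-- A `k + J`-submodule `N` of `B` is finitely generated: it contains the finitely generated ideal
`J N` of `B`, and `N / J N` is a subspace of the finite-dimensional space `B N / J N`. -/
theorem isNoetherian_fieldPlus [Module.Finite k (B ⧸ J)] [IsNoetherianRing B] :
    IsNoetherian (fieldPlus k J) B := by
  classical
  have hfin : Module.Finite (fieldPlus k J) B := finite_fieldPlus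
  obtain ⟨t, ht⟩ := exists_finset_add_mem (k := k) (J := J)
  refine ⟨fun N => ?_⟩
  obtain ⟨s, hsN, hs⟩ := (Submodule.fg_span_iff_fg_span_finset_subset (R := B)
    (N : Set B)).1 (IsNoetherian.noetherian _)
  set M : Ideal B := Submodule.span B (N : Set B) with hM
  have hJM : ((J * M).restrictScalars (fieldPlus k J)) ≤ N := by
    intro b hb
    rw [Submodule.restrictScalars_mem] at hb
    induction hb using Submodule.mul_induction_on' with
    | mem_mul_mem j hj m hm =>
      induction hm using Submodule.span_induction generalizing j with
      | mem m hm => exact N.smul_mem (⟨j, mem_fieldPlus_of_mem hj⟩ : fieldPlus k J) hm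
      | zero => simp
      | add m m' _ _ h h' => rw [mul_add]; exact add_mem (h j hj) (h' j hj)
      | smul b m _ h =>
        rw [smul_eq_mul, ← mul_assoc]
        exact h _ (Ideal.mul_mem_right _ _ hj)
    | add b _ b' _ h h' => exact add_mem h h'
  have hfgJM : ((J * M).restrictScalars (fieldPlus k J)).FG := by
    have h2 : Module.Finite (fieldPlus k J) (J * M : Ideal B) := Module.Finite.trans B _
    exact Module.Finite.iff_fg.1 h2
  -- a finite-dimensional space `U` with `B N = U + J N`
  let U : Submodule k B := Submodule.span k (t : Set B) * Submodule.span k (s : Set B)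
  have hUfg : U.FG := (Submodule.fg_span t.finite_toSet).mul (Submodule.fg_span s.finite_toSet)
  have hU : ∀ m ∈ M, ∃ w ∈ U, m - w ∈ J * M := by
    intro m hm
    have hsM : ∀ i ∈ s, i ∈ M := fun i hi => hs ▸ Submodule.subset_span hi
    rw [hs, Submodule.mem_span_finset] at hm
    obtain ⟨f, -, rfl⟩ := hm
    choose w hw hfw using ht
    refine ⟨∑ i ∈ s, w (f i) * i, Submodule.sum_mem _ fun i hi =>
      Submodule.mul_mem_mul (hw _) (Submodule.subset_span hi), ?_⟩
    rw [← Finset.sum_sub_distrib]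
    refine Ideal.sum_mem _ fun i hi => ?_
    rw [smul_eq_mul, ← sub_mul]
    exact Ideal.mul_mem_mul (hfw _) (hsM i hi)
  have hfd : FiniteDimensional k U := Module.Finite.iff_fg.2 hUfg
  have hNU : (U ⊓ N.restrictScalars k).FG :=
    Submodule.FG.of_le hUfg inf_le_left
  obtain ⟨r, hr⟩ := hNU
  have hN : N = Submodule.span (fieldPlus k J) (r : Set B) ⊔
      (J * M).restrictScalars (fieldPlus k J) := by
    apply le_antisymm
    · intro b hb
      obtain ⟨w, hw, hbw⟩ := hU b (Submodule.subset_span hb)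
      have hwN : w ∈ N := by
        have := N.sub_mem hb (hJM hbw)
        rwa [sub_sub_cancel] at this
      have hwr : w ∈ Submodule.span k (r : Set B) := by rw [hr]; exact ⟨hw, hwN⟩
      rw [← add_sub_cancel w b]
      exact Submodule.add_mem_sup (Submodule.span_le_restrictScalars k (fieldPlus k J) _ hwr) hbw
    · refine sup_le (Submodule.span_le.2 fun b hb => ?_) hJM
      have : b ∈ Submodule.span k (r : Set B) := Submodule.subset_span hb
      rw [hr] at this
      exact this.2
  rw [hN]
  exact (Submodule.fg_span r.finite_toSet).sup hfgJM

theorem isNoetherianRing_fieldPlus [Module.Finite k (B ⧸ J)] [IsNoetherianRing B] :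
    IsNoetherianRing (fieldPlus k J) := by
  have := isNoetherian_fieldPlus (k := k) (J := J)
  exact isNoetherian_of_injective (Algebra.linearMap (fieldPlus k J) B) Subtype.val_injective

end FieldPlus

/-! ### Binary forms and analytic independence -/

section Forms

variable {k A : Type*} [Field k] [CommRing A] [Algebra k A] {m : Ideal A} {a b : A}

/-- The value at `(a, b)` of the binary form of degree `n` with coefficients `c`. -/
def formEval (a b : A) (n : ℕ) (c : Fin (n + 1) → k) : A :=
  ∑ i : Fin (n + 1), c i • (a ^ (i : ℕ) * b ^ (n - i))

variable (k m a b) in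
/-- The elements `a, b` are analytically independent: a binary form over the residue field `k`
whose value at `(a, b)` lies in `(a, b) ^ n * m`, where `n` is its degree, vanishes. -/
def AnalyticallyIndependent : Prop :=
  ∀ (n : ℕ) (c : Fin (n + 1) → k), formEval a b n c ∈ Ideal.span {a, b} ^ n * m → c = 0

theorem span_pair_pow (a b : A) (n : ℕ) : Ideal.span {a, b} ^ n =
    Ideal.span (Set.range fun i : Fin (n + 1) => a ^ (i : ℕ) * b ^ (n - i)) := by
  apply le_antisymm
  · induction n with
    | zero => simp
    | succ n ih =>
      rw [pow_succ]
      refine (Ideal.mul_mono_left ih).trans ?_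
      rw [Ideal.span_mul_span', Ideal.span_le]
      rintro _ ⟨_, ⟨i, rfl⟩, y, hy, rfl⟩
      have hi := i.2
      rcases hy with rfl | hy
      · refine Ideal.subset_span ⟨⟨i + 1, by omega⟩, ?_⟩
        simp only [Nat.add_sub_add_right]
        ring
      · rw [Set.mem_singleton_iff] at hy
        subst hy
        refine Ideal.subset_span ⟨⟨i, by omega⟩, ?_⟩
        simp only
        rw [Nat.succ_sub (by omega : (i : ℕ) ≤ n), Nat.succ_eq_add_one, pow_succ, mul_assoc]
  · rw [Ideal.span_le]
    rintro _ ⟨i, rfl⟩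
    have ha : a ∈ Ideal.span {a, b} := Ideal.subset_span (Or.inl rfl)
    have hb : b ∈ Ideal.span {a, b} := Ideal.subset_span (Or.inr rfl)
    have := Ideal.mul_mem_mul (Ideal.pow_mem_pow ha i) (Ideal.pow_mem_pow hb (n - i))
    rwa [← pow_add, Nat.add_sub_cancel' (by omega : (i : ℕ) ≤ n)] at this

theorem pow_mul_pow_mem (n : ℕ) (i : Fin (n + 1)) :
    a ^ (i : ℕ) * b ^ (n - i) ∈ Ideal.span {a, b} ^ n := by
  rw [span_pair_pow]
  exact Ideal.subset_span ⟨i, rfl⟩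

theorem smul_mem_ideal (I : Ideal A) (c : k) {x : A} (hx : x ∈ I) : c • x ∈ I := by
  rw [Algebra.smul_def]; exact I.mul_mem_left _ hx

/-- If the residue field is `k`, an ideal is spanned over `k` by its generators up to its product
with `m`. -/
theorem exists_sub_sum_smul_mem (hm : ∀ x : A, ∃ c : k, x - algebraMap k A c ∈ m) {ι : Type*}
    [Fintype ι] (u : ι → A) {x : A} (hx : x ∈ Ideal.span (Set.range u)) :
    ∃ c : ι → k, x - ∑ i, c i • u i ∈ Ideal.span (Set.range u) * m := by
  obtain ⟨f, rfl⟩ := Ideal.mem_span_range_iff_exists_fun.1 hx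
  choose c hc using fun i => hm (f i)
  refine ⟨c, ?_⟩
  rw [← Finset.sum_sub_distrib]
  refine Ideal.sum_mem _ fun i _ => ?_
  rw [Algebra.smul_def, ← sub_mul, mul_comm (Ideal.span _)]
  exact Ideal.mul_mem_mul (hc i) (Ideal.subset_span ⟨i, rfl⟩)

theorem exists_sub_formEval_mem (hm : ∀ x : A, ∃ c : k, x - algebraMap k A c ∈ m) {n : ℕ} {x : A}
    (hx : x ∈ Ideal.span {a, b} ^ n) :
    ∃ c : Fin (n + 1) → k, x - formEval a b n c ∈ Ideal.span {a, b} ^ n * m := by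
  rw [span_pair_pow] at hx ⊢
  exact exists_sub_sum_smul_mem hm _ hx

/-- The space `Q ^ n / Q ^ n m` has the `n + 1` monomials of degree `n` as a basis. -/
theorem AnalyticallyIndependent.length_quotient [m.IsMaximal]
    (hind : AnalyticallyIndependent k m a b)
    (hm : ∀ x : A, ∃ c : k, x - algebraMap k A c ∈ m) (n : ℕ) :
    Module.length A (A ⧸ (Ideal.span {a, b} ^ n * m)) =
      Module.length A (A ⧸ Ideal.span {a, b} ^ n) + ((n + 1 : ℕ) : ℕ∞) := by
  rw [length_quotient_eq_add_card (k := k) m hm (N := Ideal.span {a, b} ^ n)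
    (N' := Ideal.span {a, b} ^ n * m) (fun x hx => (Ideal.mul_le_inf hx).1) (mul_comm _ _).le
    (fun i : Fin (n + 1) => a ^ (i : ℕ) * b ^ (n - i))
    (fun i => pow_mul_pow_mem n i) (fun x hx => exists_sub_formEval_mem hm hx) (hind n),
    Fintype.card_fin]

theorem AnalyticallyIndependent.coeff_eq_zero (hind : AnalyticallyIndependent k m a b) {α β : k}
    (h : α • a + β • b ∈ Ideal.span {a, b} * m) : α = 0 ∧ β = 0 := by
  have h1 := hind 1 ![β, α] (by simpa [formEval, add_comm] using h)
  exact ⟨congrFun h1 1, congrFun h1 0⟩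

end Forms

/-! ### Rees algebras -/

section Rees

variable {A : Type u} [CommRing A] {m Q : Ideal A}

theorem monomial_mem_extendedIdeal {n : ℕ} {y : A} (hy : y ∈ Q ^ n * m)
    (h : monomial n y ∈ reesAlgebra Q) :
    (⟨monomial n y, h⟩ : reesAlgebra Q) ∈ extendedIdeal m Q := by
  have key : ∃ h : monomial n y ∈ reesAlgebra Q,
      (⟨monomial n y, h⟩ : reesAlgebra Q) ∈ extendedIdeal m Q := by
    clear h
    induction hy using Submodule.mul_induction_on' with
    | mem_mul_mem q hq x hx =>
      refine ⟨reesAlgebra.monomial_mem.2 (Ideal.mul_mem_right _ _ hq), ?_⟩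
      have h1 := Ideal.mul_mem_left (extendedIdeal m Q)
        (⟨monomial n q, reesAlgebra.monomial_mem.2 hq⟩ : reesAlgebra Q)
        (Ideal.mem_map_of_mem (algebraMap A (reesAlgebra Q)) hx)
      convert h1 using 1
      apply Subtype.ext
      change monomial n (q * x) = monomial n q * C x
      rw [monomial_mul_C]
    | add y _ y' _ h h' =>
      obtain ⟨h, hy⟩ := h
      obtain ⟨h', hy'⟩ := h'
      refine ⟨by rw [map_add]; exact add_mem h h', ?_⟩
      convert add_mem hy hy' using 1
      apply Subtype.ext
      exact map_add _ _ _
  exact key.2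

theorem eq_sum_monomial_rees (f : reesAlgebra Q) : f = ∑ n ∈ (f : A[X]).support,
    (⟨monomial n ((f : A[X]).coeff n), reesAlgebra.monomial_mem.2 (f.2 n)⟩ : reesAlgebra Q) := by
  apply Subtype.ext
  rw [AddSubmonoidClass.coe_finsetSum]
  exact (f : A[X]).as_sum_support

/-- The extension of `m` to `R(Q)` is `⨁ₙ Qⁿ m`. -/
theorem mem_extendedIdeal_iff (f : reesAlgebra Q) :
    f ∈ extendedIdeal m Q ↔ ∀ n, (f : A[X]).coeff n ∈ Q ^ n * m := by
  constructor
  · intro hf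
    induction hf using Submodule.span_induction with
    | mem f hf =>
      obtain ⟨x, hx, rfl⟩ := hf
      intro n
      change (C x).coeff n ∈ _
      rw [coeff_C]
      split_ifs with h
      · subst h; simpa using hx
      · exact zero_mem _
    | zero => intro n; simp
    | add f g _ _ hf hg =>
      intro n
      have : ((f + g : reesAlgebra Q) : A[X]).coeff n =
        (f : A[X]).coeff n + (g : A[X]).coeff n := coeff_add _ _ _
      rw [this]
      exact add_mem (hf n) (hg n)
    | smul g f _ hf =>
      intro n
      have : ((g • f : reesAlgebra Q) : A[X]).coeff n = _ := coeff_mul (g : A[X]) (f : A[X]) n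
      rw [this]
      refine Ideal.sum_mem _ fun p hp => ?_
      rw [← Finset.HasAntidiagonal.mem_antidiagonal.1 hp, pow_add, mul_assoc]
      exact Ideal.mul_mem_mul (g.2 p.1) (hf p.2)
  · intro hf
    rw [eq_sum_monomial_rees f]
    exact Ideal.sum_mem _ fun n _ => monomial_mem_extendedIdeal (hf n) _

/-- The component of degree `n` of `m R(m)` is contained in `m ^ (n + 1)`. -/
theorem coeff_mem_of_mem_reesTop (hQ : Q ≤ m) {f : A[X]} (hf : f ∈ reesTop Q m) (n : ℕ) :
    f.coeff n ∈ m ^ (n + 1) := by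
  induction hf using Submodule.span_induction generalizing n with
  | mem f hf =>
    obtain ⟨x, hx, g, hg, rfl⟩ := hf
    rw [coeff_C_mul, pow_succ']
    exact Ideal.mul_mem_mul hx (hg n)
  | zero => simp
  | add f g _ _ hf hg => rw [coeff_add]; exact add_mem (hf n) (hg n)
  | smul g f _ hf =>
    have : (g • f).coeff n = _ := coeff_mul (g : A[X]) f n
    rw [this]
    refine Ideal.sum_mem _ fun p hp => ?_
    rw [← Finset.HasAntidiagonal.mem_antidiagonal.1 hp, add_assoc, pow_add]
    exact Ideal.mul_mem_mul (Ideal.pow_right_mono hQ _ (g.2 p.1)) (hf p.2)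

/-- The component of degree `n` of `m R(Q)` is `Q ^ n m`. -/
theorem mem_reesBot_iff {f : A[X]} : f ∈ reesBot Q m ↔ ∀ n, f.coeff n ∈ Q ^ n * m := by
  constructor
  · intro hf n
    induction hf using Submodule.span_induction generalizing n with
    | mem f hf =>
      obtain ⟨x, hx, rfl⟩ := hf
      rw [coeff_C]
      split_ifs with h
      · subst h; simpa using hx
      · exact zero_mem _
    | zero => simp
    | add f g _ _ hf hg => rw [coeff_add]; exact add_mem (hf n) (hg n)
    | smul g f _ hf =>
      have : (g • f).coeff n = _ := coeff_mul (g : A[X]) f n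
      rw [this]
      refine Ideal.sum_mem _ fun p hp => ?_
      rw [← Finset.HasAntidiagonal.mem_antidiagonal.1 hp, pow_add, mul_assoc]
      exact Ideal.mul_mem_mul (g.2 p.1) (hf p.2)
  · intro hf
    rw [f.as_sum_support]
    refine Submodule.sum_mem _ fun n _ => ?_
    have key : ∀ y ∈ Q ^ n * m, monomial n y ∈ reesBot Q m := by
      intro y hy
      induction hy using Submodule.mul_induction_on' with
      | mem_mul_mem q hq x hx =>
        have := Submodule.smul_mem (reesBot Q m)
          (⟨monomial n q, reesAlgebra.monomial_mem.2 hq⟩ : reesAlgebra Q)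
          (Submodule.subset_span ⟨x, hx, rfl⟩)
        change monomial n q * C x ∈ _ at this
        rwa [monomial_mul_C] at this
      | add y _ y' _ h h' => rw [map_add]; exact add_mem h h'
    exact key _ (hf n)

theorem monomial_one_mem_reesTop {u : A} (hu : u ∈ m ^ 2) : monomial 1 u ∈ reesTop Q m := by
  rw [pow_two] at hu
  induction hu using Submodule.mul_induction_on' with
  | mem_mul_mem x hx y hy =>
    refine Submodule.subset_span ⟨x, hx, monomial 1 y, reesAlgebra.monomial_mem.2 (by simpa), ?_⟩
    rw [C_mul_monomial]
  | add y _ y' _ h h' => rw [map_add]; exact add_mem h h'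

end Rees

section Prime

variable {k : Type*} {A : Type u} [Field k] [CommRing A] [Algebra k A] {m : Ideal A} {a b : A}

/-- The fiber ring `R(Q) / m R(Q)` of an ideal `Q` generated by two analytically independent
elements is a polynomial ring in two variables over the residue field. -/
theorem AnalyticallyIndependent.isPrime_extendedIdeal (hind : AnalyticallyIndependent k m a b)
    (hm : ∀ x : A, ∃ c : k, x - algebraMap k A c ∈ m) :
    (extendedIdeal m (Ideal.span {a, b})).IsPrime := by
  classical
  set Q := Ideal.span {a, b} with hQ
  have ha : a ∈ Q := Ideal.subset_span (Or.inl rfl)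
  have hb : b ∈ Q := Ideal.subset_span (Or.inr rfl)
  let s : reesAlgebra Q := ⟨monomial 1 a, reesAlgebra.monomial_mem.2 (by simpa using ha)⟩
  let t : reesAlgebra Q := ⟨monomial 1 b, reesAlgebra.monomial_mem.2 (by simpa using hb)⟩
  let i₀ : k →+* reesAlgebra Q := (algebraMap A (reesAlgebra Q)).comp (algebraMap k A)
  -- `k[X, Y] → R(Q)`, `X ↦ a t`, `Y ↦ b t`, will induce an isomorphism modulo `m R(Q)`
  let φ : MvPolynomial (Fin 2) k →+* reesAlgebra Q := MvPolynomial.eval₂Hom i₀ ![s, t]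
  let E : ℕ → ℕ → (Fin 2 →₀ ℕ) := fun i j => Finsupp.equivFunOnFinite.symm ![i, j]
  have hE : ∀ e : Fin 2 →₀ ℕ, E (e 0) (e 1) = e := by
    intro e; ext i; fin_cases i <;> rfl
  have hφmon : ∀ (e : Fin 2 →₀ ℕ) (c : k), ((φ (MvPolynomial.monomial e c) : reesAlgebra Q) : A[X])
      = monomial (e 0 + e 1) (c • (a ^ e 0 * b ^ e 1)) := by
    intro e c
    have h1 : φ (MvPolynomial.monomial e c) = i₀ c * (s ^ e 0 * t ^ e 1) := by
      simp [φ, MvPolynomial.eval₂_monomial, Finsupp.prod_fintype]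
    rw [h1]
    change C (algebraMap k A c) * (monomial 1 a ^ e 0 * monomial 1 b ^ e 1) = _
    rw [monomial_pow, monomial_pow, monomial_mul_monomial, C_mul_monomial, one_mul, one_mul,
      Algebra.smul_def]
  -- the coefficient of degree `n` is the value at `(a, b)` of the homogeneous part of degree `n`
  have hφcoeff : ∀ (F : MvPolynomial (Fin 2) k) (n : ℕ), ((φ F : reesAlgebra Q) : A[X]).coeff n =
      formEval a b n fun i => MvPolynomial.coeff (E i (n - i)) F := by
    intro F n
    induction F using MvPolynomial.induction_on' with
    | monomial e c =>
      rw [hφmon, coeff_monomial]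
      simp only [formEval, MvPolynomial.coeff_monomial]
      split_ifs with h
      · rw [Finset.sum_eq_single ⟨e 0, by omega⟩]
        · have h1 : n - e 0 = e 1 := by omega
          simp only [h1, hE, if_true]
        · intro i _ hi
          rw [if_neg, zero_smul]
          intro he
          exact hi (Fin.ext (DFunLike.congr_fun he 0).symm)
        · simp
      · rw [Finset.sum_eq_zero]
        intro i _
        rw [if_neg, zero_smul]
        intro he
        refine h ?_
        rw [he]
        change (i : ℕ) + (n - i) = n
        omega
    | add F G hF hG =>
      rw [map_add]
      change (φ F : A[X]).coeff n + (φ G : A[X]).coeff n = _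
      rw [hF, hG]
      simp only [formEval, ← Finset.sum_add_distrib, MvPolynomial.coeff_add, add_smul]
  have hinj : ∀ F, φ F ∈ extendedIdeal m Q → F = 0 := by
    intro F hF
    rw [mem_extendedIdeal_iff] at hF
    ext e
    have h1 := hF (e 0 + e 1)
    rw [hφcoeff] at h1
    have h2 := congrFun (hind _ _ h1) ⟨e 0, by omega⟩
    simpa [hE] using h2
  have hsurj : ∀ f : reesAlgebra Q, ∃ F, f - φ F ∈ extendedIdeal m Q := by
    intro f
    choose c hc using fun n => exists_sub_formEval_mem hm (f.2 n)
    refine ⟨∑ n ∈ (f : A[X]).support, ∑ i : Fin (n + 1),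
      MvPolynomial.monomial (E i (n - i)) (c n i), ?_⟩
    nth_rewrite 1 [eq_sum_monomial_rees f]
    rw [map_sum, ← Finset.sum_sub_distrib]
    refine Ideal.sum_mem _ fun n _ => ?_
    convert monomial_mem_extendedIdeal (hc n)
      (reesAlgebra.monomial_mem.2 (Ideal.mul_le_inf (hc n)).1) using 1
    apply Subtype.ext
    change monomial n _ - (φ _ : A[X]) = monomial n _
    rw [map_sum, AddSubmonoidClass.coe_finsetSum, map_sub, formEval, map_sum]
    congr 1
    refine Finset.sum_congr rfl fun i _ => ?_
    rw [hφmon]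
    have hi : (i : ℕ) + (n - i) = n := by omega
    change monomial ((i : ℕ) + (n - i)) (c n i • (a ^ (i : ℕ) * b ^ (n - i))) = _
    rw [hi]
  have h1 : Function.Bijective ((Ideal.Quotient.mk (extendedIdeal m Q)).comp φ) := by
    constructor
    · rw [injective_iff_map_eq_zero]
      intro F hF
      exact hinj F (Ideal.Quotient.eq_zero_iff_mem.1 hF)
    · intro y
      obtain ⟨f, rfl⟩ := Ideal.Quotient.mk_surjective y
      obtain ⟨F, hF⟩ := hsurj f
      exact ⟨F, (Ideal.Quotient.eq.2 hF).symm⟩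
  rw [← Ideal.Quotient.isDomain_iff_prime]
  exact (RingEquiv.ofBijective _ h1).symm.toMulEquiv.isDomain _

end Prime

/-! ### Localized modules of length zero and one -/

section LocalLength

variable {T M : Type u} [CommRing T] [AddCommGroup M] [Module T M] (P : Ideal T) [P.IsPrime]

theorem length_localizedModule_eq_zero {s : T} (hs : s ∉ P) (h : ∀ y : M, s • y = 0) :
    Module.length (Localization.AtPrime P) (LocalizedModule P.primeCompl M) = 0 := by
  rw [Module.length_eq_zero_iff, LocalizedModule.subsingleton_iff]
  exact fun y => ⟨s, hs, h y⟩

/-- A module with an element `u` that generates it locally at the prime `P` and has annihilator `P`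
localizes at `P` to the residue field. -/
theorem length_localizedModule_eq_one {s : T} (hs : s ∉ P) {u : M}
    (hkill : ∀ r ∈ P, r • u = 0) (hann : ∀ r : T, r • u = 0 → r ∈ P)
    (hgen : ∀ y : M, ∃ g : T, s • y = g • u) :
    Module.length (Localization.AtPrime P) (LocalizedModule P.primeCompl M) = 1 := by
  let ψ : Localization.AtPrime P →ₗ[Localization.AtPrime P] LocalizedModule P.primeCompl M :=
    LinearMap.toSpanSingleton _ _ (LocalizedModule.mk u 1)
  have hψ : ∀ (r : T) (t : P.primeCompl),
      ψ (Localization.mk r t) = LocalizedModule.mk (r • u) t := by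
    intro r t
    rw [LinearMap.toSpanSingleton_apply, LocalizedModule.mk_smul_mk, mul_one]
  have hψsurj : Function.Surjective ψ := by
    intro y
    induction y using LocalizedModule.induction_on with
    | h y r =>
      obtain ⟨g, hg⟩ := hgen y
      refine ⟨Localization.mk g ((⟨s, hs⟩ : P.primeCompl) * r), ?_⟩
      rw [hψ, ← hg]
      exact LocalizedModule.mk_cancel_common_left (⟨s, hs⟩ : P.primeCompl) r y
  have hker : LinearMap.ker ψ = IsLocalRing.maximalIdeal (Localization.AtPrime P) := by
    ext y
    obtain ⟨r, t, rfl⟩ := IsLocalization.exists_mk'_eq P.primeCompl y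
    rw [LinearMap.mem_ker, IsLocalization.AtPrime.mk'_mem_maximal_iff _ P,
      ← Localization.mk_eq_mk', hψ, ← LocalizedModule.zero_mk t, LocalizedModule.mk_eq]
    constructor
    · rintro ⟨c, hc⟩
      have h1 : (c : T) * ((t : T) * r) ∈ P := hann _ (by
        rw [mul_smul, mul_smul]
        simpa [Submonoid.smul_def] using hc)
      have h2 := (Ideal.IsPrime.mem_or_mem inferInstance h1).resolve_left c.2
      exact (Ideal.IsPrime.mem_or_mem inferInstance h2).resolve_left t.2
    · intro hr
      exact ⟨1, by rw [hkill r hr]⟩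
  have e := LinearMap.quotKerEquivOfSurjective ψ hψsurj
  rw [← e.length_eq, hker]
  have : IsSimpleModule (Localization.AtPrime P) (Localization.AtPrime P ⧸
      IsLocalRing.maximalIdeal (Localization.AtPrime P)) := by
    rw [isSimpleModule_iff_isCoatom]; exact (IsLocalRing.maximalIdeal.isMaximal _).out
  exact Module.length_eq_one _ _

variable {N₁ N₂ : Submodule T M}

theorem length_localized_subQuotient_eq_zero {s : T} (hs : s ∉ P) (h : ∀ f ∈ N₁, s • f ∈ N₂) :
    Module.length (Localization.AtPrime P)
      (LocalizedModule P.primeCompl (SubQuotient N₁ N₂)) = 0 := by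
  refine length_localizedModule_eq_zero P hs fun y => ?_
  obtain ⟨f, rfl⟩ := Submodule.mkQ_surjective _ y
  rw [← map_smul, Submodule.mkQ_apply, Submodule.Quotient.mk_eq_zero]
  exact h f f.2

theorem length_localized_subQuotient_eq_one {s : T} (hs : s ∉ P) {u : M} (hu : u ∈ N₁)
    (hkill : ∀ r ∈ P, r • u ∈ N₂) (hann : ∀ r : T, r • u ∈ N₂ → r ∈ P)
    (hgen : ∀ f ∈ N₁, ∃ g : T, s • f - g • u ∈ N₂) :
    Module.length (Localization.AtPrime P)
      (LocalizedModule P.primeCompl (SubQuotient N₁ N₂)) = 1 := by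
  have hmk : ∀ (r : T), r • (N₂.submoduleOf N₁).mkQ ⟨u, hu⟩ = 0 ↔ r • u ∈ N₂ := by
    intro r
    rw [← map_smul, Submodule.mkQ_apply, Submodule.Quotient.mk_eq_zero]
    rfl
  refine length_localizedModule_eq_one P hs (u := (N₂.submoduleOf N₁).mkQ ⟨u, hu⟩)
    (fun r hr => (hmk r).2 (hkill r hr)) (fun r hr => hann r ((hmk r).1 hr)) fun y => ?_
  obtain ⟨f, rfl⟩ := Submodule.mkQ_surjective _ y
  obtain ⟨g, hg⟩ := hgen f f.2
  refine ⟨g, ?_⟩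
  rw [← sub_eq_zero, ← map_smul, ← map_smul, ← map_sub, Submodule.mkQ_apply,
    Submodule.Quotient.mk_eq_zero]
  exact hg

end LocalLength

/-! ### The localized Sally module -/

section Sally

variable {A : Type u} [CommRing A] {m Q : Ideal A}

theorem monomial_one_notMem_extendedIdeal {a : A} (h : monomial 1 a ∈ reesAlgebra Q)
    (ha : a ∉ Q * m) : (⟨monomial 1 a, h⟩ : reesAlgebra Q) ∉ extendedIdeal m Q := by
  intro hs
  have := (mem_extendedIdeal_iff _).1 hs 1
  simp only [coeff_monomial, if_true, pow_one] at this
  exact ha this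

theorem coeff_monomial_one_mul_succ (f : A[X]) (x : A) (n : ℕ) :
    (monomial 1 x * f).coeff (n + 1) = x * f.coeff n := by
  rw [← C_mul_X_eq_monomial, mul_assoc, coeff_C_mul, coeff_X_mul]

theorem coeff_monomial_one_mul_zero (f : A[X]) (x : A) : (monomial 1 x * f).coeff 0 = 0 := by
  rw [← C_mul_X_eq_monomial, mul_assoc, coeff_C_mul, coeff_X_mul_zero, mul_zero]

/-- If some `b ∈ Q` outside `Q m` satisfies `b m ^ (n + 1) ≤ Q ^ (n + 1) m` for all `n`, then the
element `b t` outside `m R(Q)` kills the Sally module. -/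
theorem hasLocalSallyLength_zero (hp : (extendedIdeal m Q).IsPrime) (hQ : Q ≤ m) {b : A}
    (hb : b ∈ Q) (hbm : b ∉ Q * m) (h : ∀ n, ∀ x ∈ m ^ (n + 1), b * x ∈ Q ^ (n + 1) * m) :
    HasLocalSallyLength Q m 0 := by
  have hb' : monomial 1 b ∈ reesAlgebra Q := reesAlgebra.monomial_mem.2 (by simpa using hb)
  refine ⟨hp, length_localized_subQuotient_eq_zero _
    (monomial_one_notMem_extendedIdeal hb' hbm) fun f hf => ?_⟩
  change monomial 1 b * f ∈ _
  rw [mem_reesBot_iff]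
  intro n
  cases n with
  | zero => rw [coeff_monomial_one_mul_zero]; exact zero_mem _
  | succ n =>
    rw [coeff_monomial_one_mul_succ]
    exact h n _ (coeff_mem_of_mem_reesTop hQ hf n)

/-- Suppose that `u ∈ m ^ 2` has `m u ≤ Q m`, that multiplication by `a t`, with `a ∈ Q` outside
`Q m`, maps the Sally module into the submodule generated by `u t`, and that the annihilator of
`u t` is `m R(Q)`. Then the localization of the Sally module at `m R(Q)` is the residue field. -/
theorem hasLocalSallyLength_one (hp : (extendedIdeal m Q).IsPrime) (hQ : Q ≤ m) {a u : A}
    (ha : a ∈ Q) (ham : a ∉ Q * m) (hu : u ∈ m ^ 2) (hkill : ∀ x ∈ m, x * u ∈ Q * m)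
    (hgen : ∀ n, ∀ x ∈ m ^ (n + 1), ∃ g ∈ Q ^ n, a * x - g * u ∈ Q ^ (n + 1) * m)
    (hann : ∀ n, ∀ s ∈ Q ^ n, s * u ∈ Q ^ (n + 1) * m → s ∈ Q ^ n * m) :
    HasLocalSallyLength Q m 1 := by
  have ha' : monomial 1 a ∈ reesAlgebra Q := reesAlgebra.monomial_mem.2 (by simpa using ha)
  refine ⟨hp, length_localized_subQuotient_eq_one _ (monomial_one_notMem_extendedIdeal ha' ham)
    (monomial_one_mem_reesTop hu) (fun r hr => ?_) (fun r hr => ?_) fun f hf => ?_⟩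
  · change (r : A[X]) * monomial 1 u ∈ reesBot Q m
    rw [mem_reesBot_iff, mul_comm]
    intro n
    cases n with
    | zero => rw [coeff_monomial_one_mul_zero]; exact zero_mem _
    | succ n =>
      rw [coeff_monomial_one_mul_succ, mul_comm u]
      have h1 := (mem_extendedIdeal_iff r).1 hr n
      have h2 : ∀ y ∈ Q ^ n * m, y * u ∈ Q ^ (n + 1) * m := by
        intro y hy
        induction hy using Submodule.mul_induction_on' with
        | mem_mul_mem q hq x hx =>
          rw [mul_assoc, pow_succ, mul_assoc]
          exact Ideal.mul_mem_mul hq (hkill x hx)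
        | add y _ y' _ h h' => rw [add_mul]; exact add_mem h h'
      exact h2 _ h1
  · rw [mem_extendedIdeal_iff]
    intro n
    have h2 : (r : A[X]) * monomial 1 u ∈ reesBot Q m := hr
    rw [mem_reesBot_iff, mul_comm] at h2
    have h3 := h2 (n + 1)
    rw [coeff_monomial_one_mul_succ, mul_comm u] at h3
    exact hann n _ (r.2 n) h3
  · choose g hg hgf using fun n => hgen n _ (coeff_mem_of_mem_reesTop hQ hf n)
    let G : A[X] := ∑ n ∈ f.support, monomial n (g n)
    have hG : G ∈ reesAlgebra Q := Subalgebra.sum_mem _ fun n _ =>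
      reesAlgebra.monomial_mem.2 (hg n)
    refine ⟨⟨G, hG⟩, ?_⟩
    change monomial 1 a * f - G * monomial 1 u ∈ reesBot Q m
    rw [mem_reesBot_iff, mul_comm G]
    intro n
    cases n with
    | zero =>
      rw [coeff_sub, coeff_monomial_one_mul_zero, coeff_monomial_one_mul_zero, sub_zero]
      exact zero_mem _
    | succ n =>
      rw [coeff_sub, coeff_monomial_one_mul_succ, coeff_monomial_one_mul_succ]
      have hGn : G.coeff n = if n ∈ f.support then g n else 0 := by
        simp [G, coeff_monomial]
      rw [hGn, mul_comm u]
      split_ifs with hn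
      · exact hgf n
      · rw [notMem_support_iff.1 hn]; simp

end Sally

/-! ### Reductions and integral closure -/

section Reduction

variable {A : Type u} [CommRing A] {m Q : Ideal A}

theorem IsReduction.radical_eq [m.IsMaximal] (h : IsReduction Q m) : Q.radical = m := by
  obtain ⟨hle, n, hn⟩ := h
  apply le_antisymm
  · exact (Ideal.radical_mono hle).trans (Ideal.IsPrime.radical inferInstance).le
  · intro x hx
    refine ⟨n + 1, ?_⟩
    have := Ideal.pow_mem_pow hx (n + 1)
    rw [hn] at this
    exact (Ideal.mul_le_inf this).1

/-- A maximal ideal is integrally closed. -/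
theorem idealIntegralClosure_self [m.IsMaximal] : idealIntegralClosure m = m := by
  ext x
  constructor
  · rintro ⟨n, hn, a, ha, h⟩
    have h1 : ∑ i ∈ Finset.Icc 1 n, a i * x ^ (n - i) ∈ m := by
      refine Ideal.sum_mem _ fun i hi => Ideal.mul_mem_right _ _ ?_
      exact Ideal.pow_le_self (by have := (Finset.mem_Icc.1 hi).1; omega) (ha i)
    have h2 : x ^ n ∈ m := by
      rw [eq_neg_of_add_eq_zero_left h]; exact m.neg_mem h1
    exact Ideal.IsPrime.mem_of_pow_mem inferInstance n h2
  · intro hx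
    refine ⟨1, one_pos, fun i => if i = 1 then -x else 0, fun i => ?_, by simp⟩
    dsimp only
    split_ifs with h
    · subst h; simpa using hx
    · exact zero_mem _

/-- An ideal is integral over its reductions: by the Cayley-Hamilton theorem for `m ^ n`, an
element `x` of `m` satisfies an equation `p(x) m ^ n = 0` of integral dependence, so that
`x ^ n p(x) = 0`. -/
theorem IsReduction.idealIntegralClosure_eq [IsNoetherianRing A] [m.IsMaximal]
    (h : IsReduction Q m) : idealIntegralClosure Q = m := by
  obtain ⟨hle, n, hn⟩ := h
  apply subset_antisymm
  · rw [← idealIntegralClosure_self (m := m)]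
    rintro x ⟨n, hn, a, ha, h⟩
    exact ⟨n, hn, a, fun i => Ideal.pow_right_mono hle i (ha i), h⟩
  · intro x hx
    have hmap : ∀ y ∈ m ^ n, x * y ∈ m ^ n := fun y hy => Ideal.mul_mem_left _ _ hy
    let f : Module.End A (m ^ n : Ideal A) := (LinearMap.mulLeft A x).restrict hmap
    obtain ⟨p, hpm, hpd, hpc, hp⟩ :=
      LinearMap.exists_monic_and_natDegree_eq_and_coeff_mem_pow_and_aeval_eq_zero A f Q (by
        rintro _ ⟨y, rfl⟩
        have h1 : x * (y : A) ∈ Q * m ^ n := by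
          rw [← hn, pow_succ']; exact Ideal.mul_mem_mul hx y.2
        obtain ⟨z, hz, hzy⟩ : ∃ z ∈ Q • (⊤ : Submodule A (m ^ n : Ideal A)), (z : A) = x * y := by
          have h2 : x * (y : A) ∈ Submodule.map (m ^ n).subtype (Q • ⊤) := by
            rw [Submodule.map_smul'', Submodule.map_top, Submodule.range_subtype]
            exact h1
          obtain ⟨z, hz, hzy⟩ := h2
          exact ⟨z, hz, hzy⟩
        have : f y = z := Subtype.ext hzy.symm
        rwa [this])
    have hfpow : ∀ (i : ℕ) (y : (m ^ n : Ideal A)), (((f ^ i) y : (m ^ n : Ideal A)) : A) =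
        x ^ i * y := by
      intro i y
      induction i with
      | zero => simp
      | succ i ih =>
        rw [pow_succ', Module.End.mul_apply, pow_succ', mul_assoc, ← ih]
        rfl
    have hxp : x ^ n * p.eval x = 0 := by
      have h1 := congrArg (fun g : Module.End A (m ^ n : Ideal A) =>
        ((g ⟨x ^ n, Ideal.pow_mem_pow hx n⟩ : (m ^ n : Ideal A)) : A)) hp
      simp only [aeval_eq_sum_range, LinearMap.sum_apply, LinearMap.smul_apply,
        LinearMap.zero_apply, AddSubmonoidClass.coe_finsetSum, Submodule.coe_smul, hfpow,
        ZeroMemClass.coe_zero] at h1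
      rw [eval_eq_sum_range, Finset.mul_sum, ← h1]
      refine Finset.sum_congr rfl fun i _ => ?_
      rw [smul_eq_mul]; ring
    -- the equation `x ^ (n + 1) * p(x) = 0`, whose degree is positive
    refine ⟨p.natDegree + (n + 1), by omega,
      fun i => if i ≤ p.natDegree then p.coeff (p.natDegree - i) else 0, fun i => ?_, ?_⟩
    · dsimp only
      split_ifs with h
      · have := hpc (p.natDegree - i)
        rwa [Nat.sub_sub_self h] at this
      · exact zero_mem _
    · have h1 : x ^ (n + 1) * p.eval x = 0 := by rw [pow_succ', mul_assoc, hxp, mul_zero]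
      refine Eq.trans ?_ h1
      rw [eval_eq_sum_range, ← Finset.sum_range_reflect, Finset.sum_range_succ', mul_add, add_comm]
      dsimp only
      congr 1
      · rw [← Finset.sum_subset (Finset.Icc_subset_Icc_right
          (by omega : p.natDegree ≤ p.natDegree + (n + 1))), Finset.mul_sum]
        · refine Finset.sum_nbij' (· - 1) (· + 1) ?_ ?_ ?_ ?_ ?_
          · intro i hi; simp only [Finset.mem_Icc, Finset.mem_range] at hi ⊢; omega
          · intro i hi; simp only [Finset.mem_Icc, Finset.mem_range] at hi ⊢; omega
          · intro i hi; simp only [Finset.mem_Icc] at hi; omega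
          · intro i hi; simp
          · intro i hi
            simp only [Finset.mem_Icc] at hi
            rw [if_pos hi.2, show p.natDegree + (n + 1) - i = (n + 1) + (p.natDegree - i) by omega,
              show p.natDegree + 1 - 1 - (i - 1 + 1) = p.natDegree - i by omega, pow_add]
            ring
        · intro i hi hi'
          simp only [Finset.mem_Icc] at hi hi'
          rw [if_neg (by omega), zero_mul]
      · rw [add_tsub_cancel_right, Nat.sub_zero, hpm.coeff_natDegree, one_mul, ← pow_add, add_comm]

/-- A criterion for minimal reductions. The homomorphisms `φ` detect leading forms: if the elements
of a reduction `K ≤ (a, b)` of `m` satisfied a common linear relation modulo `(a, b) m`, some `φ`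
would map `K` into `(X ^ 2)`, hence `m ^ (n + 1) = K m ^ n` into `(X ^ (n + 2))`; but it maps some
element of `m` to a multiple of `X` by a unit. -/
theorem isMinimalReduction_span_pair {k : Type*} [Field k] [Algebra k A] [IsNoetherianRing A]
    [IsLocalRing A] (hmax : IsLocalRing.maximalIdeal A = m) {a b : A}
    (hm : ∀ x : A, ∃ c : k, x - algebraMap k A c ∈ m) (h : IsReduction (Ideal.span {a, b}) m)
    (hφ : ∀ c d : k, ∃ φ : A →ₐ[k] PowerSeries k, (∀ x ∈ m, PowerSeries.X ∣ φ x) ∧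
      φ a = c • PowerSeries.X ∧ φ b = d • PowerSeries.X) :
    IsMinimalReduction (Ideal.span {a, b}) m := by
  refine ⟨h, fun K hK hKQ => ?_⟩
  have ha : a ∈ Ideal.span {a, b} := Ideal.subset_span (Or.inl rfl)
  have hb : b ∈ Ideal.span {a, b} := Ideal.subset_span (Or.inr rfl)
  have hform : ∀ x ∈ K, ∃ α β : k, x - (α • a + β • b) ∈ Ideal.span {a, b} * m := by
    intro x hx
    obtain ⟨c, hc⟩ := exists_sub_formEval_mem (n := 1) hm (by simpa using hKQ hx)
    refine ⟨c 1, c 0, ?_⟩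
    simpa [formEval, add_comm] using hc
  -- no nonzero `(c, d)` is orthogonal to the linear forms of all elements of `K`
  have horth : ∀ c d : k, (∀ x ∈ K, ∀ α β : k, x - (α • a + β • b) ∈ Ideal.span {a, b} * m →
      α * c + β * d = 0) → c = 0 ∧ d = 0 := by
    intro c d hcd
    obtain ⟨φ, hφm, hφa, hφb⟩ := hφ c d
    have hφQ : ∀ x ∈ Ideal.span {a, b}, PowerSeries.X ∣ φ x := fun x hx => hφm x (h.1 hx)
    have hφQm : ∀ x ∈ Ideal.span {a, b} * m, PowerSeries.X ^ 2 ∣ φ x := by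
      intro x hx
      induction hx using Submodule.mul_induction_on' with
      | mem_mul_mem q hq x hx => rw [map_mul, pow_two]; exact mul_dvd_mul (hφQ q hq) (hφm x hx)
      | add y _ y' _ h h' => rw [map_add]; exact dvd_add h h'
    have hφK : ∀ x ∈ K, PowerSeries.X ^ 2 ∣ φ x := by
      intro x hx
      obtain ⟨α, β, hαβ⟩ := hform x hx
      have h1 : φ (α • a + β • b) = 0 := by
        rw [map_add, map_smul, map_smul, hφa, hφb, smul_smul, smul_smul, ← add_smul,
          hcd x hx α β hαβ, zero_smul]
      have h2 := hφQm _ hαβ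
      rwa [map_sub, h1, sub_zero] at h2
    obtain ⟨-, n, hn⟩ := hK
    have hφpow : ∀ i, ∀ x ∈ m ^ i, PowerSeries.X ^ i ∣ φ x := by
      intro i
      induction i with
      | zero => intro x _; simp
      | succ i ih =>
        intro x hx
        rw [pow_succ] at hx
        induction hx using Submodule.mul_induction_on' with
        | mem_mul_mem q hq x hx => rw [map_mul, pow_succ]; exact mul_dvd_mul (ih q hq) (hφm x hx)
        | add y _ y' _ h h' => rw [map_add]; exact dvd_add h h'
    have hφtop : ∀ x ∈ m ^ (n + 1), PowerSeries.X ^ (n + 2) ∣ φ x := by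
      intro x hx
      rw [hn] at hx
      induction hx using Submodule.mul_induction_on' with
      | mem_mul_mem q hq x hx =>
        rw [map_mul, add_comm, pow_add]; exact mul_dvd_mul (hφK q hq) (hφpow n x hx)
      | add y _ y' _ h h' => rw [map_add]; exact dvd_add h h'
    have key : ∀ (y : A) (e : k), y ∈ m → φ y = e • PowerSeries.X → e = 0 := by
      intro y e hy he
      have h1 := hφtop _ (Ideal.pow_mem_pow hy (n + 1))
      rw [map_pow, he, _root_.smul_pow, PowerSeries.X_pow_dvd_iff] at h1
      have h2 := h1 (n + 1) (by omega)
      simpa [PowerSeries.coeff_X_pow] using h2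
    exact ⟨key a c (h.1 ha) hφa, key b d (h.1 hb) hφb⟩
  have hle : Ideal.span {a, b} ≤ K ⊔ m • Ideal.span {a, b} := by
    -- two elements of `K` with linearly independent linear forms
    obtain ⟨x, hx, α, β, hαβ, y, hy, α', β', hαβ', hdet⟩ : ∃ x ∈ K, ∃ α β : k,
        x - (α • a + β • b) ∈ Ideal.span {a, b} * m ∧ ∃ y ∈ K, ∃ α' β' : k,
        y - (α' • a + β' • b) ∈ Ideal.span {a, b} * m ∧ α * β' - β * α' ≠ 0 := by
      by_contra! hcon
      have hzero : ∀ x ∈ K, ∀ α β : k, x - (α • a + β • b) ∈ Ideal.span {a, b} * m →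
          α = 0 ∧ β = 0 := by
        intro x hx α β hαβ
        have := horth β (-α) fun y hy α' β' hαβ' => by
          linear_combination -hcon x hx α β hαβ y hy α' β' hαβ'
        exact ⟨neg_eq_zero.1 this.2, this.1⟩
      have := (horth 1 0 fun x hx α β hαβ => by
        rw [(hzero x hx α β hαβ).1, (hzero x hx α β hαβ).2]; ring).1
      exact one_ne_zero this
    set D := α * β' - β * α' with hD
    have hcomb : ∀ γ δ : k, γ • a + δ • b ∈ K ⊔ m • Ideal.span {a, b} := by
      intro γ δ
      have hxy : ∀ s t : k, s • (α • a + β • b) + t • (α' • a + β' • b) ∈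
          K ⊔ m • Ideal.span {a, b} := by
        intro s t
        have hmem : ∀ (x l : A), x ∈ K → x - l ∈ Ideal.span {a, b} * m →
            l ∈ K ⊔ m • Ideal.span {a, b} := by
          intro x l hx hl
          have h1 : x - l ∈ K ⊔ m • Ideal.span {a, b} := by
            rw [smul_eq_mul, mul_comm m]; exact Ideal.mem_sup_right hl
          have h2 := Ideal.sub_mem _ (Ideal.mem_sup_left hx) h1
          rwa [sub_sub_cancel] at h2
        exact add_mem (smul_mem_ideal _ _ (hmem _ _ hx hαβ))
          (smul_mem_ideal _ _ (hmem _ _ hy hαβ'))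
      convert hxy (D⁻¹ * (γ * β' - δ * α')) (D⁻¹ * (δ * α - γ * β)) using 1
      have h1 : D⁻¹ * (γ * β' - δ * α') * α + D⁻¹ * (δ * α - γ * β) * α' = γ := by
        have : D⁻¹ * D = 1 := inv_mul_cancel₀ hdet
        rw [hD] at this ⊢
        linear_combination γ * this
      have h2 : D⁻¹ * (γ * β' - δ * α') * β + D⁻¹ * (δ * α - γ * β) * β' = δ := by
        have : D⁻¹ * D = 1 := inv_mul_cancel₀ hdet
        rw [hD] at this ⊢
        linear_combination δ * this
      rw [smul_add, smul_add, smul_smul, smul_smul, smul_smul, smul_smul, add_add_add_comm,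
        ← add_smul, ← add_smul, h1, h2]
    rw [Ideal.span_le, Set.pair_subset_iff]
    exact ⟨by simpa using hcomb 1 0, by simpa using hcomb 0 1⟩
  -- Nakayama's lemma
  refine Submodule.le_of_le_smul_of_le_jacobson_bot (IsNoetherian.noetherian _) ?_ hle
  rw [← hmax]
  exact (IsLocalRing.jacobson_eq_maximalIdeal ⊥ bot_ne_top).ge

end Reduction

/-! ### Dimension and Hilbert coefficients -/

section Dimension

variable {A : Type u} [CommRing A] [IsNoetherianRing A] [IsLocalRing A]

/-- The dimension is at most two by Krull's height theorem, and at least two because of the chain of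
the kernel of `g`, the kernel of `h ∘ g` and the maximal ideal. -/
theorem ringKrullDim_eq_two {Q : Ideal A} {a b : A} (hQ : Q = Ideal.span {a, b})
    (hrad : Q.radical = IsLocalRing.maximalIdeal A) {D D' : Type*} [CommRing D] [IsDomain D]
    [CommRing D'] [IsDomain D'] (g : A →+* D) (h : D →+* D') {z w : A} (hz : g z ≠ 0)
    (hhz : h (g z) = 0) (hw : h (g w) ≠ 0) (hwm : w ∈ IsLocalRing.maximalIdeal A) :
    ringKrullDim A = 2 := by
  apply le_antisymm
  · rw [← IsLocalRing.maximalIdeal_height_eq_ringKrullDim]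
    have hmin : IsLocalRing.maximalIdeal A ∈ (Ideal.span {a, b}).minimalPrimes := by
      rw [← Ideal.radical_minimalPrimes, ← hQ, hrad, Ideal.minimalPrimes_eq_subsingleton_self]
      rfl
    have h1 := Ideal.height_le_card_of_mem_minimalPrimes_span (Set.toFinite _) hmin
    have h2 : (({a, b} : Set A).ncard : ℕ∞) ≤ 2 := by
      have := Set.ncard_insert_le a {b}
      rw [Set.ncard_singleton] at this
      exact_mod_cast this
    exact WithBot.coe_le_coe.2 (h1.trans h2)
  · let p₀ : PrimeSpectrum A := ⟨RingHom.ker g, RingHom.ker_isPrime g⟩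
    let p₁ : PrimeSpectrum A := ⟨RingHom.ker (h.comp g), RingHom.ker_isPrime _⟩
    let p₂ : PrimeSpectrum A := IsLocalRing.closedPoint A
    have h01 : p₀ < p₁ := by
      refine lt_of_le_of_ne (fun x hx => ?_) fun heq => ?_
      · change h (g x) = 0
        rw [show g x = 0 from hx, map_zero]
      · have : z ∈ p₁.asIdeal := hhz
        rw [← heq] at this
        exact hz this
    have h12 : p₁ < p₂ := by
      refine lt_of_le_of_ne (IsLocalRing.le_maximalIdeal (RingHom.ker_isPrime _).ne_top)
        fun heq => ?_
      have : w ∈ p₂.asIdeal := hwm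
      rw [← heq] at this
      exact hw this
    let c : LTSeries (PrimeSpectrum A) :=
      { length := 2
        toFun := ![p₀, p₁, p₂]
        step := fun i => by fin_cases i <;> assumption }
    exact Order.LTSeries.length_le_krullDim c

end Dimension

section HilbertCoefficient

variable {A : Type u} [CommRing A]

theorem isParameterIdeal_span_pair [IsLocalRing A] (hdim : ringKrullDim A = 2) {a b : A}
    (hrad : (Ideal.span {a, b}).radical = IsLocalRing.maximalIdeal A) :
    IsParameterIdeal (Ideal.span {a, b}) :=
  ⟨2, hdim, ⟨![a, b], by simp [Set.pair_comm]⟩, hrad⟩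

/-- In dimension two, the Hilbert function of `m`, the lengths of `Q ^ n / Q ^ n m` and the lengths
`s₁ * n + s₀` of the components `m ^ (n + 1) / Q ^ n m` of the Sally module determine the Hilbert
polynomial of `Q`. -/
theorem isHilbertCoefficient_one_of_length {m Q : Ideal A} (hdim : ringKrullDim A = 2)
    (hfin : Module.length A (A ⧸ m ^ 2) ≠ ⊤)
    (hm : ∀ n, 2 ≤ n → Module.length A (A ⧸ m ^ (n + 1)) =
      Module.length A (A ⧸ m ^ n) + ((8 * n + 6 : ℕ) : ℕ∞))
    (hQ : ∀ n, Module.length A (A ⧸ (Q ^ n * m)) =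
      Module.length A (A ⧸ Q ^ n) + ((n + 1 : ℕ) : ℕ∞))
    {s₁ s₀ : ℕ} (hS : ∀ᶠ n in atTop, Module.length A (A ⧸ (Q ^ n * m)) =
      Module.length A (A ⧸ m ^ (n + 1)) + ((s₁ * n + s₀ : ℕ) : ℕ∞)) :
    IsHilbertCoefficient Q 1 (-5 - (s₁ : ℤ)) := by
  obtain ⟨l₂, hl₂⟩ := ENat.ne_top_iff_exists.1 hfin
  have hlen : ∀ n : ℕ, 2 ≤ n → ∃ l : ℕ, Module.length A (A ⧸ m ^ n) = (l : ℕ∞) ∧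
      (l : ℤ) = 4 * (n : ℤ) ^ 2 + 2 * n + (l₂ - 20) := by
    intro n hn
    induction n, hn using Nat.le_induction with
    | base => exact ⟨l₂, hl₂.symm, by push_cast; ring⟩
    | succ n hn ih =>
      obtain ⟨l, hl, hln⟩ := ih
      refine ⟨l + (8 * n + 6), by rw [hm n hn, hl]; push_cast; rfl, ?_⟩
      push_cast
      rw [hln]; ring
  -- `4 (n + 2)² + 2 (n + 2) + (l₂ - 20) + s₁ (n + 1) + s₀ - (n + 2)` in terms of binomials
  refine ⟨2, fun j => if j = 0 then 8 else if j = 1 then -5 - (s₁ : ℤ) else (l₂ - 20) + 5 + s₀,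
    hdim, by norm_num, by simp, ?_⟩
  filter_upwards [(tendsto_add_atTop_nat 1).eventually hS] with n hn
  obtain ⟨l, hl, hln⟩ := hlen (n + 1 + 1) (by omega)
  rw [hQ, hl] at hn
  have htop : Module.length A (A ⧸ Q ^ (n + 1)) ≠ ⊤ := by
    intro h
    rw [h, top_add] at hn
    exact ENat.top_ne_natCast (l + (s₁ * (n + 1) + s₀)) (by rw [hn]; push_cast; rfl)
  obtain ⟨q, hq⟩ := ENat.ne_top_iff_exists.1 htop
  refine ⟨q, hq.symm, ?_⟩
  rw [← hq] at hn
  have hn' : q + (n + 1 + 1) = l + (s₁ * (n + 1) + s₀) := by exact_mod_cast hn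
  have hqz : (q : ℤ) = l + (s₁ * (n + 1) + s₀) - (n + 2) := by
    have : ((q + (n + 1 + 1) : ℕ) : ℤ) = ((l + (s₁ * (n + 1) + s₀) : ℕ) : ℤ) := by rw [hn']
    push_cast at this
    linear_combination this
  have hchoose : (2 : ℤ) * ((n + 2).choose 2 : ℤ) = (n + 2) * (n + 1) := by
    have h3 := Nat.choose_two_right (n + 2)
    have h4 : 2 ∣ (n + 2) * (n + 2 - 1) := (Nat.even_mul_pred_self (n + 2)).two_dvd
    have h5 : 2 * (n + 2).choose 2 = (n + 2) * (n + 1) := by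
      rw [h3, Nat.mul_div_cancel' h4]; rfl
    exact_mod_cast h5
  simp only [Finset.sum_range_succ, Finset.sum_range_zero]
  simp only [if_true, Nat.sub_zero, show n + 2 - 1 = n + 1 by omega, show 2 - 1 = 1 by rfl,
    Nat.choose_one_right, show n + 2 - 2 = n by omega, Nat.sub_self, Nat.choose_zero_right]
  norm_num
  rw [hqz, hln]
  push_cast
  linear_combination (-4 : ℤ) * hchoose

end HilbertCoefficient

/-! ### Products in `B` -/

section Relations

variable {B : Type*} [CommRing B]

/-- The relations between `x, y, z, w` in `k[[X, Y, Z, W]] / ((X², Y²) ∩ (Z, W))`. -/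
structure Relations (x y z w : B) : Prop where
  xz : x ^ 2 * z = 0
  xw : x ^ 2 * w = 0
  yz : y ^ 2 * z = 0
  yw : y ^ 2 * w = 0

/-- The ideal `(x, y)² + (z, w)`. -/
def sqIdeal (x y z w : B) : Ideal B := Ideal.span {x, y} ^ 2 ⊔ Ideal.span {z, w}

variable {x y z w : B}

theorem sqIdeal_eq_span : sqIdeal x y z w = Ideal.span {x ^ 2, x * y, y ^ 2, z, w} := by
  have h : (Ideal.span {x, y} : Ideal B) ^ 2 = Ideal.span {x ^ 2, x * y, y ^ 2} := by
    rw [pow_two, Ideal.span_pair_mul_span_pair]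
    rw [mul_comm y x, ← pow_two, ← pow_two]
    congr 1
    ext t
    simp only [Set.mem_insert_iff, Set.mem_singleton_iff]
    tauto
  rw [sqIdeal, h, ← Ideal.span_union]
  congr 1
  ext t
  simp only [Set.mem_union, Set.mem_insert_iff, Set.mem_singleton_iff]
  tauto

theorem xx_mem_sqIdeal : x ^ 2 ∈ sqIdeal x y z w := by
  rw [sqIdeal_eq_span]; exact Ideal.subset_span (by simp)

theorem xy_mem_sqIdeal : x * y ∈ sqIdeal x y z w := by
  rw [sqIdeal_eq_span]; exact Ideal.subset_span (by simp)

theorem yy_mem_sqIdeal : y ^ 2 ∈ sqIdeal x y z w := by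
  rw [sqIdeal_eq_span]; exact Ideal.subset_span (by simp)

theorem z_mem_sqIdeal : z ∈ sqIdeal x y z w := by
  rw [sqIdeal_eq_span]; exact Ideal.subset_span (by simp)

theorem w_mem_sqIdeal : w ∈ sqIdeal x y z w := by
  rw [sqIdeal_eq_span]; exact Ideal.subset_span (by simp)

/-- Membership of `t * j` for `j` in `(x, y)² + (z, w)` can be checked on the five generators. -/
theorem mul_mem_of_mem_sqIdeal {t : B} {K : Ideal B} (h1 : t * x ^ 2 ∈ K) (h2 : t * (x * y) ∈ K)
    (h3 : t * y ^ 2 ∈ K) (h4 : t * z ∈ K) (h5 : t * w ∈ K) {j : B} (hj : j ∈ sqIdeal x y z w) :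
    t * j ∈ K := by
  rw [sqIdeal_eq_span] at hj
  induction hj using Submodule.span_induction with
  | mem j hj => rcases hj with rfl | rfl | rfl | rfl | rfl <;> assumption
  | zero => simp
  | add j j' _ _ h h' => rw [mul_add]; exact add_mem h h'
  | smul c j _ h => rw [smul_eq_mul, mul_left_comm]; exact K.mul_mem_left _ h

theorem mul_add_mul_mem_span_pair_mul {a b : B} {J : Ideal B} {s t : B} (hs : s ∈ J) (ht : t ∈ J) :
    a * s + b * t ∈ Ideal.span {a, b} * J :=
  add_mem (Ideal.mul_mem_mul (Ideal.subset_span (Or.inl rfl)) hs)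
    (Ideal.mul_mem_mul (Ideal.subset_span (Or.inr rfl)) ht)

namespace Relations

variable (h : Relations x y z w)
include h

/-- The square of `J = (x, y)² + (z, w)` modulo an ideal `K` is generated by products of
generators, where the relations remove the products of `x², y²` with `z, w`. -/
theorem sq_le {K : Ideal B} (hxx : x ^ 2 * x ^ 2 ∈ K) (hxxxy : x * y * x ^ 2 ∈ K)
    (hxxyy : x ^ 2 * y ^ 2 ∈ K) (hxyyy : x * y * y ^ 2 ∈ K) (hxyz : x * y * z ∈ K)
    (hxyw : x * y * w ∈ K) (hyy : y ^ 2 * y ^ 2 ∈ K) (hzz : z * z ∈ K) (hzw : z * w ∈ K)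
    (hww : w * w ∈ K) : sqIdeal x y z w ^ 2 ≤ K := by
  have h1 : x ^ 2 * z ∈ K := h.xz ▸ K.zero_mem
  have h2 : x ^ 2 * w ∈ K := h.xw ▸ K.zero_mem
  have h3 : y ^ 2 * z ∈ K := h.yz ▸ K.zero_mem
  have h4 : y ^ 2 * w ∈ K := h.yw ▸ K.zero_mem
  have h5 : x * y * (x * y) ∈ K := by convert hxxyy using 1; ring
  rw [pow_two, Ideal.mul_le]
  intro s hs t ht
  refine mul_mem_of_mem_sqIdeal ?_ ?_ ?_ ?_ ?_ ht <;> rw [mul_comm] <;>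
    refine mul_mem_of_mem_sqIdeal ?_ ?_ ?_ ?_ ?_ hs
  all_goals first
    | assumption
    | (rw [mul_comm]; assumption)

section Squares

/-- Modulo `(x² - z, y² - w) J`, the ideal `J²` is generated by `x³y` and `xy³`. -/
theorem sq_le_sup : sqIdeal x y z w ^ 2 ≤
    Ideal.span {x ^ 2 - z, y ^ 2 - w} * sqIdeal x y z w ⊔
      Ideal.span {x * y * x ^ 2, x * y * y ^ 2} := by
  obtain ⟨hxz, hxw, hyz, hyw⟩ := h
  have hx := xx_mem_sqIdeal (x := x) (y := y) (z := z) (w := w)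
  have hxy := xy_mem_sqIdeal (x := x) (y := y) (z := z) (w := w)
  have hy := yy_mem_sqIdeal (x := x) (y := y) (z := z) (w := w)
  have hz := z_mem_sqIdeal (x := x) (y := y) (z := z) (w := w)
  have hw := w_mem_sqIdeal (x := x) (y := y) (z := z) (w := w)
  have h0 := (sqIdeal x y z w).zero_mem
  have key : ∀ {t j₁ j₂ : B} (c d : B), j₁ ∈ sqIdeal x y z w → j₂ ∈ sqIdeal x y z w →
      t = ((x ^ 2 - z) * j₁ + (y ^ 2 - w) * j₂) + (c * (x * y * x ^ 2) + d * (x * y * y ^ 2)) →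
      t ∈ Ideal.span {x ^ 2 - z, y ^ 2 - w} * sqIdeal x y z w ⊔
        Ideal.span {x * y * x ^ 2, x * y * y ^ 2} := by
    rintro t j₁ j₂ c d h₁ h₂ rfl
    exact Submodule.add_mem_sup (mul_add_mul_mem_span_pair_mul h₁ h₂)
      (Ideal.mem_span_pair.2 ⟨c, d, rfl⟩)
  refine sq_le ⟨hxz, hxw, hyz, hyw⟩ (key 0 0 hx h0 ?_) (key 1 0 h0 h0 ?_) (key 0 0 h0 hx ?_)
    (key 0 1 h0 h0 ?_) (key 1 0 (neg_mem hxy) h0 ?_) (key 0 1 h0 (neg_mem hxy) ?_)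
    (key 0 0 h0 hy ?_) (key 0 0 (neg_mem hz) h0 ?_) (key 0 0 h0 (neg_mem hz) ?_)
    (key 0 0 h0 (neg_mem hw) ?_)
  · linear_combination hxz
  · ring
  · linear_combination hxw
  · ring
  · ring
  · ring
  · linear_combination hyw
  · linear_combination hxz
  · linear_combination hyz
  · linear_combination hyw

/-- The relations turn `x³y` times a generator of `J` into a multiple of a generator of `(x² - z, y²
- w)`, for instance `x³y * xy = (x² - z) * x²y²`. -/
theorem xxxy_mul_mem {j : B} (hj : j ∈ sqIdeal x y z w) : x * y * x ^ 2 * j ∈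
    Ideal.span {x ^ 2 - z, y ^ 2 - w} * sqIdeal x y z w ^ 2 := by
  have hx := xx_mem_sqIdeal (x := x) (y := y) (z := z) (w := w)
  have hxy := xy_mem_sqIdeal (x := x) (y := y) (z := z) (w := w)
  have hy := yy_mem_sqIdeal (x := x) (y := y) (z := z) (w := w)
  have h0 := (sqIdeal x y z w ^ 2).zero_mem
  have h1 := Ideal.mul_mem_mul hxy hx
  have h2 := Ideal.mul_mem_mul hx hy
  rw [← pow_two] at h1 h2
  refine mul_mem_of_mem_sqIdeal ?_ ?_ ?_ ?_ ?_ hj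
  · convert mul_add_mul_mem_span_pair_mul h1 h0 using 1
    linear_combination x * y * h.xz
  · convert mul_add_mul_mem_span_pair_mul h2 h0 using 1
    linear_combination y ^ 2 * h.xz
  · convert mul_add_mul_mem_span_pair_mul h0 h1 using 1
    linear_combination x * y * h.xw
  · convert Ideal.zero_mem _ using 1
    linear_combination x * y * h.xz
  · convert Ideal.zero_mem _ using 1
    linear_combination x * y * h.xw

theorem xyyy_mul_mem {j : B} (hj : j ∈ sqIdeal x y z w) : x * y * y ^ 2 * j ∈
    Ideal.span {x ^ 2 - z, y ^ 2 - w} * sqIdeal x y z w ^ 2 := by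
  have hx := xx_mem_sqIdeal (x := x) (y := y) (z := z) (w := w)
  have hxy := xy_mem_sqIdeal (x := x) (y := y) (z := z) (w := w)
  have hy := yy_mem_sqIdeal (x := x) (y := y) (z := z) (w := w)
  have h0 := (sqIdeal x y z w ^ 2).zero_mem
  have h1 := Ideal.mul_mem_mul hxy hy
  have h2 := Ideal.mul_mem_mul hx hy
  rw [← pow_two] at h1 h2
  refine mul_mem_of_mem_sqIdeal ?_ ?_ ?_ ?_ ?_ hj
  · convert mul_add_mul_mem_span_pair_mul h1 h0 using 1
    linear_combination x * y * h.yz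
  · convert mul_add_mul_mem_span_pair_mul h0 h2 using 1
    linear_combination y ^ 2 * h.xw
  · convert mul_add_mul_mem_span_pair_mul h0 h1 using 1
    linear_combination x * y * h.yw
  · convert Ideal.zero_mem _ using 1
    linear_combination x * y * h.yz
  · convert Ideal.zero_mem _ using 1
    linear_combination x * y * h.yw

/-- `J³ ≤ (x² - z, y² - w) J²`. -/
theorem cube_le : sqIdeal x y z w ^ 3 ≤
    Ideal.span {x ^ 2 - z, y ^ 2 - w} * sqIdeal x y z w ^ 2 := by
  rw [pow_succ, Ideal.mul_le]
  intro t ht j hj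
  obtain ⟨t₁, ht₁, t₂, ht₂, rfl⟩ := Submodule.mem_sup.1 (h.sq_le_sup ht)
  obtain ⟨c, d, rfl⟩ := Ideal.mem_span_pair.1 ht₂
  have h1 := Ideal.mul_mem_mul ht₁ hj
  rw [mul_assoc, ← pow_two] at h1
  convert add_mem h1 (add_mem (Ideal.mul_mem_left _ c (h.xxxy_mul_mem hj))
    (Ideal.mul_mem_left _ d (h.xyyy_mul_mem hj))) using 1
  ring

/-- As `x` and `y` move `x³y` and `xy³` into `(x² - z, y² - w) J`, the two elements span `J²` modulo
this ideal even over `k`. This is what is needed in `k + J`, where `x` and `y` are missing. -/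
theorem exists_sub_smul_mem {k : Type*} [Field k] [Algebra k B]
    (hdec : ∀ b : B, ∃ c₀ c₁ c₂ : k, ∃ j ∈ sqIdeal x y z w,
      b = algebraMap k B c₀ + c₁ • x + c₂ • y + j) {t : B} (ht : t ∈ sqIdeal x y z w ^ 2) :
    ∃ c d : k, t - (c • (x * y * x ^ 2) + d • (x * y * y ^ 2)) ∈
      Ideal.span {x ^ 2 - z, y ^ 2 - w} * sqIdeal x y z w := by
  have hx := xx_mem_sqIdeal (x := x) (y := y) (z := z) (w := w)
  have hy := yy_mem_sqIdeal (x := x) (y := y) (z := z) (w := w)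
  have h0 := (sqIdeal x y z w).zero_mem
  have hle : Ideal.span {x ^ 2 - z, y ^ 2 - w} * sqIdeal x y z w ^ 2 ≤
      Ideal.span {x ^ 2 - z, y ^ 2 - w} * sqIdeal x y z w :=
    Ideal.mul_mono_right (Ideal.pow_le_self two_ne_zero)
  obtain ⟨t₁, ht₁, t₂, ht₂, rfl⟩ := Submodule.mem_sup.1 (h.sq_le_sup ht)
  obtain ⟨c, d, rfl⟩ := Ideal.mem_span_pair.1 ht₂
  obtain ⟨c₀, c₁, c₂, j, hj, rfl⟩ := hdec c
  obtain ⟨d₀, d₁, d₂, j', hj', rfl⟩ := hdec d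
  refine ⟨c₀, d₀, ?_⟩
  have e1 : x * (x * y * x ^ 2) ∈ Ideal.span {x ^ 2 - z, y ^ 2 - w} * sqIdeal x y z w := by
    convert mul_add_mul_mem_span_pair_mul (Ideal.mul_mem_left _ y hx) h0 using 1
    linear_combination y * h.xz
  have e2 : y * (x * y * x ^ 2) ∈ Ideal.span {x ^ 2 - z, y ^ 2 - w} * sqIdeal x y z w := by
    convert mul_add_mul_mem_span_pair_mul h0 (Ideal.mul_mem_left _ x hx) using 1
    linear_combination x * h.xw
  have e3 : x * (x * y * y ^ 2) ∈ Ideal.span {x ^ 2 - z, y ^ 2 - w} * sqIdeal x y z w := by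
    convert mul_add_mul_mem_span_pair_mul h0 (Ideal.mul_mem_left _ y hx) using 1
    linear_combination y * h.xw
  have e4 : y * (x * y * y ^ 2) ∈ Ideal.span {x ^ 2 - z, y ^ 2 - w} * sqIdeal x y z w := by
    convert mul_add_mul_mem_span_pair_mul h0 (Ideal.mul_mem_left _ x hy) using 1
    linear_combination x * h.yw
  convert add_mem ht₁ (add_mem (add_mem (add_mem (smul_mem_ideal _ c₁ e1) (smul_mem_ideal _ c₂ e2))
    (hle (h.xxxy_mul_mem hj))) (add_mem (add_mem (smul_mem_ideal _ d₁ e3)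
      (smul_mem_ideal _ d₂ e4)) (hle (h.xyyy_mul_mem hj')))) using 1
  simp only [Algebra.smul_def]
  ring

end Squares

section Mixed

/-- Modulo `(xy - z, x² + y² - w) J`, the ideal `J²` is generated by `x²y²`. -/
theorem sq_le_sup' : sqIdeal x y z w ^ 2 ≤
    Ideal.span {x * y - z, x ^ 2 + y ^ 2 - w} * sqIdeal x y z w ⊔ Ideal.span {(x * y) ^ 2} := by
  obtain ⟨hxz, hxw, hyz, hyw⟩ := h
  have hx := xx_mem_sqIdeal (x := x) (y := y) (z := z) (w := w)
  have hxy := xy_mem_sqIdeal (x := x) (y := y) (z := z) (w := w)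
  have hy := yy_mem_sqIdeal (x := x) (y := y) (z := z) (w := w)
  have hz := z_mem_sqIdeal (x := x) (y := y) (z := z) (w := w)
  have hw := w_mem_sqIdeal (x := x) (y := y) (z := z) (w := w)
  have h0 := (sqIdeal x y z w).zero_mem
  have key : ∀ {t j₁ j₂ : B} (c : B), j₁ ∈ sqIdeal x y z w → j₂ ∈ sqIdeal x y z w →
      t = ((x * y - z) * j₁ + (x ^ 2 + y ^ 2 - w) * j₂) + c * (x * y) ^ 2 →
      t ∈ Ideal.span {x * y - z, x ^ 2 + y ^ 2 - w} * sqIdeal x y z w ⊔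
        Ideal.span {(x * y) ^ 2} := by
    rintro t j₁ j₂ c h₁ h₂ rfl
    exact Submodule.add_mem_sup (mul_add_mul_mem_span_pair_mul h₁ h₂)
      (Ideal.mem_span_singleton'.2 ⟨c, rfl⟩)
  refine sq_le ⟨hxz, hxw, hyz, hyw⟩ (key (-1) h0 hx ?_) (key 0 hx h0 ?_) (key 1 h0 h0 ?_)
    (key 0 hy h0 ?_) (key 1 (neg_mem hxy) h0 ?_) (key 0 (add_mem hx hy) (neg_mem hxy) ?_)
    (key (-1) h0 hy ?_) (key 1 (neg_mem (add_mem hxy hz)) h0 ?_) (key 0 h0 (neg_mem hz) ?_)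
    (key 0 h0 (neg_mem hw) ?_)
  · linear_combination hxw
  · linear_combination hxz
  · ring
  · linear_combination hyz
  · ring
  · linear_combination hxz + hyz
  · linear_combination hyw
  · ring
  · linear_combination hxz + hyz
  · linear_combination hxw + hyw

/-- The relations turn `x²y²` times a generator of `J` into a multiple of `xy - z`, for instance
`x²y² * xy = (xy - z) * x²y²`. -/
theorem xy_sq_mul_mem {j : B} (hj : j ∈ sqIdeal x y z w) : (x * y) ^ 2 * j ∈
    Ideal.span {x * y - z, x ^ 2 + y ^ 2 - w} * sqIdeal x y z w ^ 2 := by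
  have hx := xx_mem_sqIdeal (x := x) (y := y) (z := z) (w := w)
  have hxy := xy_mem_sqIdeal (x := x) (y := y) (z := z) (w := w)
  have hy := yy_mem_sqIdeal (x := x) (y := y) (z := z) (w := w)
  have h0 := (sqIdeal x y z w ^ 2).zero_mem
  have h1 := Ideal.mul_mem_mul hx hxy
  have h2 := Ideal.mul_mem_mul hxy hxy
  have h3 := Ideal.mul_mem_mul hy hxy
  rw [← pow_two] at h1 h2 h3
  refine mul_mem_of_mem_sqIdeal ?_ ?_ ?_ ?_ ?_ hj
  · convert mul_add_mul_mem_span_pair_mul h1 h0 using 1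
    linear_combination x * y * h.xz
  · convert mul_add_mul_mem_span_pair_mul h2 h0 using 1
    linear_combination y ^ 2 * h.xz
  · convert mul_add_mul_mem_span_pair_mul h3 h0 using 1
    linear_combination x * y * h.yz
  · convert Ideal.zero_mem _ using 1
    linear_combination y ^ 2 * h.xz
  · convert Ideal.zero_mem _ using 1
    linear_combination y ^ 2 * h.xw

/-- `J³ ≤ (xy - z, x² + y² - w) J²`. -/
theorem cube_le' : sqIdeal x y z w ^ 3 ≤
    Ideal.span {x * y - z, x ^ 2 + y ^ 2 - w} * sqIdeal x y z w ^ 2 := by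
  rw [pow_succ, Ideal.mul_le]
  intro t ht j hj
  obtain ⟨t₁, ht₁, t₂, ht₂, rfl⟩ := Submodule.mem_sup.1 (h.sq_le_sup' ht)
  obtain ⟨c, rfl⟩ := Ideal.mem_span_singleton'.1 ht₂
  have h1 := Ideal.mul_mem_mul ht₁ hj
  rw [mul_assoc, ← pow_two] at h1
  convert add_mem h1 (Ideal.mul_mem_left _ c (h.xy_sq_mul_mem hj)) using 1
  ring

/-- The element `x²y²` spans `J²` modulo `(xy - z, x² + y² - w) J` over `k`. -/
theorem exists_sub_smul_mem' {k : Type*} [Field k] [Algebra k B]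
    (hdec : ∀ b : B, ∃ c₀ c₁ c₂ : k, ∃ j ∈ sqIdeal x y z w,
      b = algebraMap k B c₀ + c₁ • x + c₂ • y + j) {t : B} (ht : t ∈ sqIdeal x y z w ^ 2) :
    ∃ c : k, t - c • (x * y) ^ 2 ∈
      Ideal.span {x * y - z, x ^ 2 + y ^ 2 - w} * sqIdeal x y z w := by
  have hx := xx_mem_sqIdeal (x := x) (y := y) (z := z) (w := w)
  have hy := yy_mem_sqIdeal (x := x) (y := y) (z := z) (w := w)
  have h0 := (sqIdeal x y z w).zero_mem
  have hle : Ideal.span {x * y - z, x ^ 2 + y ^ 2 - w} * sqIdeal x y z w ^ 2 ≤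
      Ideal.span {x * y - z, x ^ 2 + y ^ 2 - w} * sqIdeal x y z w :=
    Ideal.mul_mono_right (Ideal.pow_le_self two_ne_zero)
  obtain ⟨t₁, ht₁, t₂, ht₂, rfl⟩ := Submodule.mem_sup.1 (h.sq_le_sup' ht)
  obtain ⟨c, rfl⟩ := Ideal.mem_span_singleton'.1 ht₂
  obtain ⟨c₀, c₁, c₂, j, hj, rfl⟩ := hdec c
  refine ⟨c₀, ?_⟩
  have e1 : x * (x * y) ^ 2 ∈ Ideal.span {x * y - z, x ^ 2 + y ^ 2 - w} * sqIdeal x y z w := by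
    convert mul_add_mul_mem_span_pair_mul (Ideal.mul_mem_left _ y hx) h0 using 1
    linear_combination y * h.xz
  have e2 : y * (x * y) ^ 2 ∈ Ideal.span {x * y - z, x ^ 2 + y ^ 2 - w} * sqIdeal x y z w := by
    convert mul_add_mul_mem_span_pair_mul (Ideal.mul_mem_left _ x hy) h0 using 1
    linear_combination x * h.yz
  convert add_mem ht₁ (add_mem (add_mem (smul_mem_ideal _ c₁ e1) (smul_mem_ideal _ c₂ e2))
    (hle (h.xy_sq_mul_mem hj))) using 1
  simp only [Algebra.smul_def]
  ring

/-- `(x² + y² - w) x²y² = (xy - z)² (x² + y²)`: the second generator kills the class of `x²y²` in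
the Sally module. -/
theorem mul_xy_sq_mem : (x ^ 2 + y ^ 2 - w) * (x * y) ^ 2 ∈
    Ideal.span {x * y - z, x ^ 2 + y ^ 2 - w} ^ 2 * sqIdeal x y z w := by
  have ha : x * y - z ∈ Ideal.span {x * y - z, x ^ 2 + y ^ 2 - w} := Ideal.subset_span (Or.inl rfl)
  convert Ideal.mul_mem_mul (Ideal.pow_mem_pow ha 2)
    (add_mem (xx_mem_sqIdeal (x := x) (y := y) (z := z) (w := w)) yy_mem_sqIdeal) using 1
  linear_combination (2 * x * y - z) * (h.xz + h.yz) - y ^ 2 * h.xw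

end Mixed

end Relations

end Relations

/-! ### The components of the Sally module -/

section SallyComponents

variable {A : Type u} [CommRing A] {m Q : Ideal A}

theorem pow_add_two_eq (hred : m ^ 3 = Q * m ^ 2) (n : ℕ) : m ^ (n + 2) = Q ^ n * m ^ 2 := by
  induction n with
  | zero => simp
  | succ n ih =>
    rw [show n + 1 + 2 = 1 + (n + 2) by ring, pow_add, ih, pow_one, mul_left_comm, ← pow_succ',
      hred, ← mul_assoc, ← pow_succ]

/-- Generators of `m ^ 2` modulo `Q m` propagate to generators of `m ^ (n + 2)` modulo `Q ^ (n + 1)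
m`, because `m ^ (n + 3) = Q m ^ (n + 2)`. -/
theorem pow_add_two_le_sup (hred : m ^ 3 = Q * m ^ 2) {L : ℕ → Ideal A}
    (h0 : m ^ 2 ≤ Q * m ⊔ L 0) (hL : ∀ n, Q * L n ≤ Q ^ (n + 2) * m ⊔ L (n + 1)) (n : ℕ) :
    m ^ (n + 2) ≤ Q ^ (n + 1) * m ⊔ L n := by
  induction n with
  | zero => simpa using h0
  | succ n ih =>
    have h1 : m ^ (n + 1 + 2) = Q * m ^ (n + 2) := by
      rw [pow_add_two_eq hred (n + 1), pow_add_two_eq hred n, pow_succ', mul_assoc]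
    rw [h1]
    refine (Ideal.mul_mono_right ih).trans ?_
    rw [Ideal.mul_sup, ← mul_assoc, ← pow_succ']
    exact sup_le le_sup_left (hL n)

/-- As `p` kills `z` and `w`, it does not distinguish `p - z, q - w` from `p, q`. -/
theorem pow_mul_pow_mul_eq {p q z w : A} (hpz : p * z = 0) (hpw : p * w = 0) (i j : ℕ) :
    (p - z) ^ i * (q - w) ^ j * p = p ^ i * q ^ j * p := by
  have h2 : ∀ j, (q - w) ^ j * p = q ^ j * p := by
    intro j
    induction j with
    | zero => simp
    | succ j ih =>
      rw [pow_succ', mul_assoc, ih, pow_succ']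
      linear_combination -q ^ j * hpw
  have h1 : ∀ i, (p - z) ^ i * p = p ^ i * p := by
    intro i
    induction i with
    | zero => simp
    | succ i ih =>
      rw [pow_succ', mul_assoc, ih, pow_succ']
      linear_combination -p ^ i * hpz
  rw [mul_assoc, h2, mul_left_comm, h1]
  ring

section Linear

variable {p q r z w : A} (hpz : p * z = 0) (hpw : p * w = 0) (hqz : q * z = 0) (hqw : q * w = 0)

include hpz hpw hqz hqw

theorem span_sub_mul_span_le :
    Ideal.span {p - z, q - w} * Ideal.span {p, q} ≤ Ideal.span {p, q} ^ 2 := by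
  have hp : p ∈ Ideal.span {p, q} := Ideal.subset_span (Or.inl rfl)
  have hq : q ∈ Ideal.span {p, q} := Ideal.subset_span (Or.inr rfl)
  rw [Ideal.span_pair_mul_span_pair, Ideal.span_le, pow_two]
  rintro s (rfl | rfl | rfl | rfl)
  · rw [show (p - z) * p = p * p by linear_combination -hpz]
    exact Ideal.mul_mem_mul hp hp
  · rw [show (p - z) * q = p * q by linear_combination -hqz]
    exact Ideal.mul_mem_mul hp hq
  · rw [show (q - w) * p = q * p by linear_combination -hpw]
    exact Ideal.mul_mem_mul hq hp
  · rw [show (q - w) * q = q * q by linear_combination -hqw]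
    exact Ideal.mul_mem_mul hq hq

variable (hred : m ^ 3 = Ideal.span {p - z, q - w} * m ^ 2)
  (hsq : m ^ 2 ≤ Ideal.span {p - z, q - w} * m ⊔ Ideal.span {r} * Ideal.span {p, q})

include hred hsq

/-- The components of the Sally module of `m` with respect to `(p - z, q - w)` are generated by the
products of `r` and a monomial in `p` and `q`. -/
theorem pow_le_sup_span (n : ℕ) : m ^ (n + 2) ≤
    Ideal.span {p - z, q - w} ^ (n + 1) * m ⊔ Ideal.span {r} * Ideal.span {p, q} ^ (n + 1) := by
  refine pow_add_two_le_sup hred (L := fun n => Ideal.span {r} * Ideal.span {p, q} ^ (n + 1))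
    (by simpa using hsq) (fun n => le_trans ?_ le_sup_right) n
  rw [mul_left_comm, pow_succ' _ n, ← mul_assoc (Ideal.span {p - z, q - w})]
  refine Ideal.mul_mono_right ((Ideal.mul_mono_left
    (span_sub_mul_span_le hpz hpw hqz hqw)).trans ?_)
  rw [← pow_add, add_comm 2 n]

variable (hr : Ideal.span {r} * Ideal.span {p, q} * m ≤ Ideal.span {p - z, q - w} * m ^ 2)
  (hrm : r ∈ m) (hpm : p ∈ m) (hqm : q ∈ m) (hzm : z ∈ m) (hwm : w ∈ m)

include hr hrm hpm hqm hzm hwm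

omit hpz hpw hqz hqw hsq hrm hzm hwm in
theorem span_mul_pow_mul_le (n : ℕ) : Ideal.span {r} * Ideal.span {p, q} ^ (n + 1) * m ≤
    Ideal.span {p - z, q - w} ^ (n + 1) * m := by
  have hpq : Ideal.span {p, q} ≤ m := by
    rw [Ideal.span_le, Set.pair_subset_iff]; exact ⟨hpm, hqm⟩
  calc Ideal.span {r} * Ideal.span {p, q} ^ (n + 1) * m
      = Ideal.span {p, q} ^ n * (Ideal.span {r} * Ideal.span {p, q} * m) := by rw [pow_succ]; ring
    _ ≤ m ^ n * (Ideal.span {p - z, q - w} * m ^ 2) :=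
        Ideal.mul_mono (Ideal.pow_right_mono hpq n) hr
    _ = Ideal.span {p - z, q - w} * m ^ (n + 2) := by rw [pow_add]; ring
    _ = Ideal.span {p - z, q - w} ^ (n + 1) * m * m := by rw [pow_add_two_eq hred]; ring
    _ ≤ Ideal.span {p - z, q - w} ^ (n + 1) * m := fun x hx => (Ideal.mul_le_inf hx).1

variable {k : Type*} [Field k] [Algebra k A] [m.IsMaximal]
  (hm : ∀ x : A, ∃ c : k, x - algebraMap k A c ∈ m)
  (hlin : ∀ (n : ℕ) (c : Fin (n + 2) → k),
    r * formEval p q (n + 1) c ∈ Ideal.span {p - z, q - w} ^ (n + 1) * m → c = 0)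

include hm hlin

/-- The component `m ^ (n + 2) / Q ^ (n + 1) m` of the Sally module has as a basis the `n + 2`
products of `r` and a monomial of degree `n + 1` in `p` and `q`; their independence is the
hypothesis `hlin`. -/
theorem length_quotient_eq_add_of_linear (n : ℕ) :
    Module.length A (A ⧸ (Ideal.span {p - z, q - w} ^ (n + 1) * m)) =
      Module.length A (A ⧸ m ^ (n + 2)) + ((n + 2 : ℕ) : ℕ∞) := by
  have hQm : Ideal.span {p - z, q - w} ≤ m := by
    rw [Ideal.span_le, Set.pair_subset_iff]
    exact ⟨sub_mem hpm hzm, sub_mem hqm hwm⟩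
  have hpq : Ideal.span {p, q} ≤ m := by
    rw [Ideal.span_le, Set.pair_subset_iff]; exact ⟨hpm, hqm⟩
  have hle : Ideal.span {p - z, q - w} ^ (n + 1) * m ≤ m ^ (n + 2) := by
    rw [pow_succ m (n + 1)]
    exact Ideal.mul_mono_left (Ideal.pow_right_mono hQm _)
  have hmul : m * m ^ (n + 2) ≤ Ideal.span {p - z, q - w} ^ (n + 1) * m := by
    rw [← pow_succ', show n + 2 + 1 = (n + 1) + 2 by ring, pow_add_two_eq hred]
    exact Ideal.mul_mono_right (Ideal.pow_le_self two_ne_zero)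
  have hsum : ∀ c : Fin (n + 2) → k,
      ∑ i : Fin (n + 2), c i • (r * (p ^ (i : ℕ) * q ^ (n + 1 - i))) =
        r * formEval p q (n + 1) c := by
    intro c
    rw [formEval, Finset.mul_sum]
    exact Finset.sum_congr rfl fun i _ => by rw [mul_smul_comm]
  rw [length_quotient_eq_add_card (k := k) m hm hle hmul
    (fun i : Fin (n + 2) => r * (p ^ (i : ℕ) * q ^ (n + 1 - i))) (fun i => ?_) (fun x hx => ?_)
    (fun c hc => hlin n c (by rwa [hsum] at hc)), Fintype.card_fin]
  · rw [pow_succ' m (n + 1)]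
    exact Ideal.mul_mem_mul hrm (Ideal.pow_right_mono hpq _ (pow_mul_pow_mem (n + 1) i))
  · obtain ⟨x₁, hx₁, x₂, hx₂, rfl⟩ := Submodule.mem_sup.1
      (pow_le_sup_span hpz hpw hqz hqw hred hsq n hx)
    obtain ⟨t, ht, rfl⟩ := Ideal.mem_span_singleton_mul.1 hx₂
    obtain ⟨c, hc⟩ := exists_sub_formEval_mem hm ht
    refine ⟨c, ?_⟩
    have h1 : r * (t - formEval p q (n + 1) c) ∈ Ideal.span {p - z, q - w} ^ (n + 1) * m := by
      refine span_mul_pow_mul_le hred hr hpm hqm n ?_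
      rw [mul_assoc]
      exact Ideal.mul_mem_mul (Ideal.mem_span_singleton_self r) hc
    rw [hsum, add_sub_assoc, ← mul_sub]
    exact add_mem hx₁ h1

omit [m.IsMaximal] in
/-- Multiplication by `(p - z) t` maps `r p ^ i q ^ j t ^ n` to `(p - z) ^ i (q - w) ^ j t ^ n`
times `r p t`, so that locally at `m R(Q)` the Sally module is generated by `r p t`, whose
annihilator is `m R(Q)` by `hlin`. -/
theorem hasLocalSallyLength_one_of_linear
    (hind : AnalyticallyIndependent k m (p - z) (q - w)) :
    HasLocalSallyLength (Ideal.span {p - z, q - w}) m 1 := by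
  have hQm : Ideal.span {p - z, q - w} ≤ m := by
    rw [Ideal.span_le, Set.pair_subset_iff]
    exact ⟨sub_mem hpm hzm, sub_mem hqm hwm⟩
  have ha : p - z ∈ Ideal.span {p - z, q - w} := Ideal.subset_span (Or.inl rfl)
  have hrp : r * p ∈ Ideal.span {r} * Ideal.span {p, q} :=
    Ideal.mul_mem_mul (Ideal.mem_span_singleton_self r) (Ideal.subset_span (Or.inl rfl))
  have hkill : ∀ x ∈ m, x * (r * p) ∈ Ideal.span {p - z, q - w} * m := by
    intro x hx
    have := hr (Ideal.mul_mem_mul hrp hx)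
    rw [mul_comm x]
    exact Ideal.mul_mono_right (Ideal.pow_le_self two_ne_zero) this
  refine hasLocalSallyLength_one (hind.isPrime_extendedIdeal hm) hQm ha (fun h => ?_)
    (u := r * p) (by rw [pow_two]; exact Ideal.mul_mem_mul hrm hpm) hkill
    (fun n x hx => ?_) (fun n s hs hsu => ?_)
  · exact one_ne_zero (hind.coeff_eq_zero (α := 1) (β := 0) (by simpa using h)).1
  · cases n with
    | zero => exact ⟨0, zero_mem _, by simpa using Ideal.mul_mem_mul ha (by simpa using hx)⟩
    | succ n =>
      obtain ⟨x₁, hx₁, x₂, hx₂, rfl⟩ := Submodule.mem_sup.1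
        (pow_le_sup_span hpz hpw hqz hqw hred hsq n hx)
      obtain ⟨t, ht, rfl⟩ := Ideal.mem_span_singleton_mul.1 hx₂
      -- `p * t = p * g`, where `g` is obtained from `t` by replacing `p, q` with `p - z, q - w`
      rw [span_pair_pow, Ideal.mem_span_range_iff_exists_fun] at ht
      obtain ⟨f, rfl⟩ := ht
      refine ⟨∑ i : Fin (n + 2), f i * ((p - z) ^ (i : ℕ) * (q - w) ^ (n + 1 - i)),
        Ideal.sum_mem _ fun i _ => Ideal.mul_mem_left _ _ (pow_mul_pow_mem (n + 1) i), ?_⟩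
      have h1 : (∑ i : Fin (n + 2), f i * ((p - z) ^ (i : ℕ) * (q - w) ^ (n + 1 - i))) * p =
          (∑ i : Fin (n + 2), f i * (p ^ (i : ℕ) * q ^ (n + 1 - i))) * p := by
        rw [Finset.sum_mul, Finset.sum_mul]
        exact Finset.sum_congr rfl fun i _ => by
          linear_combination f i * pow_mul_pow_mul_eq (q := q) hpz hpw (i : ℕ) (n + 1 - i)
      have h2 : (∑ i : Fin (n + 2), f i * (p ^ (i : ℕ) * q ^ (n + 1 - i))) * z = 0 := by
        obtain ⟨c, d, hcd⟩ := Ideal.mem_span_pair.1 (Ideal.pow_le_self n.succ_ne_zero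
          (Ideal.sum_mem (Ideal.span {p, q} ^ (n + 1)) fun i (_ : i ∈ Finset.univ) =>
            Ideal.mul_mem_left _ (f i) (pow_mul_pow_mem (n + 1) i)))
        rw [← hcd]
        linear_combination c * hpz + d * hqz
      have h3 := Ideal.mul_mem_mul ha hx₁
      rw [← mul_assoc, ← pow_succ'] at h3
      convert h3 using 1
      linear_combination -r * h1 - r * h2
  · obtain ⟨c, hc⟩ := exists_sub_formEval_mem hm hs
    have h1 : (s - formEval (p - z) (q - w) n c) * (r * p) ∈
        Ideal.span {p - z, q - w} ^ (n + 1) * m := by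
      have : ∀ y ∈ Ideal.span {p - z, q - w} ^ n * m,
          y * (r * p) ∈ Ideal.span {p - z, q - w} ^ (n + 1) * m := by
        intro y hy
        induction hy using Submodule.mul_induction_on' with
        | mem_mul_mem g hg x hx =>
          rw [mul_assoc, pow_succ, mul_assoc]
          exact Ideal.mul_mem_mul hg (hkill x hx)
        | add y _ y' _ h h' => rw [add_mul]; exact add_mem h h'
      exact this _ hc
    have h2 : formEval (p - z) (q - w) n c * (r * p) ∈
        Ideal.span {p - z, q - w} ^ (n + 1) * m := by
      have := sub_mem hsu h1
      rwa [sub_mul, sub_sub_cancel] at this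
    have h3 : formEval (p - z) (q - w) n c * (r * p) =
        r * formEval p q (n + 1) (Fin.cons 0 c : Fin (n + 2) → k) := by
      have hcons : formEval p q (n + 1) (Fin.cons 0 c : Fin (n + 2) → k) =
          ∑ i : Fin (n + 1), c i • (p ^ ((i : ℕ) + 1) * q ^ (n - i)) := by
        rw [formEval, Fin.sum_univ_succ, Fin.cons_zero, zero_smul, zero_add]
        exact Finset.sum_congr rfl fun i _ => by
          rw [Fin.cons_succ, Fin.val_succ, Nat.add_sub_add_right]
      rw [hcons, formEval, Finset.sum_mul, Finset.mul_sum]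
      refine Finset.sum_congr rfl fun i _ => ?_
      rw [smul_mul_assoc, mul_smul_comm]
      congr 1
      have := pow_mul_pow_mul_eq (q := q) hpz hpw i (n - i)
      rw [pow_succ]
      linear_combination r * this
    rw [h3] at h2
    have h4 := hlin n _ h2
    have h5 : c = 0 := by
      funext i
      have := congrFun h4 i.succ
      rwa [Fin.cons_succ] at this
    simpa [h5, formEval] using hc

end Linear

section Square

variable {a b t : A} (hred : m ^ 3 = Ideal.span {a, b} * m ^ 2)
  (hsq : m ^ 2 ≤ Ideal.span {a, b} * m ⊔ Ideal.span {t})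
  (ht : ∀ x ∈ m, t * x ∈ Ideal.span {a, b} * m)
  (hbt : b * t ∈ Ideal.span {a, b} ^ 2 * m)

include hred hsq hbt

/-- The components of the Sally module are generated by `a ^ n * t`, since `b * t` vanishes in
it. -/
theorem pow_le_sup_span_singleton (n : ℕ) :
    m ^ (n + 2) ≤ Ideal.span {a, b} ^ (n + 1) * m ⊔ Ideal.span {a ^ n * t} := by
  refine pow_add_two_le_sup hred (L := fun n => Ideal.span {a ^ n * t}) (by simpa using hsq)
    (fun n => ?_) n
  have ha : a ∈ Ideal.span {a, b} := Ideal.subset_span (Or.inl rfl)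
  rw [mul_comm, Ideal.span_singleton_mul_le_iff]
  intro s hs
  obtain ⟨c, d, rfl⟩ := Ideal.mem_span_pair.1 hs
  have h1 : a ^ n * (b * t) ∈ Ideal.span {a, b} ^ (n + 2) * m := by
    rw [pow_add, mul_assoc]
    exact Ideal.mul_mem_mul (Ideal.pow_mem_pow ha n) hbt
  have h2 : d * (a ^ n * (b * t)) + c * (a ^ (n + 1) * t) ∈
      Ideal.span {a, b} ^ (n + 2) * m ⊔ Ideal.span {a ^ (n + 1) * t} :=
    Submodule.add_mem_sup (Ideal.mul_mem_left _ _ h1)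
      (Ideal.mul_mem_left _ _ (Ideal.mem_span_singleton_self _))
  convert h2 using 1
  ring

/-- Since `b` kills the classes of `a ^ n * t`, which generate the components of the Sally module,
the localization vanishes. -/
theorem hasLocalSallyLength_zero_of_square {k : Type*} [Field k] [Algebra k A]
    (hm : ∀ x : A, ∃ c : k, x - algebraMap k A c ∈ m) (ham : a ∈ m) (hbm : b ∈ m)
    (hind : AnalyticallyIndependent k m a b) : HasLocalSallyLength (Ideal.span {a, b}) m 0 := by
  have hQm : Ideal.span {a, b} ≤ m := by
    rw [Ideal.span_le, Set.pair_subset_iff]; exact ⟨ham, hbm⟩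
  have ha : a ∈ Ideal.span {a, b} := Ideal.subset_span (Or.inl rfl)
  have hb : b ∈ Ideal.span {a, b} := Ideal.subset_span (Or.inr rfl)
  refine hasLocalSallyLength_zero (hind.isPrime_extendedIdeal hm) hQm hb (fun h => ?_)
    fun n x hx => ?_
  · exact one_ne_zero (hind.coeff_eq_zero (α := 0) (β := 1) (by simpa using h)).2
  · cases n with
    | zero => simpa using Ideal.mul_mem_mul hb (by simpa using hx)
    | succ n =>
      obtain ⟨x₁, hx₁, x₂, hx₂, rfl⟩ := Submodule.mem_sup.1
        (pow_le_sup_span_singleton hred hsq hbt n hx)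
      obtain ⟨c, rfl⟩ := Ideal.mem_span_singleton'.1 hx₂
      have h1 := Ideal.mul_mem_mul hb hx₁
      rw [← mul_assoc, ← pow_succ'] at h1
      have h2 := Ideal.mul_mem_mul (Ideal.pow_mem_pow ha n) hbt
      rw [← mul_assoc, ← pow_add] at h2
      convert add_mem h1 (Ideal.mul_mem_left _ c h2) using 1
      ring

include ht

/-- Each component of the Sally module has length at most one, and it vanishes if the preceding one
does, so that the lengths are eventually constant. -/
theorem exists_eventually_length_quotient_eq_add {k : Type*} [Field k] [Algebra k A] [m.IsMaximal]
    (hm : ∀ x : A, ∃ c : k, x - algebraMap k A c ∈ m) (ham : a ∈ m) (hbm : b ∈ m)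
    (htm : t ∈ m ^ 2) : ∃ s₀ : ℕ, ∀ᶠ n in atTop,
      Module.length A (A ⧸ (Ideal.span {a, b} ^ n * m)) =
        Module.length A (A ⧸ m ^ (n + 1)) + (s₀ : ℕ∞) := by
  have hQm : Ideal.span {a, b} ≤ m := by
    rw [Ideal.span_le, Set.pair_subset_iff]; exact ⟨ham, hbm⟩
  have ha : a ∈ Ideal.span {a, b} := Ideal.subset_span (Or.inl rfl)
  have hle : ∀ n, Ideal.span {a, b} ^ (n + 1) * m ≤ m ^ (n + 2) := fun n => by
    rw [pow_succ m (n + 1)]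
    exact Ideal.mul_mono_left (Ideal.pow_right_mono hQm _)
  have hmul : ∀ n, m * m ^ (n + 2) ≤ Ideal.span {a, b} ^ (n + 1) * m := fun n => by
    rw [← pow_succ', show n + 2 + 1 = (n + 1) + 2 by ring, pow_add_two_eq hred]
    exact Ideal.mul_mono_right (Ideal.pow_le_self two_ne_zero)
  have htx : ∀ n, ∀ x ∈ m, a ^ n * t * x ∈ Ideal.span {a, b} ^ (n + 1) * m := fun n x hx => by
    rw [mul_assoc, pow_succ, mul_assoc]
    exact Ideal.mul_mem_mul (Ideal.pow_mem_pow ha n) (ht x hx)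
  -- once `a ^ n₀ * t` vanishes in its component, all later components are zero
  by_cases hex : ∃ n₀, a ^ n₀ * t ∈ Ideal.span {a, b} ^ (n₀ + 1) * m
  · obtain ⟨n₀, hn₀⟩ := hex
    refine ⟨0, ?_⟩
    filter_upwards [eventually_ge_atTop (n₀ + 1)] with n hn
    obtain ⟨j, rfl⟩ := Nat.exists_eq_add_of_le hn
    have h1 : a ^ (n₀ + j) * t ∈ Ideal.span {a, b} ^ (n₀ + j + 1) * m := by
      have := Ideal.mul_mem_mul (Ideal.pow_mem_pow ha j) hn₀
      rw [← mul_assoc, ← mul_assoc, ← pow_add, ← pow_add] at this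
      rwa [show n₀ + j + 1 = j + (n₀ + 1) by ring, add_comm n₀ j]
    have h2 : Ideal.span {a, b} ^ (n₀ + j + 1) * m = m ^ (n₀ + j + 2) := by
      refine le_antisymm (hle _) ((pow_le_sup_span_singleton hred hsq hbt _).trans ?_)
      exact sup_le le_rfl (by rwa [Ideal.span_singleton_le_iff_mem])
    rw [show n₀ + 1 + j = n₀ + j + 1 by ring, h2, Nat.cast_zero, add_zero]
  · push Not at hex
    refine ⟨1, ?_⟩
    filter_upwards [eventually_ge_atTop 1] with n hn
    obtain ⟨n, rfl⟩ := Nat.exists_eq_add_of_le' hn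
    rw [length_quotient_eq_add_card (k := k) m hm (hle n) (hmul n) (fun _ : Unit => a ^ n * t)
      (fun _ => ?_) (fun x hx => ?_) (fun c hc => ?_), Fintype.card_unit]
    · rw [pow_add]
      exact Ideal.mul_mem_mul (Ideal.pow_mem_pow ham n) htm
    · obtain ⟨x₁, hx₁, x₂, hx₂, rfl⟩ := Submodule.mem_sup.1
        (pow_le_sup_span_singleton hred hsq hbt n hx)
      obtain ⟨c, rfl⟩ := Ideal.mem_span_singleton'.1 hx₂
      obtain ⟨γ, hγ⟩ := hm c
      refine ⟨fun _ => γ, ?_⟩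
      convert add_mem hx₁ (htx n _ hγ) using 1
      simp only [Finset.univ_unique, Finset.sum_singleton, Algebra.smul_def]
      ring
    · funext i
      by_contra hne
      refine hex n ?_
      have h1 : c i • (a ^ n * t) ∈ Ideal.span {a, b} ^ (n + 1) * m := by simpa using hc
      have h2 := smul_mem_ideal _ (c i)⁻¹ h1
      rwa [smul_smul, inv_mul_cancel₀ hne, one_smul] at h2

end Square

end SallyComponents

/-! ### Monomials and coefficients in `B` -/

section Monomials

variable (k : Type u) [Field k]

/-- The ideal defining `B` contains the products of `X², Y²` with `Z, W`. -/
theorem relations : Relations (v k 0) (v k 1) (v k 2) (v k 3) := by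
  have h : ∀ i j : Fin 4, (i = 0 ∨ i = 1) → (j = 2 ∨ j = 3) → v k i ^ 2 * v k j = 0 := by
    intro i j hi hj
    rw [v, v, ← map_pow, ← map_mul, Ideal.Quotient.eq_zero_iff_mem, idealK, Ideal.mem_inf]
    refine ⟨Ideal.mul_mem_right _ _ (Ideal.subset_span ?_),
      Ideal.mul_mem_left _ _ (Ideal.subset_span ?_)⟩
    · rcases hi with rfl | rfl <;> simp
    · rcases hj with rfl | rfl <;> simp
  exact ⟨h 0 2 (by simp) (by simp), h 0 3 (by simp) (by simp), h 1 2 (by simp) (by simp),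
    h 1 3 (by simp) (by simp)⟩

theorem J_eq_sqIdeal : J k = sqIdeal (v k 0) (v k 1) (v k 2) (v k 3) := rfl

open Classical in
/-- Multiplication by a monomial shifts the coefficients, which are then restricted to the standard
exponents. -/
theorem cf_mon_mul (e : Fin 4 →₀ ℕ) (a b c d : ℕ) (t : B k) : cf k e (mon k a b c d * t) =
    if IsStandard e ∧ expo a b c d ≤ e then cf k (e - expo a b c d) t else 0 := by
  obtain ⟨f, rfl⟩ := mk_surjective k t
  rw [mon_eq_mk, ← map_mul, cf_mk, MvPowerSeries.coeff_monomial_mul, one_mul, cf_mk]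
  have h : IsStandard e → IsStandard (e - expo a b c d) := by
    simp only [IsStandard, Finsupp.tsub_apply]; omega
  split_ifs <;> tauto

theorem expo_le_expo_iff {a b c d a' b' c' d' : ℕ} :
    expo a b c d ≤ expo a' b' c' d' ↔ a ≤ a' ∧ b ≤ b' ∧ c ≤ c' ∧ d ≤ d' :=
  ⟨fun h => ⟨h 0, h 1, h 2, h 3⟩, fun h => expo_le h.1 h.2.1 h.2.2.1 h.2.2.2⟩

theorem expo_sub_expo (a b c d a' b' c' d' : ℕ) :
    expo a b c d - expo a' b' c' d' = expo (a - a') (b - b') (c - c') (d - d') := by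
  apply expo_ext <;> simp [Finsupp.tsub_apply]

theorem cf_one : cf k (expo 0 0 0 0) 1 = 1 := by
  have := cf_mon k (expo 0 0 0 0) 0 0 0 0
  simpa [mon, IsStandard] using this

theorem J_ne_top : J k ≠ ⊤ := by
  intro h
  have h1 : (1 : B k) ∈ J k ^ 1 := by rw [pow_one, h]; trivial
  have h2 := (mem_J_pow_iff k 1 1).1 h1 (expo 0 0 0 0) (by simp [wt])
  rw [cf_one] at h2
  exact one_ne_zero h2

/-- `B = k + k x + k y + J`. -/
theorem exists_eq_add_mem_J (b : B k) : ∃ c₀ c₁ c₂ : k, ∃ j ∈ J k,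
    b = algebraMap k (B k) c₀ + c₁ • v k 0 + c₂ • v k 1 + j := by
  refine ⟨cf k (expo 0 0 0 0) b, cf k (expo 1 0 0 0) b, cf k (expo 0 1 0 0) b, _, ?_,
    (add_sub_cancel _ _).symm⟩
  have h0 : algebraMap k (B k) (cf k (expo 0 0 0 0) b) =
      cf k (expo 0 0 0 0) b • mon k 0 0 0 0 := by simp [mon, Algebra.algebraMap_eq_smul_one]
  have h1 : v k 0 = mon k 1 0 0 0 := by simp [mon]
  have h2 : v k 1 = mon k 0 1 0 0 := by simp [mon]
  rw [← pow_one (J k), mem_J_pow_iff, h0, h1, h2]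
  intro e he
  have h : e = expo 0 0 0 0 ∨ e = expo 1 0 0 0 ∨ e = expo 0 1 0 0 := by
    unfold wt at he
    by_cases h0 : e 0 = 1
    · exact Or.inr (Or.inl (expo_ext h0 (by simp; omega) (by simp; omega) (by simp; omega)))
    by_cases h1 : e 1 = 1
    · exact Or.inr (Or.inr (expo_ext (by simp; omega) h1 (by simp; omega) (by simp; omega)))
    · exact Or.inl (expo_ext (by simp; omega) (by simp; omega) (by simp; omega) (by simp; omega))
  rcases h with rfl | rfl | rfl <;>
    simp [cf_mon, expo_eq_iff, IsStandard]

theorem finite_quotient_J : Module.Finite k (B k ⧸ J k) := by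
  classical
  refine ⟨⟨{1, Ideal.Quotient.mk _ (v k 0), Ideal.Quotient.mk _ (v k 1)}, ?_⟩⟩
  rw [eq_top_iff]
  rintro q -
  obtain ⟨b, rfl⟩ := Ideal.Quotient.mk_surjective q
  obtain ⟨c₀, c₁, c₂, j, hj, h⟩ := exists_eq_add_mem_J k b
  have hq : Ideal.Quotient.mk (J k) b = c₀ • (1 : B k ⧸ J k) + c₁ • Ideal.Quotient.mk _ (v k 0) +
      c₂ • Ideal.Quotient.mk _ (v k 1) := by
    rw [h, map_add, Ideal.Quotient.eq_zero_iff_mem.2 hj, add_zero, Algebra.algebraMap_eq_smul_one]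
    rfl
  rw [hq]
  refine add_mem (add_mem ?_ ?_) ?_ <;>
    exact Submodule.smul_mem _ _ (Submodule.subset_span (by simp))

theorem isLocalRing_quotient_idealK : IsLocalRing (B k) :=
  have : Nontrivial (B k) := ⟨⟨0, 1, fun h => J_ne_top k
    ((Ideal.eq_top_iff_one _).2 (h ▸ zero_mem _))⟩⟩
  IsLocalRing.of_surjective' _ (mk_surjective k)

end Monomials

/-! ### Independence of forms in `B` -/

section Independence

variable (k : Type u) [Field k]

theorem neg_pow_mul_neg_pow {R : Type*} [CommRing R] (z w : R) {i n : ℕ} (h : i ≤ n) :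
    (-z) ^ i * (-w) ^ (n - i) = (-1) ^ n * (z ^ i * w ^ (n - i)) := by
  have : (-1 : R) ^ n = (-1) ^ i * (-1) ^ (n - i) := by rw [← pow_add, Nat.add_sub_cancel' h]
  rw [neg_pow z, neg_pow w, this]; ring

/-- Powers of two differences `p - z` and `q - w`, when all mixed products vanish. -/
theorem sub_pow_mul_sub_pow {R : Type*} [CommRing R] {p q z w : R} (hpz : p * z = 0)
    (hpw : p * w = 0) (hqz : q * z = 0) (hqw : q * w = 0) {n j : ℕ} (hj : j ≤ n + 1) :
    (p - z) ^ j * (q - w) ^ (n + 1 - j) =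
      p ^ j * q ^ (n + 1 - j) + (-1) ^ (n + 1) * (z ^ j * w ^ (n + 1 - j)) := by
  have hsub : ∀ {p z : R}, p * z = 0 → ∀ i, (p - z) ^ (i + 1) = p ^ (i + 1) + (-z) ^ (i + 1) := by
    intro p z hpz i
    induction i with
    | zero => ring
    | succ i ih =>
      rw [pow_succ, ih]
      linear_combination (-p ^ i - (-z) ^ i) * hpz
  rw [← neg_pow_mul_neg_pow z w hj]
  obtain rfl | ⟨i, rfl⟩ : j = 0 ∨ ∃ i, j = i + 1 := by
    cases j with
    | zero => exact Or.inl rfl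
    | succ i => exact Or.inr ⟨i, rfl⟩
  · simpa using hsub hqw n
  · obtain rfl | ⟨l, hl⟩ : i = n ∨ ∃ l, n + 1 - (i + 1) = l + 1 := by
      rcases Nat.eq_or_lt_of_le hj with h | h
      · exact Or.inl (by omega)
      · exact Or.inr ⟨n - i - 1, by omega⟩
    · simpa using hsub hpz i
    · rw [hl, hsub hpz, hsub hqw]
      linear_combination -p ^ i * (-w) ^ l * hpw - q ^ l * (-z) ^ i * hqz

theorem neg_one_pow_mul_eq_smul {R : Type*} [CommRing R] [Algebra k R] (n : ℕ) (t : R) :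
    (-1) ^ n * t = ((-1 : k) ^ n) • t := by
  rw [Algebra.smul_def, map_pow, map_neg, map_one]

/-- The coefficients at monomials in `z` and `w` vanish on the ideal `(x, y)`. -/
theorem cf_eq_zero_of_mem_span {c d : ℕ} {t : B k} (ht : t ∈ Ideal.span {v k 0, v k 1}) :
    cf k (expo 0 0 c d) t = 0 := by
  obtain ⟨f, g, rfl⟩ := Ideal.mem_span_pair.1 ht
  have h0 : v k 0 = mon k 1 0 0 0 := by simp [mon]
  have h1 : v k 1 = mon k 0 1 0 0 := by simp [mon]
  rw [map_add, mul_comm f, mul_comm g, h0, h1, cf_mon_mul, cf_mon_mul]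
  simp [expo_le_expo_iff]

/-- Modulo `(x, y)`, a form in `s - z` and `t - w` becomes a form in `-z` and `-w`, and its
coefficients can be read off from the monomials `z ^ i w ^ (n - i)`, which have weight `2 n`. -/
theorem eq_zero_of_formEval_mem {s t : B k} (hs : s ∈ Ideal.span {v k 0, v k 1})
    (ht : t ∈ Ideal.span {v k 0, v k 1}) (n : ℕ) (c : Fin (n + 1) → k)
    (h : formEval (s - v k 2) (t - v k 3) n c ∈ J k ^ (n + 1)) : c = 0 := by
  classical
  funext i
  have h1 := (mem_J_pow_iff k (n + 1) _).1 h (expo 0 0 i (n - i)) (by simp [wt]; omega)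
  have h2 : ∀ j : Fin (n + 1), cf k (expo 0 0 i (n - i))
      ((s - v k 2) ^ (j : ℕ) * (t - v k 3) ^ (n - j)) = if j = i then (-1) ^ n else 0 := by
    intro j
    have hj : (j : ℕ) ≤ n := by omega
    have h3 : (s - v k 2) ^ (j : ℕ) * (t - v k 3) ^ (n - j) -
        (-v k 2) ^ (j : ℕ) * (-v k 3) ^ (n - j) ∈ Ideal.span {v k 0, v k 1} := by
      rw [← Ideal.Quotient.eq]
      simp only [map_mul, map_pow, map_sub, map_neg, Ideal.Quotient.eq_zero_iff_mem.2 hs,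
        Ideal.Quotient.eq_zero_iff_mem.2 ht, zero_sub]
    have h4 := cf_eq_zero_of_mem_span k (c := i) (d := n - i) h3
    have h5 : v k 2 ^ (j : ℕ) * v k 3 ^ (n - j) = mon k 0 0 j (n - j) := by simp [mon]
    rw [map_sub, sub_eq_zero] at h4
    rw [h4, neg_pow_mul_neg_pow _ _ hj, neg_one_pow_mul_eq_smul k, map_smul, h5, cf_mon]
    have h6 : (IsStandard (expo 0 0 (i : ℕ) (n - i)) ∧
        expo 0 0 (i : ℕ) (n - i) = expo 0 0 j (n - j)) ↔ j = i := by
      rw [expo_eq_iff]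
      exact ⟨fun h => Fin.ext h.2.2.2.1.symm, by rintro rfl; simp [IsStandard]⟩
    simp only [h6]
    simp
  rw [formEval, map_sum] at h1
  simpa [h2] using h1

/-- A form in `p = x²` and `q = y²`, multiplied by `xy`, lies in `(p - z, q - w) ^ (n + 1)` only if
it vanishes. With `N = n + 1`, the functional `[x ^ (2 i + 1) y ^ (2 (N - i) + 1)] -
(-1) ^ N [x y z ^ i w ^ (N - i)]` vanishes on that ideal, since
`(p - z) ^ j (q - w) ^ (N - j) = p ^ j q ^ (N - j) + (-1) ^ N z ^ j w ^ (N - j)`. -/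
theorem eq_zero_of_mul_formEval_mem (n : ℕ) (c : Fin (n + 2) → k)
    (h : v k 0 * v k 1 * formEval (v k 0 ^ 2) (v k 1 ^ 2) (n + 1) c ∈
      Ideal.span {v k 0 ^ 2 - v k 2, v k 1 ^ 2 - v k 3} ^ (n + 1)) : c = 0 := by
  classical
  obtain ⟨hxz, hxw, hyz, hyw⟩ := relations k
  funext i
  let L : B k →ₗ[k] k := cf k (expo (2 * i + 1) (2 * (n + 1 - i) + 1) 0 0) -
    ((-1 : k) ^ (n + 1)) • cf k (expo 1 1 i (n + 1 - i))
  have hL : ∀ t, L t = cf k (expo (2 * i + 1) (2 * (n + 1 - i) + 1) 0 0) t -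
    (-1 : k) ^ (n + 1) * cf k (expo 1 1 i (n + 1 - i)) t := fun _ => rfl
  have hgen : ∀ j : ℕ, j ≤ n + 1 → (v k 0 ^ 2 - v k 2) ^ j * (v k 1 ^ 2 - v k 3) ^ (n + 1 - j) =
      mon k (2 * j) (2 * (n + 1 - j)) 0 0 + ((-1 : k) ^ (n + 1)) • mon k 0 0 j (n + 1 - j) := by
    intro j hj
    rw [sub_pow_mul_sub_pow hxz hxw hyz hyw hj]
    refine congrArg₂ (· + ·) ?_ ((neg_one_pow_mul_eq_smul k _ _).trans (congrArg _ ?_))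
    · simp only [mon]; ring
    · simp only [mon]; ring
  have hkill : ∀ t ∈ Ideal.span {v k 0 ^ 2 - v k 2, v k 1 ^ 2 - v k 3} ^ (n + 1), L t = 0 := by
    intro t ht
    rw [span_pair_pow, Ideal.mem_span_range_iff_exists_fun] at ht
    obtain ⟨f, rfl⟩ := ht
    rw [map_sum]
    refine Finset.sum_eq_zero fun j _ => ?_
    have hj : (j : ℕ) ≤ n + 1 := by omega
    have hi : (i : ℕ) ≤ n + 1 := by omega
    have hs1 : IsStandard (expo (2 * i + 1) (2 * (n + 1 - i) + 1) 0 0) := by simp [IsStandard]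
    have hs2 : IsStandard (expo 1 1 i (n + 1 - i)) := by simp [IsStandard]
    have h1 : ¬ expo 0 0 (j : ℕ) (n + 1 - j) ≤ expo (2 * i + 1) (2 * (n + 1 - i) + 1) 0 0 := by
      rw [expo_le_expo_iff]; omega
    have h2 : ¬ expo (2 * j) (2 * (n + 1 - j)) 0 0 ≤ expo 1 1 i (n + 1 - i) := by
      rw [expo_le_expo_iff]; omega
    rw [mul_comm, hgen j hj, add_mul, smul_mul_assoc, hL, map_add, map_add, map_smul, map_smul,
      cf_mon_mul, cf_mon_mul, cf_mon_mul, cf_mon_mul]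
    simp only [h1, h2, hs1, hs2, true_and, if_false, zero_add, smul_eq_mul]
    by_cases hij : (i : ℕ) = j
    · have h3 : (-1 : k) ^ (n + 1) * (-1 : k) ^ (n + 1) = 1 := by
        rw [← mul_pow]; simp
      have h4 : expo (2 * j) (2 * (n + 1 - j)) 0 0 ≤
          expo (2 * i + 1) (2 * (n + 1 - i) + 1) 0 0 := by rw [expo_le_expo_iff]; omega
      have h5 : expo 0 0 j (n + 1 - j) ≤ expo 1 1 i (n + 1 - i) := by
        rw [expo_le_expo_iff]; omega
      rw [if_pos h4, if_pos h5, expo_sub_expo, expo_sub_expo, hij]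
      simp only [Nat.sub_self, Nat.add_sub_cancel_left, Nat.sub_zero]
      linear_combination -(cf k (expo 1 1 0 0) (f j)) * h3
    · rw [if_neg, if_neg]
      · simp
      · rw [expo_le_expo_iff]; omega
      · rw [expo_le_expo_iff]; omega
  have hval : ∀ j : Fin (n + 2), L (v k 0 * v k 1 * ((v k 0 ^ 2) ^ (j : ℕ) *
      (v k 1 ^ 2) ^ (n + 1 - j))) = if j = i then 1 else 0 := by
    intro j
    have h1 : v k 0 * v k 1 * ((v k 0 ^ 2) ^ (j : ℕ) * (v k 1 ^ 2) ^ (n + 1 - j)) =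
        mon k (2 * j + 1) (2 * (n + 1 - j) + 1) 0 0 := by
      simp only [mon]; ring
    have h2 : (IsStandard (expo (2 * i + 1) (2 * (n + 1 - i) + 1) 0 0) ∧
        expo (2 * i + 1) (2 * (n + 1 - i) + 1) 0 0 =
        expo (2 * j + 1) (2 * (n + 1 - j) + 1) 0 0) ↔ j = i := by
      rw [expo_eq_iff]
      exact ⟨fun h => Fin.ext (by omega), by rintro rfl; simp [IsStandard]⟩
    have h3 : ¬ (IsStandard (expo 1 1 i (n + 1 - i)) ∧
        expo 1 1 i (n + 1 - i) = expo (2 * j + 1) (2 * (n + 1 - j) + 1) 0 0) := by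
      simp only [expo_eq_iff]; omega
    rw [h1, hL, cf_mon, cf_mon, if_neg h3, mul_zero, sub_zero]
    simp only [h2]
  have h1 := hkill _ h
  rw [formEval, Finset.mul_sum, map_sum] at h1
  simp only [mul_smul_comm, map_smul, hval] at h1
  simpa using h1

end Independence

/-! ### Homomorphisms from `B` to power series rings -/

section Evaluation

variable (k : Type u) [Field k] {τ : Type*} {s t : MvPowerSeries τ k}
  (hs : s.constantCoeff = 0) (ht : t.constantCoeff = 0)

include hs ht in
theorem hasSubst_zero_zero :
    MvPowerSeries.HasSubst (![0, 0, s, t] : Fin 4 → MvPowerSeries τ k) :=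
  MvPowerSeries.hasSubst_of_constantCoeff_zero fun i => by fin_cases i <;> simp [hs, ht]

/-- The evaluation of elements of `B` at `x = y = 0`, `z = s` and `w = t`, for power series `s` and
`t` without constant term. -/
def evalZW : B k →ₐ[k] MvPowerSeries τ k :=
  Ideal.Quotient.liftₐ (idealK k) (MvPowerSeries.substAlgHom (hasSubst_zero_zero k hs ht))
    fun f hf => by
      have h : (Ideal.span {MvPowerSeries.X 0 ^ 2, MvPowerSeries.X 1 ^ 2} :
          Ideal (MvPowerSeries (Fin 4) k)) ≤
          RingHom.ker (MvPowerSeries.substAlgHom (hasSubst_zero_zero k hs ht)) := by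
        rw [Ideal.span_le]
        rintro g (rfl | rfl) <;>
          rw [SetLike.mem_coe, RingHom.mem_ker, map_pow, MvPowerSeries.substAlgHom_X] <;> simp
      exact h hf.1

theorem evalZW_v (i : Fin 4) : evalZW k hs ht (v k i) = (![0, 0, s, t] : Fin 4 → _) i :=
  MvPowerSeries.substAlgHom_X (hasSubst_zero_zero k hs ht) i

theorem evalZW_mem {I : Ideal (MvPowerSeries τ k)} (hsI : s ∈ I) (htI : t ∈ I) {b : B k}
    (hb : b ∈ J k) : evalZW k hs ht b ∈ I := by
  have h : J k ≤ I.comap (evalZW k hs ht) := by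
    rw [J_eq_sqIdeal, sqIdeal_eq_span, Ideal.span_le]
    rintro g (rfl | rfl | rfl | rfl | rfl) <;>
      simp [evalZW_v, hsI, htI]
  exact h hb

end Evaluation

/-! ### Ideals shared by two rings -/

section SharedIdeal

variable {k A B : Type*} [Field k] [CommRing A] [CommRing B] [Algebra k A] [Algebra k B]

/-- The `k`-algebra `A` is embedded by `ι` as `k + J` into `B`, with `m` corresponding to the ideal
`J` of `B`. -/
structure IsFieldPlus (ι : A →ₐ[k] B) (m : Ideal A) (J : Ideal B) : Prop where
  injective : Function.Injective ι
  mem_iff : ∀ x, x ∈ m ↔ ι x ∈ J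
  exists_eq : ∀ b ∈ J, ∃ a, ι a = b
  exists_sub_mem : ∀ x : A, ∃ c : k, x - algebraMap k A c ∈ m

namespace IsFieldPlus

variable {ι : A →ₐ[k] B} {m : Ideal A} {J : Ideal B} (h : IsFieldPlus ι m J)

include h

/-- As `J` is an ideal of both rings, products with `J` can be computed in `B`. -/
theorem mem_mul_iff (I : Ideal A) (x : A) : x ∈ I * m ↔ ι x ∈ I.map ι * J := by
  constructor
  · intro hx
    have := Ideal.mem_map_of_mem ι hx
    rw [Ideal.map_mul] at this
    exact Ideal.mul_mono_right (Ideal.map_le_iff_le_comap.2 fun y hy => (h.mem_iff y).1 hy) this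
  · have key : ∀ b ∈ I.map ι * J, ∃ y ∈ I * m, ι y = b := by
      intro b hb
      induction hb using Submodule.mul_induction_on' with
      | mem_mul_mem i hi j hj =>
        rw [Ideal.map] at hi
        induction hi using Submodule.span_induction generalizing j with
        | mem i hi =>
          obtain ⟨i, hi, rfl⟩ := hi
          obtain ⟨j, rfl⟩ := h.exists_eq j hj
          exact ⟨i * j, Ideal.mul_mem_mul hi ((h.mem_iff j).2 hj), map_mul ι i j⟩
        | zero => exact ⟨0, zero_mem _, by simp⟩
        | add i i' _ _ h₁ h₂ =>
          obtain ⟨y, hy, hyi⟩ := h₁ j hj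
          obtain ⟨y', hy', hyi'⟩ := h₂ j hj
          exact ⟨y + y', add_mem hy hy', by rw [map_add, hyi, hyi', add_mul]⟩
        | smul b i _ h₁ =>
          obtain ⟨y, hy, hyi⟩ := h₁ (b * j) (Ideal.mul_mem_left _ _ hj)
          exact ⟨y, hy, by rw [hyi, smul_eq_mul]; ring⟩
      | add b _ b' _ h₁ h₂ =>
        obtain ⟨y, hy, rfl⟩ := h₁
        obtain ⟨y', hy', rfl⟩ := h₂
        exact ⟨y + y', add_mem hy hy', map_add ι y y'⟩
    intro hx
    obtain ⟨y, hy, hyx⟩ := key _ hx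
    rwa [← h.injective hyx]

theorem map_mul_eq (I : Ideal A) : (I * m).map ι = I.map ι * J := by
  apply le_antisymm
  · rw [Ideal.map_le_iff_le_comap]
    exact fun x hx => (h.mem_mul_iff I x).1 hx
  · intro b hb
    obtain ⟨a, rfl⟩ := h.exists_eq b (Ideal.mul_le_inf hb).2
    exact Ideal.mem_map_of_mem ι ((h.mem_mul_iff I a).2 hb)

theorem map_pow_eq (n : ℕ) : (m ^ n).map ι = J ^ n := by
  induction n with
  | zero => rw [pow_zero, pow_zero, Ideal.one_eq_top, Ideal.one_eq_top, Ideal.map_top]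
  | succ n ih => rw [pow_succ, h.map_mul_eq, ih, ← pow_succ]

theorem mem_pow_succ_iff (n : ℕ) (x : A) : x ∈ m ^ (n + 1) ↔ ι x ∈ J ^ (n + 1) := by
  rw [pow_succ, h.mem_mul_iff, h.map_pow_eq, ← pow_succ]

/-- The length of `m ^ (n + 1) / m ^ (n + 2)` is the dimension of the same vector space `J ^ (n + 1)
/ J ^ (n + 2)`, formed in `B`. -/
theorem length_quotient_pow [m.IsMaximal] (n : ℕ) {τ : Type*} [Fintype τ] (u : τ → B)
    (hu : ∀ i, u i ∈ J ^ (n + 1))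
    (hspan : ∀ x ∈ J ^ (n + 1), ∃ c : τ → k, x - ∑ i, c i • u i ∈ J ^ (n + 2))
    (hind : ∀ c : τ → k, ∑ i, c i • u i ∈ J ^ (n + 2) → c = 0) :
    Module.length A (A ⧸ m ^ (n + 2)) =
      Module.length A (A ⧸ m ^ (n + 1)) + (Fintype.card τ : ℕ∞) := by
  choose u' hu' using fun i => h.exists_eq (u i) (Ideal.pow_le_self n.succ_ne_zero (hu i))
  have hsum : ∀ c : τ → k, ι (∑ i, c i • u' i) = ∑ i, c i • u i := fun c => by
    simp only [map_sum, map_smul, hu']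
  refine length_quotient_eq_add_card (k := k) m h.exists_sub_mem
    (Ideal.pow_le_pow_right (by omega)) (by rw [← pow_succ']) u'
    (fun i => (h.mem_pow_succ_iff n _).2 (by rw [hu']; exact hu i)) (fun x hx => ?_) fun c hc => ?_
  · obtain ⟨c, hc⟩ := hspan (ι x) ((h.mem_pow_succ_iff n _).1 hx)
    refine ⟨c, (h.mem_pow_succ_iff (n + 1) _).2 ?_⟩
    rwa [map_sub, hsum]
  · refine hind c ?_
    rw [← hsum]
    exact (h.mem_pow_succ_iff (n + 1) _).1 hc

end IsFieldPlus

theorem isFieldPlus_fieldPlus (k : Type u) [Field k] {B : Type u} [CommRing B] [Algebra k B]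
    (J : Ideal B) : IsFieldPlus (fieldPlus k J).val (idealFieldPlus k J) J where
  injective := Subtype.val_injective
  mem_iff _ := Iff.rfl
  exists_eq b hb := ⟨⟨b, mem_fieldPlus_of_mem hb⟩, rfl⟩
  exists_sub_mem := exists_sub_algebraMap_mem

end SharedIdeal

/-! ### The Hilbert function of the maximal ideal -/

section HilbertFunction

/-- The standard exponents of weight `2 * n` and `2 * n + 1`; from left to right, those of the
monomials `x ^ i y ^ (2 n - i)`, `x ^ i y ^ (2 n + 1 - i)`, `z ^ i w ^ (n - i)`,
`x y z ^ i w ^ (n - 1 - i)`, `x z ^ i w ^ (n - i)` and `y z ^ i w ^ (n - i)`. -/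
def stdExpo (n : ℕ) : (Fin (2 * n + 1) ⊕ Fin (2 * n + 2)) ⊕ (Fin (n + 1) ⊕ Fin n) ⊕
    (Fin (n + 1) ⊕ Fin (n + 1)) → (Fin 4 →₀ ℕ) :=
  Sum.elim (Sum.elim (fun i => expo i (2 * n - i) 0 0) (fun i => expo i (2 * n + 1 - i) 0 0))
    (Sum.elim (Sum.elim (fun i => expo 0 0 i (n - i)) (fun i => expo 1 1 i (n - 1 - i)))
      (Sum.elim (fun i => expo 1 0 i (n - i)) (fun i => expo 0 1 i (n - i))))

theorem stdExpo_injective {n : ℕ} (hn : 2 ≤ n) : Function.Injective (stdExpo n) := by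
  rintro ((i | i) | (i | i) | (i | i)) ((j | j) | (j | j) | (j | j)) h <;>
    simp only [stdExpo, Sum.elim_inl, Sum.elim_inr, expo_eq_iff] at h <;>
    first
    | (exfalso; have hi := i.2; have hj := j.2; omega)
    | (have : i = j := Fin.ext (by omega)
       rw [this])

theorem isStandard_stdExpo {n : ℕ} (i) : IsStandard (stdExpo n i) := by
  rcases i with (i | i) | (i | i) | (i | i) <;> simp [stdExpo, IsStandard]

theorem wt_stdExpo {n : ℕ} (i) : 2 * n ≤ wt (stdExpo n i) := by
  rcases i with (i | i) | (i | i) | (i | i) <;> have hi := i.2 <;> simp [stdExpo, wt] <;> omega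

theorem exists_stdExpo_eq {n : ℕ} {e : Fin 4 →₀ ℕ} (he : IsStandard e)
    (h : wt e = 2 * n ∨ wt e = 2 * n + 1) : ∃ i, stdExpo n i = e := by
  unfold IsStandard at he
  unfold wt at h
  by_cases h23 : e 2 = 0 ∧ e 3 = 0
  · rcases h with h | h
    · exact ⟨Sum.inl (Sum.inl ⟨e 0, by omega⟩), expo_ext rfl (by simp [stdExpo]; omega)
        h23.1.symm h23.2.symm⟩
    · exact ⟨Sum.inl (Sum.inr ⟨e 0, by omega⟩), expo_ext rfl (by simp [stdExpo]; omega)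
        h23.1.symm h23.2.symm⟩
  · by_cases h0 : e 0 = 0 <;> by_cases h1 : e 1 = 0
    · exact ⟨Sum.inr (Sum.inl (Sum.inl ⟨e 2, by omega⟩)), expo_ext h0.symm h1.symm rfl
        (by simp [stdExpo]; omega)⟩
    · exact ⟨Sum.inr (Sum.inr (Sum.inr ⟨e 2, by omega⟩)), expo_ext h0.symm
        (by simp [stdExpo]; omega) rfl (by simp [stdExpo]; omega)⟩
    · exact ⟨Sum.inr (Sum.inr (Sum.inl ⟨e 2, by omega⟩)), expo_ext (by simp [stdExpo]; omega)
        h1.symm rfl (by simp [stdExpo]; omega)⟩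
    · exact ⟨Sum.inr (Sum.inl (Sum.inr ⟨e 2, by omega⟩)), expo_ext (by simp [stdExpo]; omega)
        (by simp [stdExpo]; omega) rfl (by simp [stdExpo]; omega)⟩

variable (k : Type u) [Field k]

/-- The Hilbert function of the maximal ideal of `A`. -/
theorem length_quotient_maximalIdeal_pow_succ {A : Type*} [CommRing A] [Algebra k A]
    {ι : A →ₐ[k] B k} {m : Ideal A} [m.IsMaximal] (h : IsFieldPlus ι m (J k)) {n : ℕ} (hn : 2 ≤ n) :
    Module.length A (A ⧸ m ^ (n + 1)) = Module.length A (A ⧸ m ^ n) + ((8 * n + 6 : ℕ) : ℕ∞) := by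
  classical
  obtain ⟨n, rfl⟩ := Nat.exists_eq_add_of_le' (show 1 ≤ n by omega)
  have hcard : 8 * (n + 1) + 6 = Fintype.card ((Fin (2 * (n + 1) + 1) ⊕ Fin (2 * (n + 1) + 2)) ⊕
      (Fin ((n + 1) + 1) ⊕ Fin (n + 1)) ⊕ (Fin ((n + 1) + 1) ⊕ Fin ((n + 1) + 1))) := by
    simp only [Fintype.card_sum, Fintype.card_fin]; ring
  rw [hcard]
  let u := fun i => mon k (stdExpo (n + 1) i 0) (stdExpo (n + 1) i 1) (stdExpo (n + 1) i 2)
    (stdExpo (n + 1) i 3)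
  have hcf : ∀ e i, cf k e (u i) = if e = stdExpo (n + 1) i then 1 else 0 := by
    intro e i
    have h1 : expo (stdExpo (n + 1) i 0) (stdExpo (n + 1) i 1) (stdExpo (n + 1) i 2)
        (stdExpo (n + 1) i 3) = stdExpo (n + 1) i := expo_ext rfl rfl rfl rfl
    have h2 : (IsStandard e ∧ e = stdExpo (n + 1) i) ↔ e = stdExpo (n + 1) i :=
      ⟨fun h => h.2, fun h => ⟨h ▸ isStandard_stdExpo i, h⟩⟩
    rw [cf_mon, h1]
    simp only [h2]
  have hu : ∀ i, u i ∈ J k ^ (n + 1) := by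
    intro i
    rw [mem_J_pow_iff]
    intro e he
    rw [hcf, if_neg]
    rintro rfl
    exact absurd (wt_stdExpo i) (by omega)
  have hsum : ∀ (c : _ → k) j, cf k (stdExpo (n + 1) j) (∑ i, c i • u i) = c j := by
    intro c j
    simp only [map_sum, map_smul, hcf, (stdExpo_injective hn).eq_iff]
    simp
  refine h.length_quotient_pow n u hu (fun x hx => ?_) fun c hc => ?_
  · refine ⟨fun i => cf k (stdExpo (n + 1) i) x, mem_J_pow_succ k (n + 1) (sub_mem hx
      (Ideal.sum_mem _ fun i _ => smul_mem_ideal _ _ (hu i))) fun e hs he => ?_⟩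
    obtain ⟨j, rfl⟩ := exists_stdExpo_eq hs he
    rw [map_sub, hsum, sub_self]
  · funext j
    have h1 : wt (stdExpo (n + 1) j) < 2 * (n + 2) := by
      rcases j with (i | i) | (i | i) | (i | i) <;> have hi := i.2 <;>
        simp [stdExpo, wt] <;> omega
    rw [← hsum c j]
    exact (mem_J_pow_iff k (n + 2) _).1 hc _ h1

end HilbertFunction

/-! ### Passage from `B` to `A` -/

section Transfer

theorem map_formEval {k A B F : Type*} [Field k] [CommRing A] [CommRing B] [Algebra k A]
    [Algebra k B] [FunLike F A B] [AlgHomClass F k A B] (f : F) (a b : A) (n : ℕ)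
    (c : Fin (n + 1) → k) : f (formEval a b n c) = formEval (f a) (f b) n c := by
  simp only [formEval, map_sum, map_smul, map_mul, map_pow]

theorem span_pair_pow_mul_le {A : Type*} [CommRing A] {m : Ideal A} {a b : A} (ha : a ∈ m)
    (hb : b ∈ m) (n : ℕ) : Ideal.span {a, b} ^ n * m ≤ m ^ (n + 1) := by
  rw [pow_succ]
  refine Ideal.mul_mono_left (Ideal.pow_right_mono ?_ n)
  rw [Ideal.span_le, Set.pair_subset_iff]
  exact ⟨ha, hb⟩

/-- The quotient by a power of the maximal ideal has finite length. -/
theorem length_quotient_maximalIdeal_pow_ne_top {A : Type*} [CommRing A] [IsNoetherianRing A]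
    [IsLocalRing A] {n : ℕ} (hn : n ≠ 0) :
    Module.length A (A ⧸ IsLocalRing.maximalIdeal A ^ n) ≠ ⊤ := by
  have hmin : IsLocalRing.maximalIdeal A ∈ (IsLocalRing.maximalIdeal A ^ n).minimalPrimes := by
    rw [← Ideal.radical_minimalPrimes, Ideal.radical_pow _ hn, Ideal.IsPrime.radical inferInstance,
      Ideal.minimalPrimes_eq_subsingleton_self]
    rfl
  have := IsLocalRing.quotient_artinian_of_mem_minimalPrimes_of_isLocalRing _ hmin
  have : IsArtinian A (A ⧸ IsLocalRing.maximalIdeal A ^ n) :=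
    isArtinian_of_surjective_algebraMap
      (Ideal.Quotient.mk_surjective (I := IsLocalRing.maximalIdeal A ^ n))
  exact Module.length_ne_top

variable {k A B : Type*} [Field k] [CommRing A] [CommRing B] [Algebra k A] [Algebra k B]
  {ι : A →ₐ[k] B} {m : Ideal A} {J : Ideal B} (h : IsFieldPlus ι m J)

theorem map_span_pair (a b : A) : (Ideal.span {a, b}).map ι = Ideal.span {ι a, ι b} := by
  rw [Ideal.map_span, Set.image_pair]

include h

theorem IsFieldPlus.mem_span_pair_mul_iff (a b x : A) (n : ℕ) :
    x ∈ Ideal.span {a, b} ^ n * m ↔ ι x ∈ Ideal.span {ι a, ι b} ^ n * J := by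
  rw [h.mem_mul_iff, Ideal.map_pow, map_span_pair]

theorem IsFieldPlus.mem_span_pair_mul_sq_iff (a b x : A) :
    x ∈ Ideal.span {a, b} * m ^ 2 ↔ ι x ∈ Ideal.span {ι a, ι b} * J ^ 2 := by
  rw [pow_two, ← mul_assoc, h.mem_mul_iff, h.map_mul_eq, map_span_pair, mul_assoc, ← pow_two]

theorem IsFieldPlus.pow_three_eq {a b : A} (ha : a ∈ m) (hb : b ∈ m)
    (hle : J ^ 3 ≤ Ideal.span {ι a, ι b} * J ^ 2) : m ^ 3 = Ideal.span {a, b} * m ^ 2 := by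
  apply le_antisymm
  · intro x hx
    exact (h.mem_span_pair_mul_sq_iff a b x).2 (hle ((h.mem_pow_succ_iff 2 x).1 hx))
  · rw [pow_succ' m 2]
    refine Ideal.mul_mono_left ?_
    rw [Ideal.span_le, Set.pair_subset_iff]
    exact ⟨ha, hb⟩

end Transfer

/-! ### Reductions generated by lifts of `-z` and `-w` -/

section Reductions

variable {k : Type u} [Field k] {A : Type u} [CommRing A] [Algebra k A] {ι : A →ₐ[k] B k}
  {m : Ideal A} (h : IsFieldPlus ι m (J k))

theorem evalZW_eq_zero_of_mem_span {τ : Type*} {s t : MvPowerSeries τ k} (hs : s.constantCoeff = 0)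
    (ht : t.constantCoeff = 0) {b : B k} (hb : b ∈ Ideal.span {v k 0, v k 1}) :
    evalZW k hs ht b = 0 := by
  obtain ⟨f, g, rfl⟩ := Ideal.mem_span_pair.1 hb
  simp [evalZW_v]

include h

/-- The two kernels in the chain of primes come from the homomorphisms `A → B → k[[Z, W]] → k[[W]]`.
-/
theorem ringKrullDim_eq_two_of_isReduction [IsLocalRing A] [IsNoetherianRing A]
    (hmax : IsLocalRing.maximalIdeal A = m) {a b : A} (hred : IsReduction (Ideal.span {a, b}) m) :
    ringKrullDim A = 2 := by
  have : m.IsMaximal := hmax ▸ inferInstance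
  obtain ⟨z, hz⟩ := h.exists_eq _ (z_mem_J k)
  obtain ⟨w, hw⟩ := h.exists_eq _ (w_mem_J k)
  have h0 : MvPowerSeries.constantCoeff (MvPowerSeries.X 0 : MvPowerSeries (Fin 2) k) = 0 := by simp
  have h1 : MvPowerSeries.constantCoeff (MvPowerSeries.X 1 : MvPowerSeries (Fin 2) k) = 0 := by simp
  have hsub : MvPowerSeries.HasSubst (![0, PowerSeries.X] : Fin 2 → MvPowerSeries Unit k) :=
    MvPowerSeries.HasSubst.zero_X
  have hgz : evalZW k h0 h1 (ι z) = MvPowerSeries.X 0 := by rw [hz, evalZW_v]; rfl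
  have hgw : evalZW k h0 h1 (ι w) = MvPowerSeries.X 1 := by rw [hw, evalZW_v]; rfl
  have : IsDomain (MvPowerSeries (Fin 2) k) := NoZeroDivisors.to_isDomain _
  have : IsDomain (MvPowerSeries Unit k) := NoZeroDivisors.to_isDomain _
  refine ringKrullDim_eq_two (D' := MvPowerSeries Unit k) rfl (hred.radical_eq.trans hmax.symm)
    ((evalZW k h0 h1).comp ι).toRingHom
    (MvPowerSeries.substAlgHom (R := k) hsub).toRingHom (z := z) (w := w) ?_ ?_ ?_ ?_
  · change evalZW k h0 h1 (ι z) ≠ 0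
    rw [hgz]
    intro h0
    have := congrArg (MvPowerSeries.coeff (Finsupp.single 0 1)) h0
    simp [MvPowerSeries.coeff_index_single_self_X] at this
  · change MvPowerSeries.substAlgHom (R := k) hsub (evalZW k h0 h1 (ι z)) = 0
    rw [hgz, MvPowerSeries.substAlgHom_X]; rfl
  · change MvPowerSeries.substAlgHom (R := k) hsub (evalZW k h0 h1 (ι w)) ≠ 0
    rw [hgw, MvPowerSeries.substAlgHom_X]
    exact PowerSeries.X_ne_zero
  · rw [hmax, h.mem_iff, hw]; exact w_mem_J k

variable {a b : A} {s t : B k} (hs : s ∈ Ideal.span {v k 0, v k 1})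
  (ht : t ∈ Ideal.span {v k 0, v k 1}) (ha : ι a = s - v k 2) (hb : ι b = t - v k 3)
  (ham : a ∈ m) (hbm : b ∈ m)

include hs ht ha hb ham hbm

theorem analyticallyIndependent_of_mem_span : AnalyticallyIndependent k m a b := by
  intro n c hc
  have h1 := (h.mem_pow_succ_iff n _).1 (span_pair_pow_mul_le ham hbm n hc)
  rw [map_formEval, ha, hb] at h1
  exact eq_zero_of_formEval_mem k hs ht n c h1

omit ham hbm in
/-- The homomorphisms required by the criterion are the evaluations at `x = y = 0`, `z = -c X` and
`w = -d X`. -/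
theorem isMinimalReduction_of_mem_span [IsLocalRing A] [IsNoetherianRing A]
    (hmax : IsLocalRing.maximalIdeal A = m) (hred : IsReduction (Ideal.span {a, b}) m) :
    IsMinimalReduction (Ideal.span {a, b}) m := by
  refine isMinimalReduction_span_pair hmax h.exists_sub_mem hred fun c d => ?_
  have hc : MvPowerSeries.constantCoeff ((-c) • PowerSeries.X : PowerSeries k) = 0 := by
    change PowerSeries.constantCoeff _ = 0
    simp
  have hd : MvPowerSeries.constantCoeff ((-d) • PowerSeries.X : PowerSeries k) = 0 := by
    change PowerSeries.constantCoeff _ = 0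
    simp
  refine ⟨(evalZW k hc hd).comp ι, fun x hx => ?_, ?_, ?_⟩
  · rw [← Ideal.mem_span_singleton]
    exact evalZW_mem k hc hd (Submodule.smul_of_tower_mem _ _ (Ideal.mem_span_singleton_self _))
      (Submodule.smul_of_tower_mem _ _ (Ideal.mem_span_singleton_self _)) ((h.mem_iff x).1 hx)
  · rw [AlgHom.comp_apply, ha, map_sub, evalZW_eq_zero_of_mem_span hc hd hs, evalZW_v]
    change 0 - (-c) • PowerSeries.X = _
    rw [zero_sub, neg_smul, neg_neg]
  · rw [AlgHom.comp_apply, hb, map_sub, evalZW_eq_zero_of_mem_span hc hd ht, evalZW_v]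
    change 0 - (-d) • PowerSeries.X = _
    rw [zero_sub, neg_smul, neg_neg]

theorem isHilbertCoefficient_of_mem_span [IsLocalRing A] [IsNoetherianRing A]
    (hmax : IsLocalRing.maximalIdeal A = m) (hred : IsReduction (Ideal.span {a, b}) m) {s₁ s₀ : ℕ}
    (hS : ∀ᶠ n in atTop, Module.length A (A ⧸ (Ideal.span {a, b} ^ n * m)) =
      Module.length A (A ⧸ m ^ (n + 1)) + ((s₁ * n + s₀ : ℕ) : ℕ∞)) :
    IsHilbertCoefficient (Ideal.span {a, b}) 1 (-5 - (s₁ : ℤ)) := by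
  have : m.IsMaximal := hmax ▸ inferInstance
  exact isHilbertCoefficient_one_of_length (ringKrullDim_eq_two_of_isReduction h hmax hred)
    (hmax ▸ length_quotient_maximalIdeal_pow_ne_top two_ne_zero)
    (fun n hn => length_quotient_maximalIdeal_pow_succ k h hn)
    ((analyticallyIndependent_of_mem_span h hs ht ha hb ham hbm).length_quotient h.exists_sub_mem)
    hS

end Reductions

/-! ### The reductions `(x² - z, y² - w)` and `(xy - z, x² + y² - w)` -/

section Comparison

section

variable (k : Type u) [Field k]

theorem sq_mem_span (i : Fin 4) (hi : i = 0 ∨ i = 1) :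
    v k i ^ 2 ∈ Ideal.span {v k 0, v k 1} := by
  rw [pow_two]
  exact Ideal.mul_mem_right _ _ (Ideal.subset_span (by rcases hi with rfl | rfl <;> simp))

theorem mem_span_mixed : v k 0 * v k 1 ∈ Ideal.span {v k 0, v k 1} ∧
    v k 0 ^ 2 + v k 1 ^ 2 ∈ Ideal.span {v k 0, v k 1} :=
  ⟨Ideal.mul_mem_right _ _ (Ideal.subset_span (Or.inl rfl)),
    add_mem (sq_mem_span k 0 (Or.inl rfl)) (sq_mem_span k 1 (Or.inr rfl))⟩

end

variable {k : Type u} [Field k] {A : Type u} [CommRing A] [Algebra k A] {ι : A →ₐ[k] B k}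
  {m : Ideal A} (h : IsFieldPlus ι m (J k)) {p q r z w : A} (hp : ι p = v k 0 ^ 2)
  (hq : ι q = v k 1 ^ 2) (hr : ι r = v k 0 * v k 1) (hz : ι z = v k 2) (hw : ι w = v k 3)

include h hp hq hr hz hw

theorem mem_of_map_eq : p ∈ m ∧ q ∈ m ∧ r ∈ m ∧ z ∈ m ∧ w ∈ m := by
  rw [h.mem_iff, h.mem_iff, h.mem_iff, h.mem_iff, h.mem_iff, hp, hq, hr, hz, hw]
  exact ⟨x_sq_mem_J k, y_sq_mem_J k, mul_mem_J k (Or.inl rfl) (Or.inr rfl), z_mem_J k, w_mem_J k⟩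

omit hr in
theorem mul_eq_zero_of_map_eq : p * z = 0 ∧ p * w = 0 ∧ q * z = 0 ∧ q * w = 0 := by
  obtain ⟨hxz, hxw, hyz, hyw⟩ := relations k
  refine ⟨h.injective ?_, h.injective ?_, h.injective ?_, h.injective ?_⟩ <;>
    simp only [map_mul, map_zero, *]

/-- The square of `m` is spanned by `r p` and `r q` modulo `(p - z, q - w) m`. -/
theorem sq_le_sup_squares : m ^ 2 ≤
    Ideal.span {p - z, q - w} * m ⊔ Ideal.span {r} * Ideal.span {p, q} := by
  intro x hx
  obtain ⟨c, d, hcd⟩ := (relations k).exists_sub_smul_mem (exists_eq_add_mem_J k)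
    ((h.mem_pow_succ_iff 1 x).1 hx)
  have h1 : x - (c • (r * p) + d • (r * q)) ∈ Ideal.span {p - z, q - w} * m := by
    rw [← pow_one (Ideal.span {p - z, q - w}), h.mem_span_pair_mul_iff]
    simp only [map_sub, map_add, map_smul, map_mul, hp, hq, hr, hz, hw, pow_one]
    exact hcd
  rw [← sub_add_cancel x (c • (r * p) + d • (r * q))]
  refine Submodule.add_mem_sup h1 (add_mem (smul_mem_ideal _ _ ?_) (smul_mem_ideal _ _ ?_)) <;>
    refine Ideal.mul_mem_mul (Ideal.mem_span_singleton_self r) (Ideal.subset_span ?_)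
  · exact Or.inl rfl
  · exact Or.inr rfl

theorem span_mul_span_mul_le :
    Ideal.span {r} * Ideal.span {p, q} * m ≤ Ideal.span {p - z, q - w} * m ^ 2 := by
  rw [Ideal.mul_le]
  intro y hy x hx
  obtain ⟨y', hy', rfl⟩ := Ideal.mem_span_singleton_mul.1 hy
  obtain ⟨c, d, rfl⟩ := Ideal.mem_span_pair.1 hy'
  have h1 : r * p * x ∈ Ideal.span {p - z, q - w} * m ^ 2 := by
    rw [h.mem_span_pair_mul_sq_iff, map_mul, map_mul, map_sub, map_sub, hp, hq, hr, hz, hw]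
    exact (relations k).xxxy_mul_mem ((h.mem_iff x).1 hx)
  have h2 : r * q * x ∈ Ideal.span {p - z, q - w} * m ^ 2 := by
    rw [h.mem_span_pair_mul_sq_iff, map_mul, map_mul, map_sub, map_sub, hp, hq, hr, hz, hw]
    exact (relations k).xyyy_mul_mem ((h.mem_iff x).1 hx)
  convert add_mem (Ideal.mul_mem_left _ c h1) (Ideal.mul_mem_left _ d h2) using 1
  ring

theorem eq_zero_of_mul_formEval_mem_span (n : ℕ) (c : Fin (n + 2) → k)
    (hc : r * formEval p q (n + 1) c ∈ Ideal.span {p - z, q - w} ^ (n + 1) * m) : c = 0 := by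
  refine eq_zero_of_mul_formEval_mem k n c ?_
  have h1 := (Ideal.mul_le_inf ((h.mem_span_pair_mul_iff _ _ _ _).1 hc)).1
  simp only [map_sub, map_mul, map_formEval, hp, hq, hr, hz, hw] at h1
  exact h1

theorem pow_three_eq_squares : m ^ 3 = Ideal.span {p - z, q - w} * m ^ 2 := by
  obtain ⟨hpm, hqm, -, hzm, hwm⟩ := mem_of_map_eq h hp hq hr hz hw
  refine h.pow_three_eq (sub_mem hpm hzm) (sub_mem hqm hwm) ?_
  rw [map_sub, map_sub, hp, hq, hz, hw]
  exact (relations k).cube_le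

theorem isReduction_squares : IsReduction (Ideal.span {p - z, q - w}) m := by
  obtain ⟨hpm, hqm, -, hzm, hwm⟩ := mem_of_map_eq h hp hq hr hz hw
  refine ⟨?_, 2, pow_three_eq_squares h hp hq hr hz hw⟩
  rw [Ideal.span_le, Set.pair_subset_iff]
  exact ⟨sub_mem hpm hzm, sub_mem hqm hwm⟩

theorem isMinimalReduction_squares [IsLocalRing A] [IsNoetherianRing A]
    (hmax : IsLocalRing.maximalIdeal A = m) :
    IsMinimalReduction (Ideal.span {p - z, q - w}) m :=
  isMinimalReduction_of_mem_span h (sq_mem_span k 0 (Or.inl rfl)) (sq_mem_span k 1 (Or.inr rfl))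
    (by rw [map_sub, hp, hz]) (by rw [map_sub, hq, hw]) hmax (isReduction_squares h hp hq hr hz hw)

theorem analyticallyIndependent_squares : AnalyticallyIndependent k m (p - z) (q - w) := by
  obtain ⟨hpm, hqm, -, hzm, hwm⟩ := mem_of_map_eq h hp hq hr hz hw
  exact analyticallyIndependent_of_mem_span h (sq_mem_span k 0 (Or.inl rfl))
    (sq_mem_span k 1 (Or.inr rfl)) (by rw [map_sub, hp, hz]) (by rw [map_sub, hq, hw])
    (sub_mem hpm hzm) (sub_mem hqm hwm)

/-- For `Q = (p - z, q - w)` and `𝔭 = m R(Q)`, the Sally module has length one at `𝔭`. -/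
theorem hasLocalSallyLength_squares :
    HasLocalSallyLength (Ideal.span {p - z, q - w}) m 1 := by
  obtain ⟨hpm, hqm, hrm, hzm, hwm⟩ := mem_of_map_eq h hp hq hr hz hw
  obtain ⟨hpz, hpw, hqz, hqw⟩ := mul_eq_zero_of_map_eq h hp hq hz hw
  exact hasLocalSallyLength_one_of_linear hpz hpw hqz hqw (pow_three_eq_squares h hp hq hr hz hw)
    (sq_le_sup_squares h hp hq hr hz hw) (span_mul_span_mul_le h hp hq hr hz hw) hrm hpm hqm hzm hwm
    h.exists_sub_mem (eq_zero_of_mul_formEval_mem_span h hp hq hr hz hw)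
    (analyticallyIndependent_squares h hp hq hr hz hw)

/-- The components of the Sally module have length `n + 1` for `n ≥ 1`, which lowers the coefficient
to `-6`. -/
theorem isHilbertCoefficient_squares [IsLocalRing A] [IsNoetherianRing A]
    (hmax : IsLocalRing.maximalIdeal A = m) :
    IsHilbertCoefficient (Ideal.span {p - z, q - w}) 1 (-6) := by
  have : m.IsMaximal := hmax ▸ inferInstance
  obtain ⟨hpm, hqm, hrm, hzm, hwm⟩ := mem_of_map_eq h hp hq hr hz hw
  obtain ⟨hpz, hpw, hqz, hqw⟩ := mul_eq_zero_of_map_eq h hp hq hz hw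
  refine isHilbertCoefficient_of_mem_span h (sq_mem_span k 0 (Or.inl rfl))
    (sq_mem_span k 1 (Or.inr rfl)) (by rw [map_sub, hp, hz]) (by rw [map_sub, hq, hw])
    (sub_mem hpm hzm) (sub_mem hqm hwm) hmax (isReduction_squares h hp hq hr hz hw)
    (s₁ := 1) (s₀ := 1) ?_
  filter_upwards [eventually_ge_atTop 1] with n hn
  obtain ⟨n, rfl⟩ := Nat.exists_eq_add_of_le' hn
  rw [length_quotient_eq_add_of_linear hpz hpw hqz hqw (pow_three_eq_squares h hp hq hr hz hw)
    (sq_le_sup_squares h hp hq hr hz hw) (span_mul_span_mul_le h hp hq hr hz hw) hrm hpm hqm hzm hwm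
    h.exists_sub_mem (eq_zero_of_mul_formEval_mem_span h hp hq hr hz hw) n]
  congr 2
  ring

theorem mem_mixed : r - z ∈ m ∧ p + q - w ∈ m := by
  obtain ⟨hpm, hqm, hrm, hzm, hwm⟩ := mem_of_map_eq h hp hq hr hz hw
  exact ⟨sub_mem hrm hzm, sub_mem (add_mem hpm hqm) hwm⟩

omit h in
theorem map_mixed : ι (r - z) = v k 0 * v k 1 - v k 2 ∧
    ι (p + q - w) = v k 0 ^ 2 + v k 1 ^ 2 - v k 3 := by
  rw [map_sub, map_sub, map_add, hp, hq, hr, hz, hw]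
  exact ⟨rfl, rfl⟩

theorem pow_three_eq_mixed : m ^ 3 = Ideal.span {r - z, p + q - w} * m ^ 2 := by
  obtain ⟨ham, hbm⟩ := mem_mixed h hp hq hr hz hw
  obtain ⟨ha, hb⟩ := map_mixed hp hq hr hz hw
  refine h.pow_three_eq ham hbm ?_
  rw [ha, hb]
  exact (relations k).cube_le'

theorem isReduction_mixed : IsReduction (Ideal.span {r - z, p + q - w}) m := by
  refine ⟨?_, 2, pow_three_eq_mixed h hp hq hr hz hw⟩
  rw [Ideal.span_le, Set.pair_subset_iff]
  exact mem_mixed h hp hq hr hz hw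

theorem isMinimalReduction_mixed [IsLocalRing A] [IsNoetherianRing A]
    (hmax : IsLocalRing.maximalIdeal A = m) :
    IsMinimalReduction (Ideal.span {r - z, p + q - w}) m :=
  isMinimalReduction_of_mem_span h (mem_span_mixed k).1 (mem_span_mixed k).2
    (map_mixed hp hq hr hz hw).1 (map_mixed hp hq hr hz hw).2 hmax
    (isReduction_mixed h hp hq hr hz hw)

theorem analyticallyIndependent_mixed :
    AnalyticallyIndependent k m (r - z) (p + q - w) :=
  analyticallyIndependent_of_mem_span h (mem_span_mixed k).1 (mem_span_mixed k).2
    (map_mixed hp hq hr hz hw).1 (map_mixed hp hq hr hz hw).2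
    (mem_mixed h hp hq hr hz hw).1 (mem_mixed h hp hq hr hz hw).2

theorem sq_le_sup_mixed :
    m ^ 2 ≤ Ideal.span {r - z, p + q - w} * m ⊔ Ideal.span {r ^ 2} := by
  intro x hx
  obtain ⟨ha, hb⟩ := map_mixed hp hq hr hz hw
  obtain ⟨c, hc⟩ := (relations k).exists_sub_smul_mem' (exists_eq_add_mem_J k)
    ((h.mem_pow_succ_iff 1 x).1 hx)
  have h1 : x - c • r ^ 2 ∈ Ideal.span {r - z, p + q - w} * m := by
    rw [← pow_one (Ideal.span {r - z, p + q - w}), h.mem_span_pair_mul_iff, ha, hb, pow_one,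
      map_sub, map_smul, map_pow, hr]
    exact hc
  rw [← sub_add_cancel x (c • r ^ 2)]
  exact Submodule.add_mem_sup h1 (smul_mem_ideal _ _ (Ideal.mem_span_singleton_self _))

theorem sq_mul_mem_mixed {x : A} (hx : x ∈ m) :
    r ^ 2 * x ∈ Ideal.span {r - z, p + q - w} * m := by
  obtain ⟨ha, hb⟩ := map_mixed hp hq hr hz hw
  refine Ideal.mul_mono_right (Ideal.pow_le_self two_ne_zero) ?_
  rw [h.mem_span_pair_mul_sq_iff, ha, hb, map_mul, map_pow, hr]
  exact (relations k).xy_sq_mul_mem ((h.mem_iff x).1 hx)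

theorem mul_sq_mem_mixed :
    (p + q - w) * r ^ 2 ∈ Ideal.span {r - z, p + q - w} ^ 2 * m := by
  obtain ⟨ha, hb⟩ := map_mixed hp hq hr hz hw
  rw [h.mem_span_pair_mul_iff, ha, map_mul, hb, map_pow, hr]
  exact (relations k).mul_xy_sq_mem

/-- For `Q' = (r - z, p + q - w)` and `𝔭' = m R(Q')`, the Sally module vanishes at `𝔭'`. -/
theorem hasLocalSallyLength_mixed : HasLocalSallyLength (Ideal.span {r - z, p + q - w}) m 0 := by
  obtain ⟨ham, hbm⟩ := mem_mixed h hp hq hr hz hw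
  exact hasLocalSallyLength_zero_of_square (pow_three_eq_mixed h hp hq hr hz hw)
    (sq_le_sup_mixed h hp hq hr hz hw) (mul_sq_mem_mixed h hp hq hr hz hw) h.exists_sub_mem
    ham hbm (analyticallyIndependent_mixed h hp hq hr hz hw)

/-- The components of the Sally module have eventually constant length, and the coefficient is `-5`.
-/
theorem isHilbertCoefficient_mixed [IsLocalRing A] [IsNoetherianRing A]
    (hmax : IsLocalRing.maximalIdeal A = m) :
    IsHilbertCoefficient (Ideal.span {r - z, p + q - w}) 1 (-5) := by
  have : m.IsMaximal := hmax ▸ inferInstance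
  obtain ⟨ham, hbm⟩ := mem_mixed h hp hq hr hz hw
  obtain ⟨ha, hb⟩ := map_mixed hp hq hr hz hw
  obtain ⟨-, -, hrm, -, -⟩ := mem_of_map_eq h hp hq hr hz hw
  obtain ⟨s₀, hs₀⟩ := exists_eventually_length_quotient_eq_add
    (pow_three_eq_mixed h hp hq hr hz hw) (sq_le_sup_mixed h hp hq hr hz hw)
    (fun x hx => sq_mul_mem_mixed h hp hq hr hz hw hx) (mul_sq_mem_mixed h hp hq hr hz hw)
    h.exists_sub_mem ham hbm (Ideal.pow_mem_pow hrm 2)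
  have := isHilbertCoefficient_of_mem_span h (mem_span_mixed k).1 (mem_span_mixed k).2 ha hb
    ham hbm hmax (isReduction_mixed h hp hq hr hz hw) (s₁ := 0) (s₀ := s₀) (by simpa using hs₀)
  simpa using this

end Comparison

/-! ### The set `Λ` -/

section Lambda

/-- A reduction of the maximal ideal generated by two elements is a parameter ideal with the same
integral closure as the maximal ideal, so that its first Hilbert coefficient belongs to `Λ`. -/
theorem mem_Lambda_of_isReduction {A : Type u} [CommRing A] [IsNoetherianRing A] [IsLocalRing A]
    {a b : A} (hdim : ringKrullDim A = 2)
    (hred : IsReduction (Ideal.span {a, b}) (IsLocalRing.maximalIdeal A)) {c : ℤ}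
    (hc : IsHilbertCoefficient (Ideal.span {a, b}) 1 c) :
    c ∈ Lambda (IsLocalRing.maximalIdeal A) :=
  ⟨_, isParameterIdeal_span_pair hdim hred.radical_eq,
    hred.idealIntegralClosure_eq.trans idealIntegralClosure_self.symm, hc⟩

theorem not_lambdaAlwaysSingleton {A : Type u} [CommRing A] [IsNoetherianRing A] [IsLocalRing A]
    (hdim : 0 < ringKrullDim A) (h : 1 < (Lambda (IsLocalRing.maximalIdeal A)).encard) :
    ¬ LambdaAlwaysSingleton.{u} := fun hL =>
  h.ne' (hL A hdim _ (Ideal.IsPrime.radical inferInstance))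

end Lambda

end HilbertCoeff

end

open HilbertCoeff in
theorem mainTheorem5 (k : Type u) [Field k] :
    IsNoetherianRing (HilbertCoeff.A k) ∧
    Module.Finite (HilbertCoeff.A k) (HilbertCoeff.B k) ∧
    ringKrullDim (HilbertCoeff.A k) = 2 ∧
    (∃ _ : IsLocalRing (HilbertCoeff.A k),
      IsLocalRing.maximalIdeal (HilbertCoeff.A k) =
        (HilbertCoeff.J k).comap (HilbertCoeff.A k).val ∧
      HilbertCoeff.IsParameterIdeal (HilbertCoeff.Q k) ∧
      HilbertCoeff.IsParameterIdeal (HilbertCoeff.Q' k) ∧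
      HilbertCoeff.IsMinimalReduction (HilbertCoeff.Q k)
        (IsLocalRing.maximalIdeal (HilbertCoeff.A k)) ∧
      HilbertCoeff.IsMinimalReduction (HilbertCoeff.Q' k)
        (IsLocalRing.maximalIdeal (HilbertCoeff.A k)) ∧
      (∃ e e' : ℤ,
        HilbertCoeff.IsHilbertCoefficient (HilbertCoeff.Q k) 1 e ∧
        HilbertCoeff.IsHilbertCoefficient (HilbertCoeff.Q' k) 1 e' ∧
        e' = e + 1 ∧ e + 1 = -5) ∧
      HilbertCoeff.HasLocalSallyLength (HilbertCoeff.Q k)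
        (IsLocalRing.maximalIdeal (HilbertCoeff.A k)) 1 ∧
      HilbertCoeff.HasLocalSallyLength (HilbertCoeff.Q' k)
        (IsLocalRing.maximalIdeal (HilbertCoeff.A k)) 0 ∧
      1 < (HilbertCoeff.Lambda (IsLocalRing.maximalIdeal (HilbertCoeff.A k))).encard) ∧
    ¬ HilbertCoeff.LambdaAlwaysSingleton.{u} := by
  have hBloc := isLocalRing_quotient_idealK k
  have hfin := finite_quotient_J k
  have hloc : IsLocalRing (A k) := isLocalRing_fieldPlus (J_ne_top k)
  have hnoeth : IsNoetherianRing (A k) := isNoetherianRing_fieldPlus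
  have hmax : IsLocalRing.maximalIdeal (A k) = idealFieldPlus k (J k) :=
    maximalIdeal_fieldPlus (J_ne_top k)
  have hmaximal : (idealFieldPlus k (J k)).IsMaximal := hmax ▸ inferInstance
  have h := isFieldPlus_fieldPlus k (J k)
  -- the elements `p = x²`, `q = y²`, `r = xy`, `z` and `w` of `A`
  let p : A k := ofJ k _ (x_sq_mem_J k)
  let q : A k := ofJ k _ (y_sq_mem_J k)
  let r : A k := ofJ k _ (mul_mem_J k (Or.inl rfl) (Or.inr rfl))
  let z : A k := ofJ k _ (z_mem_J k)
  let w : A k := ofJ k _ (w_mem_J k)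
  have hp : (A k).val p = v k 0 ^ 2 := rfl
  have hq : (A k).val q = v k 1 ^ 2 := rfl
  have hr : (A k).val r = v k 0 * v k 1 := rfl
  have hz : (A k).val z = v k 2 := rfl
  have hw : (A k).val w = v k 3 := rfl
  have hQ : Q k = Ideal.span {p - z, q - w} := rfl
  have hQ' : Q' k = Ideal.span {r - z, p + q - w} := rfl
  have hred := isReduction_squares h hp hq hr hz hw
  have hred' := isReduction_mixed h hp hq hr hz hw
  have hdim := ringKrullDim_eq_two_of_isReduction h hmax hred
  have hc := isHilbertCoefficient_squares h hp hq hr hz hw hmax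
  have hc' := isHilbertCoefficient_mixed h hp hq hr hz hw hmax
  have hLambda : 1 < (Lambda (IsLocalRing.maximalIdeal (A k))).encard :=
    Set.one_lt_encard_iff.2 ⟨-6, -5,
      mem_Lambda_of_isReduction hdim (hmax.symm ▸ hred) hc,
      mem_Lambda_of_isReduction hdim (hmax.symm ▸ hred') hc', by norm_num⟩
  refine ⟨hnoeth, finite_fieldPlus, hdim, ⟨hloc, hmax, ?_, ?_, ?_, ?_, ?_, ?_, ?_, hLambda⟩,
    not_lambdaAlwaysSingleton (by rw [hdim]; norm_num) hLambda⟩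
  · rw [hQ]
    exact isParameterIdeal_span_pair hdim (hred.radical_eq.trans hmax.symm)
  · rw [hQ']
    exact isParameterIdeal_span_pair hdim (hred'.radical_eq.trans hmax.symm)
  · rw [hQ, hmax]
    exact isMinimalReduction_squares h hp hq hr hz hw hmax
  · rw [hQ', hmax]
    exact isMinimalReduction_mixed h hp hq hr hz hw hmax
  · rw [hQ, hQ']
    exact ⟨-6, -5, hc, hc', by norm_num, by norm_num⟩
  · rw [hQ, hmax]
    exact hasLocalSallyLength_squares h hp hq hr hz hw
  · rw [hQ', hmax]
    exact hasLocalSallyLength_mixed h hp hq hr hz hw
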